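/- **Graphs.** Let $\Gamma$ be a commutative group. The gates are: $\lambda$ (one entry, edge $1$; a left exit, edge $2$; a right exit, edge $3$), $\Upsilon$ (one entry, a left and a right exit), $\curlywedge$ (a left and a right entry, one exit), $\bar\varepsilon$ for each $\varepsilon\in\Gamma$ (a left and a right entry, one exit), $\top$ (one entry). $GRAPH$ is the set of finite graphs obtained from finitely many gates by grafting exits to entries, each at most once; edges may have free extremities (leaves, which are IN if the source is missing and OUT if the target is missing, and which carry no names), and arrows without nodes (wires and loops) are allowed. Graphs are considered up to isomorphism respecting gates and ports. A graph is in $\lambda GRAPH$ if it has no $\bar\varepsilon$ gate and, for each $\lambda$ node, every oriented path that starts at edge $2$ of the node and has not come back through the node can be completed to an oriented path that terminates in a $\top$ gate or at edge $1$ of the node. **Moves** (each replaces a part of a graph and keeps the rest). Write $\lambda(a;b,c)$, $\Upsilon(a;b,c)$ for gates with entry $a$ and exits $b$ (left), $c$ (right), and $\curlywedge(a,b;c)$ for the gate with entries $a$ (left), $b$ (right) and exit $c$. * Graphic $\beta$ move: $\lambda(1;2,c),\ \curlywedge(c,4;3)$ is replaced by the arrows $1\to3$ and $4\to2$. * CO-ASSOC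 (both directions): $\Upsilon(a;m,3),\Upsilon(m;1,2)\ \leftrightarrow\ \Upsilon(a;1,m),\Upsilon(m;2,3)$. * Global FAN-OUT (both directions): if $A$ is a graph with exactly one OUT leaf $u$ (and any IN leaves) that is connected to the rest only through a gate $\Upsilon(u;p,q)$, then $A$ and this gate are replaced by two disjoint copies of $A$, with outputs $p$ and $q$; and conversely. (In particular $A$ may be a wire.) * Pruning (one direction only). Local: an $\Upsilon$ gate with one exit ending in $\top$ becomes an arrow from its entry to the other exit; a $\curlywedge$ or $\bar\varepsilon$ gate whose exit ends in $\top$ is replaced by $\top$ gates at its two entries. Global: a graph with exactly one OUT leaf, which ends in a $\top$ gate, and with no other connection to the rest, is erased together with this $\top$. * ext1: $\curlywedge(1,t;s),\ \lambda(s;t,2)$ is replaced by the arrow $1\to2$, if there is no oriented path from $2$ to $1$. **Conversion.** Let $X$ be an infinite set of variables and $T(X)$ the set of lambda terms over $X$. In the syntactic tree of $A\in T(X)$, each application $MN$ is a gate $\curlywedge$ with left entry the root of $M$ and right entry the root of $N$, and each abstraction $\lambda x.M$ is a gate $\lambda$ with edge $1$ the root of $M$, edge $2$ decorated by $x$, and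 edge $3$ its root; the leaves of the tree are the occurrences of variables and these left legs of the $\lambda$ gates. A graph $[A]$ is obtained as follows. For every abstraction, edge $2$ ends in a $\top$ gate if it binds no occurrence, and otherwise is the root of a planar binary tree of $\Upsilon$ gates (an arrow, if there is one occurrence) whose leaves are grafted, in the order from left to right, to the occurrences it binds (each bound occurrence is bound by the innermost abstraction of its variable). Then, for every free variable, its occurrences are grafted in the same way, from left to right, to the leaves of such a tree of $\Upsilon$ gates with a free root (an IN leaf). Any binary trees may be chosen; every graph so obtained is called a transformation $[A]$ of $A$. **Theorem 3.1.** 1. (a) Every term $A$ has a transformation, and every transformation $[A]$ of $A$ is in $\lambda GRAPH$. 2. (b) If $[A]'$ and $[A]''$ are transformations of the term $A$, then one can pass from $[A]'$ to $[A]''$ by at most $2^{n}$ CO-ASSOC moves, where $n$ is the number of leaves of the syntactic tree of $A$. 3. (c) If $B$ is obtained from $A$ by $\alpha$-conversion, and $[A]$, $[B]$ are any transformations of $A$, $B$, then one can pass from $[A]$ to $[B]$ by a finite sequence of CO-ASSOC moves. 4. (d) Let $A,B\in T(X)$, $x\in X$, and let $A[x:=B]$ be the result of the capture-avoiding substitution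 of $B$ for the free occurrences of $x$ in $A$. From any transformation $[(\lambda x.A)B]$ one passes, by one graphic $\beta$ move, to a graph that can be further transformed into a transformation of $A[x:=B]$ by a finite sequence of global FAN-OUT, CO-ASSOC and (local or global) pruning moves. 5. (e) Let $A\in T(X)$ and $x\in X$ with $x\notin FV(A)$. Every transformation $[\lambda x.Ax]$ is carried to a transformation of $A$ by one ext1 move, and every transformation of $A$ arises by one ext1 move from a transformation of $\lambda x.Ax$. -/

import Mathlib

open Relation

namespace GLC

/-! ### Lambda terms -/

/-- The set `T(X)` of lambda terms over the variable set `X`. -/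
inductive Term (X : Type*) where
  | var (x : X) : Term X
  | app (M N : Term X) : Term X
  | lam (x : X) (M : Term X) : Term X

namespace Term

variable {X : Type*}

/-- Number of leaves of the syntactic tree. The gate of an abstraction `λ x. M` has the leaf `x` on
its left leg and the tree of `M` on its right leg. -/
def leaves : Term X → ℕ
  | var _ => 1
  | app M N => M.leaves + N.leaves
  | lam _ M => 1 + M.leaves

variable [DecidableEq X]

/-- Free variables. -/
def fv : Term X → Finset X
  | var x => {x}
  | app M N => M.fv ∪ N.fv
  | lam x M => M.fv.erase x

open Classical in
/-- A variable outside the finite set `S`: the variable `y` itself if possible. -/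
noncomputable def fresh [Infinite X] (y : X) (S : Finset X) : X :=
  if y ∈ S then (Infinite.exists_notMem_finset S).choose else y

/-- Simultaneous capture-avoiding substitution: a bound variable is renamed when it is free in one
of the terms substituted below it. -/
noncomputable def substAll [Infinite X] : Term X → (X → Term X) → Term X
  | var x, σ => σ x
  | app M N, σ => app (M.substAll σ) (N.substAll σ)
  | lam y M, σ =>
      let z := fresh y ((M.fv.erase y).biUnion fun w => (σ w).fv)
      lam z (M.substAll (Function.update σ y (var z)))

/-- `A[x := B]`, capture-avoiding. -/
noncomputable def subst [Infinite X] (A : Term X) (x : X) (B : Term X) : Term X :=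
  A.substAll (Function.update var x B)

/-- `α`-conversion: the congruence generated by `λ x. M = λ y. M[x := y]` for `y ∉ FV(M)`. -/
inductive Alpha [Infinite X] : Term X → Term X → Prop
  | rename (x y : X) (M : Term X) : y ∉ M.fv → Alpha (lam x M) (lam y (M.subst x (var y)))
  | app {M M' N N' : Term X} : Alpha M M' → Alpha N N' → Alpha (app M N) (app M' N')
  | lam (x : X) {M M' : Term X} : Alpha M M' → Alpha (lam x M) (lam x M')
  | refl (M : Term X) : Alpha M M
  | symm {M N : Term X} : Alpha M N → Alpha N M
  | trans {M N P : Term X} : Alpha M N → Alpha N P → Alpha M P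

end Term

/-! ### Graphs

A graph is presented by the finite multiset of its gates, each gate carrying the names (natural
numbers) of the edges at its ports. An edge goes from the gate that has its name at an exit port to
the gate that has its name at an entry port; if one of the two is missing, that extremity is free,
i.e. it is a leaf (`IN` if there is no source, `OUT` if there is no target). The auxiliary `arrow`
is not a node: `arrow a b` says that the arrow `a` continues as the arrow `b`. It presents wires
(`arrow a b` with `a`, `b` not used elsewhere) and loops (`arrow a a`). -/

/-- Gates with named edges. The local planar structure is given by the roles of the ports. -/
inductive Gate (Γ : Type*) where
  /-- `λ`: one entry (edge 1), a left exit (edge 2), a right exit (edge 3) -/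
  | lam (inp left right : ℕ)
  /-- `Υ`: one entry, a left exit, a right exit -/
  | fan (inp left right : ℕ)
  /-- `⋏`: a left entry, a right entry, one exit -/
  | app (left right out : ℕ)
  /-- the gate of `ε ∈ Γ`: a left entry, a right entry, one exit -/
  | eps (ε : Γ) (left right out : ℕ)
  /-- `⊤`: one entry -/
  | top (inp : ℕ)
  /-- an arrow without nodes -/
  | arrow (src tgt : ℕ)

namespace Gate

variable {Γ : Type*}

/-- Edges that enter the gate. -/
def ins : Gate Γ → Multiset ℕ
  | lam a _ _ => {a}
  | fan a _ _ => {a}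
  | app a b _ => {a, b}
  | eps _ a b _ => {a, b}
  | top a => {a}
  | arrow a _ => {a}

/-- Edges that leave the gate. -/
def outs : Gate Γ → Multiset ℕ
  | lam _ b c => {b, c}
  | fan _ b c => {b, c}
  | app _ _ c => {c}
  | eps _ _ _ c => {c}
  | top _ => 0
  | arrow _ b => {b}

/-- Renaming of edges. -/
def rename (f : ℕ → ℕ) : Gate Γ → Gate Γ
  | lam a b c => lam (f a) (f b) (f c)
  | fan a b c => fan (f a) (f b) (f c)
  | app a b c => app (f a) (f b) (f c)
  | eps ε a b c => eps ε (f a) (f b) (f c)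
  | top a => top (f a)
  | arrow a b => arrow (f a) (f b)

end Gate

/-- A finite collection of gates with named edges. -/
abbrev Gates (Γ : Type*) := Multiset (Gate Γ)

namespace Gates

variable {Γ : Type*}

def ins (D : Gates Γ) : Multiset ℕ := Multiset.bind D Gate.ins

def outs (D : Gates Γ) : Multiset ℕ := Multiset.bind D Gate.outs

/-- `n` is the name of an edge of `D`. -/
def HasEdge (D : Gates Γ) (n : ℕ) : Prop := n ∈ ins D ∨ n ∈ outs D

def rename (f : ℕ → ℕ) (D : Gates Γ) : Gates Γ := Multiset.map (Gate.rename f) D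

/-- Every edge is grafted at most once at each of its two extremities. -/
def IsLinear (D : Gates Γ) : Prop := (ins D).Nodup ∧ (outs D).Nodup

/-- There is an oriented path from the edge `a` to the edge `b` through gates of `D`. -/
def Reach (D : Gates Γ) : ℕ → ℕ → Prop :=
  ReflTransGen fun a b => ∃ g ∈ D, a ∈ g.ins ∧ b ∈ g.outs

/-- `u` is the one and only `OUT` leaf of `A`. -/
def OneOutput (A : Gates Γ) (u : ℕ) : Prop :=
  ∀ n, (n ∈ outs A ∧ n ∉ ins A) ↔ n = u

end Gates

/-- Presentations of elements of `GRAPH`. -/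
def Presentation (Γ : Type*) := {D : Gates Γ // D.IsLinear}

/-- Two presentations of the same graph: the names of the edges are immaterial, and an arrow that is
grafted to something else is absorbed. -/
inductive SameGraph {Γ : Type*} : Presentation Γ → Presentation Γ → Prop
  | rename (D D' : Presentation Γ) (f : ℕ → ℕ) :
      Set.InjOn f {n | D.1.HasEdge n} → D'.1 = D.1.rename f → SameGraph D D'
  | absorb (D D' : Presentation Γ) (C : Gates Γ) (a b : ℕ) :
      a ≠ b → C.HasEdge a ∨ C.HasEdge b →
      D.1 = Gate.arrow a b ::ₘ C → D'.1 = C.rename (Function.update id b a) → SameGraph D D'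

/-- The set `GRAPH` over the graphical alphabet: presentations up to the equivalence relation
generated by `SameGraph`. -/
def GRAPH (Γ : Type*) := Quot (SameGraph (Γ := Γ))

/-- The graph given by a presentation. -/
def Presentation.graph {Γ : Type*} (D : Presentation Γ) : GRAPH Γ := Quot.mk _ D

/-! ### The set of lambda graphs -/

/-- No gate of an `ε ∈ Γ`, and for every `λ` node with edges `1 = p`, `2 = v`, `3 = r`, every
oriented path that starts at `v` and has not come back through this node can be completed to a path
that terminates in a `⊤` gate or at the edge `p`. (`C` is the rest of the graph.) -/
def Gates.IsLambda {Γ : Type*} (D : Gates Γ) : Prop :=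
  (∀ ε a b c, Gate.eps ε a b c ∉ D) ∧
  ∀ (C : Gates Γ) (p v r : ℕ), D = Gate.lam p v r ::ₘ C →
    ∀ e, C.Reach v e → (∃ t, Gate.top t ∈ C ∧ C.Reach e t) ∨ C.Reach e p

/-- The set `λGRAPH`. -/
def lambdaGRAPH (Γ : Type*) : Set (GRAPH Γ) :=
  {G | ∀ D : Presentation Γ, D.graph = G → D.1.IsLambda}

/-! ### Moves

In each move `C` is the part of the graph that is kept unchanged. -/

section Moves

variable {Γ : Type*}

/-- The graphic `β` move, from the pattern with the gates `λ`, `⋏` to the two arrows `1 → 3`,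
`4 → 2`. -/
inductive BetaMove : GRAPH Γ → GRAPH Γ → Prop
  | mk (D D' : Presentation Γ) (C : Gates Γ) (e₁ e₂ e₃ e₄ c : ℕ) :
      D.1 = C + {Gate.lam e₁ e₂ c, Gate.app c e₄ e₃} →
      D'.1 = C + {Gate.arrow e₁ e₃, Gate.arrow e₄ e₂} →
      BetaMove D.graph D'.graph

/-- The (CO-ASSOC) move, in both directions. -/
inductive CoAssocMove : GRAPH Γ → GRAPH Γ → Prop
  | right (D D' : Presentation Γ) (C : Gates Γ) (a m e₁ e₂ e₃ : ℕ) :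
      D.1 = C + {Gate.fan a m e₃, Gate.fan m e₁ e₂} →
      D'.1 = C + {Gate.fan a e₁ m, Gate.fan m e₂ e₃} →
      CoAssocMove D.graph D'.graph
  | left (D D' : Presentation Γ) (C : Gates Γ) (a m e₁ e₂ e₃ : ℕ) :
      D.1 = C + {Gate.fan a e₁ m, Gate.fan m e₂ e₃} →
      D'.1 = C + {Gate.fan a m e₃, Gate.fan m e₁ e₂} →
      CoAssocMove D.graph D'.graph

/-- Local pruning. -/
inductive LocalPruning : GRAPH Γ → GRAPH Γ → Prop
  | fanLeft (D D' : Presentation Γ) (C : Gates Γ) (a b c : ℕ) :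
      D.1 = C + {Gate.fan a b c, Gate.top b} → D'.1 = C + {Gate.arrow a c} →
      LocalPruning D.graph D'.graph
  | fanRight (D D' : Presentation Γ) (C : Gates Γ) (a b c : ℕ) :
      D.1 = C + {Gate.fan a b c, Gate.top c} → D'.1 = C + {Gate.arrow a b} →
      LocalPruning D.graph D'.graph
  | app (D D' : Presentation Γ) (C : Gates Γ) (a b c : ℕ) :
      D.1 = C + {Gate.app a b c, Gate.top c} → D'.1 = C + {Gate.top a, Gate.top b} →
      LocalPruning D.graph D'.graph
  | eps (D D' : Presentation Γ) (C : Gates Γ) (ε : Γ) (a b c : ℕ) :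
      D.1 = C + {Gate.eps ε a b c, Gate.top c} → D'.1 = C + {Gate.top a, Gate.top b} →
      LocalPruning D.graph D'.graph

/-- Global pruning: erase a graph `A` whose only output ends in a `⊤` gate and which has no other
connection with the rest. -/
inductive GlobalPruning : GRAPH Γ → GRAPH Γ → Prop
  | mk (D D' : Presentation Γ) (A C : Gates Γ) (u : ℕ) :
      A.OneOutput u → (∀ n, A.HasEdge n → ¬ C.HasEdge n) →
      D.1 = A + {Gate.top u} + C → D'.1 = C →
      GlobalPruning D.graph D'.graph

/-- The (global FAN-OUT) move, from the left to the right: a graph `A` whose only output enters a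
`Υ` gate, and which has no other connection with the rest, is replaced together with the `Υ` gate
by two disjoint copies of `A`, whose outputs take the place of the exits `p`, `q` of the gate. -/
inductive FanOut : GRAPH Γ → GRAPH Γ → Prop
  | mk (D D' : Presentation Γ) (A C : Gates Γ) (u p q : ℕ) (f g : ℕ → ℕ) :
      A.OneOutput u →
      (∀ n, A.HasEdge n → ¬ C.HasEdge n ∧ n ≠ p ∧ n ≠ q) →
      Set.InjOn f {n | A.HasEdge n} → f u = p →
      Set.InjOn g {n | A.HasEdge n} → g u = q →
      (∀ n, (A.rename f).HasEdge n → ¬ (A.rename g).HasEdge n) →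
      (∀ n, (A.rename f).HasEdge n → C.HasEdge n → n = p) →
      (∀ n, (A.rename g).HasEdge n → C.HasEdge n → n = q) →
      D.1 = A + {Gate.fan u p q} + C →
      D'.1 = A.rename f + A.rename g + C →
      FanOut D.graph D'.graph

/-- The (global FAN-OUT) move, in both directions. -/
def FanOutMove (G H : GRAPH Γ) : Prop := FanOut G H ∨ FanOut H G

/-- Pruning moves, local or global. -/
def PruningMove (G H : GRAPH Γ) : Prop := LocalPruning G H ∨ GlobalPruning G H

/-- The (ext1) move, from the pattern to the arrow `1 → 2`; it is allowed if there is no oriented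
path from `2` to `1`. -/
inductive Ext1Move : GRAPH Γ → GRAPH Γ → Prop
  | mk (D D' : Presentation Γ) (C : Gates Γ) (e₁ e₂ s t : ℕ) :
      D.1 = C + {Gate.app e₁ t s, Gate.lam s t e₂} →
      D'.1 = C + {Gate.arrow e₁ e₂} →
      ¬ D.1.Reach e₂ e₁ →
      Ext1Move D.graph D'.graph

end Moves

/-! ### Conversion of lambda terms into graphs -/

section Conversion

variable {X Γ : Type*}

/-- `FanTree v es T`: `T` is a planar binary tree of `Υ` gates with root edge `v`, whose leaves are
grafted, from left to right, to the edges `es` (at least one). With one leaf, it is an arrow. -/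
inductive FanTree : ℕ → List ℕ → Gates Γ → Prop
  | leaf (v e : ℕ) : FanTree v [e] {Gate.arrow v e}
  | node (v a b : ℕ) (es₁ es₂ : List ℕ) (T₁ T₂ : Gates Γ) :
      FanTree a es₁ T₁ → FanTree b es₂ T₂ →
      FanTree v (es₁ ++ es₂) ({Gate.fan v a b} + T₁ + T₂)

variable [DecidableEq X]

/-- The edges of the leaves decorated with `x`, from left to right. -/
def occurrences (x : X) (o : List (X × ℕ)) : List ℕ :=
  (o.filter fun l => l.1 = x).map Prod.snd

/-- `BoundTree A r o D`: `D` is a graph obtained from the syntactic tree of `A` by eliminating its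
bound variables. The root edge is `r`, and `o` lists from left to right the remaining leaves, with
their decorations (free variables of `A`) and edges. The left leg `v` of a `λ` gate ends in a `⊤`
gate if the variable is not used, and else in a tree of `Υ` gates which stops at the leaves that it
binds. -/
inductive BoundTree : Term X → ℕ → List (X × ℕ) → Gates Γ → Prop
  | var (x : X) (e : ℕ) : BoundTree (.var x) e [(x, e)] 0
  | app (M N : Term X) (p q r : ℕ) (o₁ o₂ : List (X × ℕ)) (D₁ D₂ : Gates Γ) :
      BoundTree M p o₁ D₁ → BoundTree N q o₂ D₂ →
      BoundTree (.app M N) r (o₁ ++ o₂) (D₁ + D₂ + {Gate.app p q r})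
  | lamUnused (x : X) (M : Term X) (p v r : ℕ) (o : List (X × ℕ)) (D : Gates Γ) :
      BoundTree M p o D → occurrences x o = [] →
      BoundTree (.lam x M) r o (D + {Gate.top v} + {Gate.lam p v r})
  | lamUsed (x : X) (M : Term X) (p v r : ℕ) (o : List (X × ℕ)) (D T : Gates Γ) :
      BoundTree M p o D → FanTree v (occurrences x o) T →
      BoundTree (.lam x M) r (o.filter fun l => l.1 ≠ x) (D + T + {Gate.lam p v r})

/-- `IsConversion A G`: the graph `G` is a transformation `[A]` of the lambda term `A`. After the
bound variables, each free variable `x` is eliminated by a tree of `Υ` gates with free root `v x`,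
which stops at the occurrences of `x`. Linearity and `r ∉ ins` say that the edges have been given
pairwise different names, so that nothing else is grafted. -/
def IsConversion (A : Term X) (G : GRAPH Γ) : Prop :=
  ∃ (r : ℕ) (o : List (X × ℕ)) (D : Gates Γ) (v : X → ℕ) (T : X → Gates Γ) (P : Presentation Γ),
    BoundTree A r o D ∧
    (∀ x ∈ A.fv, FanTree (v x) (occurrences x o) (T x)) ∧
    P.1 = D + ∑ x ∈ A.fv, T x ∧
    r ∉ P.1.ins ∧
    P.graph = G

end Conversion

end GLC

/-!
The edges of a graph `[A]` carry names, so most of the work is bookkeeping, which one identity keeps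
short: in the graph of a term every edge has a source and a target, except that the root has no
target and the free edges have no source (`BoundTree.balance`, `conversion_balance`). Hence a
presentation is linear as soon as no edge enters two gates, and a renaming between two such
presentations is injective as soon as it respects this condition (`graph_rename_of_nodup`).

(a) Fresh names give a transformation (`exists_isConversion`). The scope of a `λ` gate, i.e. its body
together with the tree of its left leg, can be left only through edge 1 of the gate, and inside the
scope every edge leads to edge 1 or to a `⊤` gate (`BoundTree.exists_scope`). The condition does not
depend on the presentation because paths are preserved and reflected by injective renamings and by
the absorption of arrows (`SameGraph.isLambda_iff`).

(b) A tree of `Υ` gates with `k` leaves becomes a right comb after less than `k` rotations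
(`FanTree.exists_comb`), and two transformations whose trees are combs are equal up to the names of
the edges (`graph_eq_of_combs`). This gives at most `2 n ≤ 2 ^ n` moves.

(c) The graphs of a term do not mention its bound variables: `BoundTree` is invariant under
`α`-conversion, with the same names of edges (`Term.Alpha.boundTree_iff`). So this case is (b).

(d) A free `Υ` gate disappears by the FAN-OUT move for a wire, and this move can be reversed. So, up
to FAN-OUT, every free occurrence may be given a root of its own (`FanTree.exists_wires`,
`exists_isConversion_of_wires`). After this the argument `B` of the redex shares nothing with `A`;
it is pruned, or copied along the tree of the bound variable (`FanTree.exists_copies`). As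
capture-avoiding substitution is the grafting of graphs (`BoundTree.substAll`), the result is the
graph of `A[x := B]` with separated free occurrences.

(e) The graph of `λ x. A x` is the graph of `A` with the pattern of (ext1) at its root, up to an
arrow (`boundTree_eta_iff`). The root of a transformation enters no gate, which gives the side
condition of the move.
-/

namespace GLC

/-! ### Edges of a collection of gates -/

namespace Gate

variable {Γ : Type*}

@[simp] theorem ins_rename (f : ℕ → ℕ) (g : Gate Γ) : (g.rename f).ins = g.ins.map f := by
  cases g <;> simp [rename, ins]

@[simp] theorem outs_rename (f : ℕ → ℕ) (g : Gate Γ) : (g.rename f).outs = g.outs.map f := by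
  cases g <;> simp [rename, outs]

theorem rename_congr {f f' : ℕ → ℕ} {g : Gate Γ} (h : ∀ n, n ∈ g.ins ∨ n ∈ g.outs → f n = f' n) :
    g.rename f = g.rename f' := by
  cases g <;> simp_all [rename, ins, outs]

@[simp] theorem rename_rename (f f' : ℕ → ℕ) (g : Gate Γ) :
    (g.rename f).rename f' = g.rename fun n => f' (f n) := by
  cases g <;> simp [rename]

@[simp] theorem rename_self (g : Gate Γ) : (g.rename fun n => n) = g := by
  cases g <;> simp [rename]

end Gate

namespace Gates

variable {Γ : Type*}

@[simp] theorem ins_zero : ins (0 : Gates Γ) = 0 := rfl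

@[simp] theorem outs_zero : outs (0 : Gates Γ) = 0 := rfl

@[simp] theorem ins_add (D E : Gates Γ) : ins (D + E) = ins D + ins E := Multiset.add_bind ..

@[simp] theorem outs_add (D E : Gates Γ) : outs (D + E) = outs D + outs E := Multiset.add_bind ..

@[simp] theorem ins_singleton (g : Gate Γ) : ins {g} = g.ins := by simp [ins]

@[simp] theorem outs_singleton (g : Gate Γ) : outs {g} = g.outs := by simp [outs]

@[simp] theorem ins_cons (g : Gate Γ) (D : Gates Γ) : ins (g ::ₘ D) = g.ins + ins D := by
  simp [ins]

@[simp] theorem outs_cons (g : Gate Γ) (D : Gates Γ) : outs (g ::ₘ D) = g.outs + outs D := by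
  simp [outs]

@[simp] theorem ins_rename (f : ℕ → ℕ) (D : Gates Γ) : ins (D.rename f) = (ins D).map f := by
  simp [ins, rename, Multiset.map_bind, Multiset.bind_map]

@[simp] theorem outs_rename (f : ℕ → ℕ) (D : Gates Γ) : outs (D.rename f) = (outs D).map f := by
  simp [outs, rename, Multiset.map_bind, Multiset.bind_map]

@[simp] theorem rename_add (f : ℕ → ℕ) (D E : Gates Γ) :
    rename f (D + E) = rename f D + rename f E := Multiset.map_add ..

@[simp] theorem rename_singleton (f : ℕ → ℕ) (g : Gate Γ) :
    rename f {g} = {g.rename f} := by simp [rename]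

@[simp] theorem rename_cons (f : ℕ → ℕ) (g : Gate Γ) (D : Gates Γ) :
    rename f (g ::ₘ D) = g.rename f ::ₘ rename f D := by simp [rename]

@[simp] theorem rename_rename (f f' : ℕ → ℕ) (D : Gates Γ) :
    (D.rename f).rename f' = D.rename fun n => f' (f n) := by
  simp [rename, Multiset.map_map]

theorem mem_ins {n : ℕ} {D : Gates Γ} : n ∈ ins D ↔ ∃ g ∈ D, n ∈ g.ins := Multiset.mem_bind

theorem mem_outs {n : ℕ} {D : Gates Γ} : n ∈ outs D ↔ ∃ g ∈ D, n ∈ g.outs := Multiset.mem_bind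

theorem rename_congr {f f' : ℕ → ℕ} {D : Gates Γ} (h : ∀ n, D.HasEdge n → f n = f' n) :
    D.rename f = D.rename f' :=
  Multiset.map_congr rfl fun g hg => Gate.rename_congr fun n hn =>
    h n (hn.imp (fun h => mem_ins.2 ⟨g, hg, h⟩) fun h => mem_outs.2 ⟨g, hg, h⟩)

theorem rename_eq_self {f : ℕ → ℕ} {D : Gates Γ} (h : ∀ n, D.HasEdge n → f n = n) :
    D.rename f = D := by
  rw [rename_congr (f' := fun n => n) h]
  simp [rename]

theorem hasEdge_rename {f : ℕ → ℕ} {D : Gates Γ} {n : ℕ} :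
    HasEdge (D.rename f) n ↔ ∃ m, D.HasEdge m ∧ f m = n := by
  simp only [HasEdge, ins_rename, outs_rename, Multiset.mem_map]
  grind

/-- Every finite collection of gates leaves an infinite supply of unused edge names. -/
theorem exists_lt_of_hasEdge (D : Gates Γ) : ∃ N, ∀ n, D.HasEdge n → n < N := by
  refine ⟨(ins D + outs D).toFinset.sup id + 1, fun n hn => Nat.lt_succ_of_le ?_⟩
  exact Finset.le_sup (f := id) (by simpa [HasEdge] using hn)

end Gates

/-! ### Equality of graphs -/

section Graphs

variable {Γ : Type*}

theorem graph_congr {D D' : Presentation Γ} (h : D.1 = D'.1) : D.graph = D'.graph := by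
  rw [Subtype.ext h]

theorem graph_rename {D D' : Presentation Γ} (f : ℕ → ℕ)
    (hf : Set.InjOn f {n | D.1.HasEdge n}) (h : D'.1 = D.1.rename f) : D.graph = D'.graph :=
  Quot.sound (.rename D D' f hf h)

/-- Linearity survives the absorption of an arrow. -/
theorem Gates.IsLinear.absorb {C : Gates Γ} {a b : ℕ} (h : IsLinear (Gate.arrow a b ::ₘ C)) :
    (C.rename (Function.update id b a)).IsLinear := by
  obtain ⟨h1, h2⟩ := h
  simp only [Gates.ins_cons, Gates.outs_cons, Gate.ins, Gate.outs, Multiset.singleton_add,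
    Multiset.nodup_cons] at h1 h2
  constructor
  · rw [Gates.ins_rename]
    refine h1.2.map_on fun x hx y hy h => ?_
    simp only [Function.update_apply, id] at h
    split_ifs at h <;> simp_all
  · rw [Gates.outs_rename]
    refine h2.2.map_on fun x hx y hy h => ?_
    simp only [Function.update_apply, id] at h
    split_ifs at h <;> simp_all

theorem graph_absorb {D D' : Presentation Γ} {C : Gates Γ} {a b : ℕ} (hab : a ≠ b)
    (hC : C.HasEdge a ∨ C.HasEdge b) (hD : D.1 = Gate.arrow a b ::ₘ C)
    (hD' : D'.1 = C.rename (Function.update id b a)) : D.graph = D'.graph :=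
  Quot.sound (.absorb D D' C a b hab hC hD hD')

/-- The absorbed arrow may also keep the name of its target. -/
theorem graph_absorb' {D D' : Presentation Γ} {C : Gates Γ} {a b : ℕ} (hab : a ≠ b)
    (hC : C.HasEdge a ∨ C.HasEdge b) (hD : D.1 = Gate.arrow a b ::ₘ C)
    (hD' : D'.1 = C.rename (Function.update id a b)) : D.graph = D'.graph := by
  have hl := Gates.IsLinear.absorb (hD ▸ D.2)
  rw [graph_absorb (D' := ⟨_, hl⟩) hab hC hD rfl]
  refine graph_rename (Equiv.swap a b) (Equiv.injective _).injOn ?_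
  rw [hD', Gates.rename_rename]
  refine Gates.rename_congr fun n _ => ?_
  simp only [Function.update_apply, id, Equiv.swap_apply_def]
  split_ifs <;> simp_all

/-- An arrow to a free edge is absorbed without renaming. -/
theorem graph_absorb_tgt {D D' : Presentation Γ} {C : Gates Γ} {a b : ℕ}
    (ha : C.HasEdge a) (hb : ¬ C.HasEdge b) (hD : D.1 = Gate.arrow a b ::ₘ C)
    (hD' : D'.1 = C) : D.graph = D'.graph := by
  refine graph_absorb (by rintro rfl; exact hb ha) (.inl ha) hD ?_
  rw [hD', Gates.rename_eq_self]
  intro n hn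
  rw [Function.update_of_ne (by rintro rfl; exact hb hn), id]

/-- An arrow from a free edge is absorbed without renaming. -/
theorem graph_absorb_src {D D' : Presentation Γ} {C : Gates Γ} {a b : ℕ}
    (ha : ¬ C.HasEdge a) (hb : C.HasEdge b) (hD : D.1 = Gate.arrow a b ::ₘ C)
    (hD' : D'.1 = C) : D.graph = D'.graph := by
  refine graph_absorb' (by rintro rfl; exact ha hb) (.inr hb) hD ?_
  rw [hD', Gates.rename_eq_self]
  intro n hn
  rw [Function.update_of_ne (by rintro rfl; exact ha hn), id]

end Graphs

/-! ### Fan trees and bound trees -/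

section Trees

variable {X Γ : Type*}

theorem FanTree.ne_nil {v : ℕ} {es : List ℕ} {T : Gates Γ} (h : FanTree v es T) : es ≠ [] := by
  induction h <;> simp_all

/-- Inside a fan tree every edge has both extremities, except that the root has no source and the
leaves have no target. -/
theorem FanTree.balance {v : ℕ} {es : List ℕ} {T : Gates Γ} (h : FanTree v es T) :
    Gates.ins T + (es : Multiset ℕ) = Gates.outs T + {v} := by
  induction h with
  | leaf v e => simpa [Gate.ins, Gate.outs] using Multiset.pair_comm v e
  | node v a b es₁ es₂ T₁ T₂ _ _ ih₁ ih₂ =>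
    ext n
    have h1 := congrArg (Multiset.count n) ih₁
    have h2 := congrArg (Multiset.count n) ih₂
    simp only [Gates.ins_add, Gates.outs_add, Gates.ins_singleton, Gates.outs_singleton, Gate.ins,
      Gate.outs, Multiset.insert_eq_cons, ← Multiset.singleton_add, ← Multiset.coe_add,
      Multiset.count_add] at h1 h2 ⊢
    omega

theorem FanTree.rename {v : ℕ} {es : List ℕ} {T : Gates Γ} (f : ℕ → ℕ) (h : FanTree v es T) :
    FanTree (f v) (es.map f) (Gates.rename f T) := by
  induction h with
  | leaf v e => simpa [Gate.rename] using FanTree.leaf (f v) (f e)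
  | node v a b es₁ es₂ T₁ T₂ _ _ ih₁ ih₂ =>
    simpa [Gate.rename] using FanTree.node (f v) (f a) (f b) _ _ _ _ ih₁ ih₂

/-- The left leg `v` of a `λ` gate together with the edges `es` that it is grafted to: a `⊤` gate if
there are none, and a fan tree otherwise. -/
def Binder (v : ℕ) (es : List ℕ) (T : Gates Γ) : Prop :=
  es = [] ∧ T = {Gate.top v} ∨ FanTree v es T

theorem Binder.balance {v : ℕ} {es : List ℕ} {T : Gates Γ} (h : Binder v es T) :
    Gates.ins T + (es : Multiset ℕ) = Gates.outs T + {v} := by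
  rcases h with ⟨rfl, rfl⟩ | h
  · simp [Gate.ins, Gate.outs]
  · exact h.balance

theorem Binder.rename {v : ℕ} {es : List ℕ} {T : Gates Γ} (f : ℕ → ℕ) (h : Binder v es T) :
    Binder (f v) (es.map f) (Gates.rename f T) := by
  rcases h with ⟨rfl, rfl⟩ | h
  · exact .inl (by simp [Gate.rename])
  · exact .inr (h.rename f)

variable [DecidableEq X]

theorem mem_occurrences {x : X} {o : List (X × ℕ)} {e : ℕ} :
    e ∈ occurrences x o ↔ (x, e) ∈ o := by
  simp only [occurrences, List.mem_map, List.mem_filter, decide_eq_true_eq]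
  exact ⟨by rintro ⟨⟨y, e⟩, ⟨h, rfl⟩, rfl⟩; exact h, fun h => ⟨_, ⟨h, rfl⟩, rfl⟩⟩

theorem occurrences_eq_nil {x : X} {o : List (X × ℕ)} :
    occurrences x o = [] ↔ x ∉ o.map Prod.fst := by
  simp [occurrences, List.filter_eq_nil_iff]
  grind

@[simp] theorem occurrences_append (x : X) (o₁ o₂ : List (X × ℕ)) :
    occurrences x (o₁ ++ o₂) = occurrences x o₁ ++ occurrences x o₂ := by
  simp [occurrences]

theorem filter_ne_of_occurrences_eq_nil {x : X} {o : List (X × ℕ)} (h : occurrences x o = []) :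
    (o.filter fun l => l.1 ≠ x) = o := by
  rw [List.filter_eq_self]
  rintro ⟨y, e⟩ hl
  rw [decide_eq_true_eq]
  rintro rfl
  simpa [h] using mem_occurrences.2 hl

theorem occurrences_add_filter (x : X) (o : List (X × ℕ)) :
    (occurrences x o : Multiset ℕ) + ((o.filter fun l => l.1 ≠ x).map Prod.snd : List ℕ) =
      (o.map Prod.snd : List ℕ) := by
  have h := List.filter_append_perm (fun l : X × ℕ => decide (l.1 = x)) o
  rw [occurrences, Multiset.coe_add, ← List.map_append, Multiset.coe_eq_coe]
  simpa using h.map Prod.snd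

theorem occurrences_map_snd (x : X) (f : ℕ → ℕ) (o : List (X × ℕ)) :
    occurrences x (o.map fun l => (l.1, f l.2)) = (occurrences x o).map f := by
  simp [occurrences, List.filter_map, Function.comp_def]

theorem filter_map_snd (x : X) (f : ℕ → ℕ) (o : List (X × ℕ)) :
    ((o.map fun l => (l.1, f l.2)).filter fun l => l.1 ≠ x) =
      (o.filter fun l => l.1 ≠ x).map fun l => (l.1, f l.2) := by
  simp [List.filter_map, Function.comp_def]

namespace BoundTree

theorem var_iff {x : X} {r : ℕ} {o : List (X × ℕ)} {D : Gates Γ} :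
    BoundTree (.var x) r o D ↔ o = [(x, r)] ∧ D = 0 := by
  constructor
  · rintro ⟨⟩
    exact ⟨rfl, rfl⟩
  · rintro ⟨rfl, rfl⟩
    exact .var x r

theorem app_iff {M N : Term X} {r : ℕ} {o : List (X × ℕ)} {D : Gates Γ} :
    BoundTree (.app M N) r o D ↔ ∃ p q o₁ o₂ D₁ D₂, BoundTree M p o₁ D₁ ∧ BoundTree N q o₂ D₂ ∧
      o = o₁ ++ o₂ ∧ D = D₁ + D₂ + {Gate.app p q r} := by
  constructor
  · rintro ⟨⟩
    exact ⟨_, _, _, _, _, _, ‹_›, ‹_›, rfl, rfl⟩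
  · rintro ⟨p, q, o₁, o₂, D₁, D₂, h₁, h₂, rfl, rfl⟩
    exact .app M N p q r o₁ o₂ D₁ D₂ h₁ h₂

theorem lam_iff {x : X} {M : Term X} {r : ℕ} {o : List (X × ℕ)} {D : Gates Γ} :
    BoundTree (.lam x M) r o D ↔ ∃ p v o₁ D₁ T, BoundTree M p o₁ D₁ ∧
      Binder v (occurrences x o₁) T ∧ o = (o₁.filter fun l => l.1 ≠ x) ∧
      D = D₁ + T + {Gate.lam p v r} := by
  constructor
  · intro h
    cases h with
    | lamUnused _ _ p v _ _ _ h h0 =>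
      exact ⟨_, _, _, _, _, h, .inl ⟨h0, rfl⟩, (filter_ne_of_occurrences_eq_nil h0).symm, rfl⟩
    | lamUsed _ _ p v _ _ _ _ h hT => exact ⟨_, _, _, _, _, h, .inr hT, rfl, rfl⟩
  · rintro ⟨p, v, o₁, D₁, T, h, ⟨h0, rfl⟩ | hT, rfl, rfl⟩
    · rw [filter_ne_of_occurrences_eq_nil h0]
      exact .lamUnused x M p v r _ _ h h0
    · exact .lamUsed x M p v r _ _ _ h hT

/-- In the graph of a term every edge has both extremities, except that the root has no target and
the occurrences of the free variables have no source. -/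
theorem balance {A : Term X} {r : ℕ} {o : List (X × ℕ)} {D : Gates Γ} (h : BoundTree A r o D) :
    Gates.ins D + {r} = Gates.outs D + (o.map Prod.snd : List ℕ) := by
  induction A generalizing r o D with
  | var x =>
    obtain ⟨rfl, rfl⟩ := var_iff.1 h
    simp
  | app M N ihM ihN =>
    obtain ⟨p, q, o₁, o₂, D₁, D₂, h₁, h₂, rfl, rfl⟩ := app_iff.1 h
    ext n
    have h1 := congrArg (Multiset.count n) (ihM h₁)
    have h2 := congrArg (Multiset.count n) (ihN h₂)
    simp only [Gates.ins_add, Gates.outs_add, Gates.ins_singleton, Gates.outs_singleton, Gate.ins,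
      Gate.outs, Multiset.insert_eq_cons, ← Multiset.singleton_add, ← Multiset.coe_add,
      List.map_append, Multiset.count_add] at h1 h2 ⊢
    omega
  | lam x M ih =>
    obtain ⟨p, v, o₁, D₁, T, h₁, hT, rfl, rfl⟩ := lam_iff.1 h
    ext n
    have h1 := congrArg (Multiset.count n) (ih h₁)
    have h2 := congrArg (Multiset.count n) hT.balance
    have h3 := congrArg (Multiset.count n) (occurrences_add_filter x o₁)
    simp only [Gates.ins_add, Gates.outs_add, Gates.ins_singleton, Gates.outs_singleton, Gate.ins,
      Gate.outs, Multiset.insert_eq_cons, ← Multiset.singleton_add,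
      Multiset.count_add] at h1 h2 h3 ⊢
    omega

theorem rename (f : ℕ → ℕ) {A : Term X} {r : ℕ} {o : List (X × ℕ)} {D : Gates Γ}
    (h : BoundTree A r o D) :
    BoundTree A (f r) (o.map fun l => (l.1, f l.2)) (Gates.rename f D) := by
  induction A generalizing r o D with
  | var x =>
    obtain ⟨rfl, rfl⟩ := var_iff.1 h
    exact .var x (f r)
  | app M N ihM ihN =>
    obtain ⟨p, q, o₁, o₂, D₁, D₂, h₁, h₂, rfl, rfl⟩ := app_iff.1 h
    exact app_iff.2 ⟨_, _, _, _, _, _, ihM h₁, ihN h₂, by simp, by simp [Gate.rename]⟩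
  | lam x M ih =>
    obtain ⟨p, v, o₁, D₁, T, h₁, hT, rfl, rfl⟩ := lam_iff.1 h
    refine lam_iff.2 ⟨_, f v, _, _, Gates.rename f T, ih h₁, ?_, (filter_map_snd x f o₁).symm,
      by simp [Gate.rename]⟩
    rw [occurrences_map_snd]
    exact hT.rename f

/-- The remaining leaves are decorated by the free variables. -/
theorem mem_labels {A : Term X} {r : ℕ} {o : List (X × ℕ)} {D : Gates Γ} (h : BoundTree A r o D)
    {x : X} : x ∈ o.map Prod.fst ↔ x ∈ A.fv := by
  induction A generalizing r o D with
  | var y =>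
    obtain ⟨rfl, rfl⟩ := var_iff.1 h
    simp [Term.fv]
  | app M N ihM ihN =>
    obtain ⟨p, q, o₁, o₂, D₁, D₂, h₁, h₂, rfl, rfl⟩ := app_iff.1 h
    rw [List.map_append, List.mem_append, ihM h₁, ihN h₂, Term.fv, Finset.mem_union]
  | lam y M ih =>
    obtain ⟨p, v, o₁, D₁, T, h₁, hT, rfl, rfl⟩ := lam_iff.1 h
    rw [Term.fv, Finset.mem_erase, ← ih h₁]
    simp
    grind

theorem occurrences_eq_nil {A : Term X} {r : ℕ} {o : List (X × ℕ)} {D : Gates Γ}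
    (h : BoundTree A r o D) {x : X} : occurrences x o = [] ↔ x ∉ A.fv := by
  rw [GLC.occurrences_eq_nil, h.mem_labels]

end BoundTree

end Trees

/-! ### Substitution and renaming of bound variables -/

section Substitution

variable {X Γ : Type*} [DecidableEq X]

theorem Term.fresh_notMem [Infinite X] (y : X) (S : Finset X) : Term.fresh y S ∉ S := by
  unfold Term.fresh
  split_ifs with h
  · exact (Infinite.exists_notMem_finset S).choose_spec
  · exact h

/-- `Plug σ o o' D`: the leaves `o` are replaced by the graphs of the terms that `σ` assigns to
their decorations. `D` collects the gates and `o'` the leaves of these graphs. -/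
inductive Plug (σ : X → Term X) : List (X × ℕ) → List (X × ℕ) → Gates Γ → Prop
  | nil : Plug σ [] [] 0
  | cons {x : X} {e : ℕ} {o o₁ o₂ : List (X × ℕ)} {D₁ D₂ : Gates Γ} :
      BoundTree (σ x) e o₁ D₁ → Plug σ o o₂ D₂ → Plug σ ((x, e) :: o) (o₁ ++ o₂) (D₁ + D₂)

theorem Plug.of_append {σ : X → Term X} {o₁ o₂ o' : List (X × ℕ)} {D : Gates Γ}
    (h : Plug σ (o₁ ++ o₂) o' D) : ∃ o₁' o₂' D₁ D₂, Plug σ o₁ o₁' D₁ ∧ Plug σ o₂ o₂' D₂ ∧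
      o' = o₁' ++ o₂' ∧ D = D₁ + D₂ := by
  induction o₁ generalizing o' D with
  | nil => exact ⟨[], o', 0, D, .nil, h, rfl, by simp⟩
  | cons l o₁ ih =>
    cases h with
    | cons hB h =>
      obtain ⟨o₁', o₂', D₁, D₂, h₁, h₂, rfl, rfl⟩ := ih h
      exact ⟨_, _, _, _, .cons hB h₁, h₂, by simp, by abel⟩

/-- Below a binder of `x`, which is renamed to `z`, the leaves decorated by `x` stay leaves. -/
theorem Plug.under_binder {σ : X → Term X} {x z : X} {o o' : List (X × ℕ)} {D : Gates Γ}
    (hz : ∀ w ∈ o.map Prod.fst, w ≠ x → z ∉ (σ w).fv)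
    (h : Plug σ (o.filter fun l => l.1 ≠ x) o' D) :
    ∃ o'', Plug (Function.update σ x (.var z)) o o'' D ∧ occurrences z o'' = occurrences x o ∧
      (o''.filter fun l => l.1 ≠ z) = o' := by
  induction o generalizing o' D with
  | nil =>
    cases h
    exact ⟨[], .nil, rfl, rfl⟩
  | cons l o ih =>
    obtain ⟨w, e⟩ := l
    have hz' : ∀ w ∈ o.map Prod.fst, w ≠ x → z ∉ (σ w).fv := fun w hw =>
      hz w (by simp only [List.map_cons, List.mem_cons, hw, or_true])
    by_cases hw : w = x
    · subst hw
      rw [List.filter_cons_of_neg (by simp)] at h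
      obtain ⟨o'', h1, h2, h3⟩ := ih hz' h
      refine ⟨(z, e) :: o'', ?_, ?_, ?_⟩
      · rw [← List.singleton_append, ← zero_add D]
        exact .cons (by rw [Function.update_self]; exact .var z e) h1
      · simpa [occurrences] using h2
      · simpa using h3
    · rw [List.filter_cons_of_pos (by simpa using hw)] at h
      cases h with
      | cons hB h =>
        obtain ⟨o'', h1, h2, h3⟩ := ih hz' h
        have h0 : occurrences z _ = [] := hB.occurrences_eq_nil.2 (hz w (by simp) hw)
        refine ⟨_ ++ o'', .cons (by rwa [Function.update_of_ne hw]) h1, ?_, ?_⟩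
        · rw [occurrences_append, h0, h2]
          simp [occurrences, hw]
        · rw [List.filter_append, filter_ne_of_occurrences_eq_nil h0, h3]

theorem occurrences_relabel {ρ : X → X} {x z : X} {o : List (X × ℕ)}
    (h : ∀ w ∈ o.map Prod.fst, ρ w = z ↔ w = x) :
    occurrences z (o.map fun l => (ρ l.1, l.2)) = occurrences x o := by
  induction o with
  | nil => rfl
  | cons l o ih =>
    have := h l.1 (by simp)
    have := ih fun w hw => h w (by simp at hw ⊢; grind)
    simp only [occurrences, List.map_cons, List.filter_cons] at *
    by_cases hl : l.1 = x <;> simp_all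

theorem filter_relabel {ρ ρ' : X → X} {x z : X} {o : List (X × ℕ)}
    (h : ∀ w ∈ o.map Prod.fst, ρ w = z ↔ w = x) (h' : ∀ w ∈ o.map Prod.fst, w ≠ x → ρ w = ρ' w) :
    ((o.map fun l => (ρ l.1, l.2)).filter fun l => l.1 ≠ z) =
      (o.filter fun l => l.1 ≠ x).map fun l => (ρ' l.1, l.2) := by
  induction o with
  | nil => rfl
  | cons l o ih =>
    have := h l.1 (by simp)
    have := h' l.1 (by simp)
    have := ih (fun w hw => h w (by simp at hw ⊢; grind)) fun w hw => h' w (by simp at hw ⊢; grind)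
    simp only [List.map_cons, List.filter_cons] at *
    by_cases hl : l.1 = x <;> simp_all

variable [Infinite X]

/-- Capture-avoiding substitution is the grafting of graphs. -/
theorem BoundTree.substAll {A : Term X} {r : ℕ} {o o' : List (X × ℕ)} {D D' : Gates Γ}
    {σ : X → Term X} (h : BoundTree A r o D) (hσ : Plug σ o o' D') :
    BoundTree (A.substAll σ) r o' (D + D') := by
  induction A generalizing r o o' D D' σ with
  | var x =>
    obtain ⟨rfl, rfl⟩ := var_iff.1 h
    obtain _ | ⟨hB, ⟨⟩⟩ := hσ
    simpa [Term.substAll] using hB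
  | app M N ihM ihN =>
    obtain ⟨p, q, o₁, o₂, D₁, D₂, h₁, h₂, rfl, rfl⟩ := app_iff.1 h
    obtain ⟨o₁', o₂', D₁', D₂', hσ₁, hσ₂, rfl, rfl⟩ := hσ.of_append
    exact app_iff.2 ⟨_, _, _, _, _, _, ihM h₁ hσ₁, ihN h₂ hσ₂, rfl, by abel⟩
  | lam x M ih =>
    obtain ⟨p, v, o₁, D₁, T, h₁, hT, rfl, rfl⟩ := lam_iff.1 h
    simp only [Term.substAll]
    set z := Term.fresh x ((M.fv.erase x).biUnion fun w => (σ w).fv) with hzdef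
    have hz : ∀ w ∈ o₁.map Prod.fst, w ≠ x → z ∉ (σ w).fv := fun w hw hwx hzw =>
      Term.fresh_notMem x ((M.fv.erase x).biUnion fun w => (σ w).fv)
        (Finset.mem_biUnion.2 ⟨w, Finset.mem_erase.2 ⟨hwx, h₁.mem_labels.1 hw⟩, hzw⟩)
    obtain ⟨o'', hp, h2, h3⟩ := hσ.under_binder hz
    refine lam_iff.2 ⟨_, v, _, _, T, ih h₁ hp, ?_, h3.symm, by abel⟩
    rwa [h2]

/-- Renaming variables keeps the graph and relabels its leaves. The converse holds because bound
variables avoid the new names of the free ones. -/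
theorem boundTree_rename_iff {A : Term X} {ρ : X → X} {r : ℕ} {o' : List (X × ℕ)} {D : Gates Γ} :
    BoundTree (A.substAll fun x => .var (ρ x)) r o' D ↔
      ∃ o, o' = (o.map fun l => (ρ l.1, l.2)) ∧ BoundTree A r o D := by
  induction A generalizing ρ r o' D with
  | var x =>
    simp only [Term.substAll, BoundTree.var_iff]
    exact ⟨by rintro ⟨rfl, rfl⟩; exact ⟨_, rfl, rfl, rfl⟩,
      by rintro ⟨o, rfl, rfl, rfl⟩; exact ⟨rfl, rfl⟩⟩
  | app M N ihM ihN =>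
    simp only [Term.substAll, BoundTree.app_iff, ihM, ihN]
    constructor
    · rintro ⟨p, q, _, _, D₁, D₂, ⟨o₁, rfl, h₁⟩, ⟨o₂, rfl, h₂⟩, rfl, rfl⟩
      exact ⟨o₁ ++ o₂, by simp, p, q, o₁, o₂, D₁, D₂, h₁, h₂, rfl, rfl⟩
    · rintro ⟨_, rfl, p, q, o₁, o₂, D₁, D₂, h₁, h₂, rfl, rfl⟩
      exact ⟨p, q, _, _, D₁, D₂, ⟨o₁, rfl, h₁⟩, ⟨o₂, rfl, h₂⟩, by simp, rfl⟩
  | lam x M ih =>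
    have hz := Term.fresh_notMem x ((M.fv.erase x).biUnion fun w => (Term.var (ρ w)).fv)
    simp only [Term.substAll]
    set z := Term.fresh x ((M.fv.erase x).biUnion fun w => (Term.var (ρ w)).fv)
    have hu : (Function.update (fun x => Term.var (ρ x)) x (.var z)) =
        fun w => .var (Function.update ρ x z w) := by
      funext w
      by_cases h : w = x
      · subst h; simp
      · simp [h]
    have key : ∀ {p : ℕ} {o : List (X × ℕ)} {D : Gates Γ}, BoundTree M p o D →
        ∀ w ∈ o.map Prod.fst, Function.update ρ x z w = z ↔ w = x := by
      intro p o D h w hw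
      by_cases hwx : w = x
      · subst hwx; simp
      · simp only [Function.update_of_ne hwx, hwx, iff_false]
        rintro hρ
        refine hz (Finset.mem_biUnion.2 ⟨w, Finset.mem_erase.2 ⟨hwx, h.mem_labels.1 hw⟩, ?_⟩)
        simp [Term.fv, hρ]
    have key' : ∀ w : X, w ≠ x → Function.update ρ x z w = ρ w := fun w hw =>
      Function.update_of_ne hw _ _
    simp only [BoundTree.lam_iff, hu, ih]
    constructor
    · rintro ⟨p, v, _, D₁, T, ⟨o, rfl, h⟩, hT, rfl, rfl⟩
      rw [occurrences_relabel (key h)] at hT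
      exact ⟨_, filter_relabel (key h) (fun w _ => key' w), p, v, o, D₁, T, h, hT, rfl, rfl⟩
    · rintro ⟨_, rfl, p, v, o, D₁, T, h, hT, rfl, rfl⟩
      refine ⟨p, v, _, D₁, T, ⟨o, rfl, h⟩, ?_,
        (filter_relabel (key h) (fun w _ => key' w)).symm, rfl⟩
      rwa [occurrences_relabel (key h)]

/-- The graphs of a term, with the names of all edges, only depend on its `α`-class. -/
theorem Term.Alpha.boundTree_iff {A B : Term X} (h : Alpha A B) {r : ℕ} {o : List (X × ℕ)}
    {D : Gates Γ} : BoundTree A r o D ↔ BoundTree B r o D := by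
  induction h generalizing r o D with
  | rename x y M hy =>
    have hu : (Function.update Term.var x (.var y) : X → Term X) =
        fun w => .var (Function.update id x y w) := by
      funext w
      by_cases h : w = x
      · subst h; simp
      · simp [h]
    have key : ∀ {p : ℕ} {o : List (X × ℕ)} {D : Gates Γ}, BoundTree M p o D →
        ∀ w ∈ o.map Prod.fst, Function.update id x y w = y ↔ w = x := by
      intro p o D h w hw
      by_cases hwx : w = x
      · subst hwx; simp
      · simp only [Function.update_of_ne hwx, hwx, iff_false, id]
        rintro rfl
        exact hy (h.mem_labels.1 hw)
    have key' : ∀ w : X, w ≠ x → Function.update id x y w = id w := fun w hw =>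
      Function.update_of_ne hw _ _
    simp only [BoundTree.lam_iff, Term.subst, hu, boundTree_rename_iff]
    constructor
    · rintro ⟨p, v, o, D₁, T, h, hT, rfl, rfl⟩
      refine ⟨p, v, _, D₁, T, ⟨o, rfl, h⟩, by rwa [occurrences_relabel (key h)], ?_, rfl⟩
      rw [filter_relabel (key h) (fun w _ => key' w)]
      simp
    · rintro ⟨p, v, _, D₁, T, ⟨o, rfl, h⟩, hT, rfl, rfl⟩
      rw [occurrences_relabel (key h)] at hT
      refine ⟨p, v, o, D₁, T, h, hT, ?_, rfl⟩
      rw [filter_relabel (key h) (fun w _ => key' w)]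
      simp
  | app _ _ ihM ihN => simp only [BoundTree.app_iff, ihM, ihN]
  | lam x _ ih => simp only [BoundTree.lam_iff, ih]
  | refl M => rfl
  | symm _ ih => exact ih.symm
  | trans _ _ ih₁ ih₂ => exact ih₁.trans ih₂

end Substitution

/-! ### Presentations of transformations -/

section Conversion

variable {X Γ : Type*}

theorem Gates.ins_sum (S : Finset X) (T : X → Gates Γ) :
    Gates.ins (∑ x ∈ S, T x) = ∑ x ∈ S, Gates.ins (T x) := by
  classical
  induction S using Finset.induction_on with
  | empty => simp
  | insert x S hx ih => simp [Finset.sum_insert hx, ih]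

theorem Gates.outs_sum (S : Finset X) (T : X → Gates Γ) :
    Gates.outs (∑ x ∈ S, T x) = ∑ x ∈ S, Gates.outs (T x) := by
  classical
  induction S using Finset.induction_on with
  | empty => simp
  | insert x S hx ih => simp [Finset.sum_insert hx, ih]

/-- If all extremities are accounted for by the root `r` and the sources `F`, then it suffices to
check that no edge is grafted twice to an entry. -/
theorem nodup_outs_of_balance {I O F : Multiset ℕ} {r : ℕ} (h : I + {r} = O + F)
    (hI : (I + {r}).Nodup) : O.Nodup ∧ ∀ n ∈ F, n ∉ O := by
  rw [h, Multiset.nodup_add] at hI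
  exact ⟨hI.1, fun n hF hO => Multiset.disjoint_left.1 hI.2.2 hO hF⟩

theorem isLinear_of_balance {D : Gates Γ} {F : Multiset ℕ} {r : ℕ}
    (h : Gates.ins D + {r} = Gates.outs D + F) (hI : (Gates.ins D + {r}).Nodup) : D.IsLinear :=
  ⟨(Multiset.nodup_add.1 hI).1, (nodup_outs_of_balance h hI).1⟩

theorem exists_notMem_multiset (s : Multiset ℕ) : ∃ n, n ∉ s := by
  simpa using Infinite.exists_notMem_finset s.toFinset

/-- A fan tree whose edges, except for the leaves, avoid the names `s`. -/
theorem exists_fanTree {s : Multiset ℕ} (hs : s.Nodup) {es : List ℕ} (hes : es ≠ []) :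
    ∃ v, ∃ T : Gates Γ, FanTree v es T ∧ (s + Gates.ins T).Nodup := by
  induction es with
  | nil => exact absurd rfl hes
  | cons e es ih =>
    rcases eq_or_ne es [] with rfl | hne
    · obtain ⟨v, hv⟩ := exists_notMem_multiset s
      refine ⟨v, _, .leaf v e, ?_⟩
      rw [Gates.ins_singleton, Gate.ins, add_comm, Multiset.singleton_add]
      exact Multiset.nodup_cons.2 ⟨hv, hs⟩
    · obtain ⟨b, T, hT, hn⟩ := ih hne
      obtain ⟨v, hv⟩ := exists_notMem_multiset (s + Gates.ins T)
      have hn1 := Multiset.nodup_cons.2 ⟨hv, hn⟩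
      obtain ⟨a, ha⟩ := exists_notMem_multiset (v ::ₘ (s + Gates.ins T))
      have hn2 := Multiset.nodup_cons.2 ⟨ha, hn1⟩
      refine ⟨v, _, .node v a b [e] es _ _ (.leaf a e) hT, ?_⟩
      simp only [Gates.ins_add, Gates.ins_singleton, Gate.ins, ← Multiset.singleton_add] at hn2 ⊢
      convert hn2 using 1
      abel

theorem exists_binder {s : Multiset ℕ} (hs : s.Nodup) (es : List ℕ) :
    ∃ v, ∃ T : Gates Γ, Binder v es T ∧ (s + Gates.ins T).Nodup := by
  rcases eq_or_ne es [] with rfl | hne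
  · obtain ⟨v, hv⟩ := exists_notMem_multiset s
    refine ⟨v, _, .inl ⟨rfl, rfl⟩, ?_⟩
    rw [Gates.ins_singleton, Gate.ins, add_comm, Multiset.singleton_add]
    exact Multiset.nodup_cons.2 ⟨hv, hs⟩
  · obtain ⟨v, T, hT, hn⟩ := exists_fanTree (Γ := Γ) hs hne
    exact ⟨v, T, .inr hT, hn⟩

variable [DecidableEq X]

/-- A graph of `A` whose edges avoid the names `s`. -/
theorem exists_boundTree {s : Multiset ℕ} (hs : s.Nodup) (A : Term X) :
    ∃ r o, ∃ D : Gates Γ, BoundTree A r o D ∧ (s + (Gates.ins D + {r})).Nodup := by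
  induction A generalizing s with
  | var x =>
    obtain ⟨e, he⟩ := exists_notMem_multiset s
    refine ⟨e, _, _, .var x e, ?_⟩
    rw [Gates.ins_zero, zero_add, add_comm, Multiset.singleton_add]
    exact Multiset.nodup_cons.2 ⟨he, hs⟩
  | app M N ihM ihN =>
    obtain ⟨p, o₁, D₁, h₁, hn₁⟩ := ihM hs
    obtain ⟨q, o₂, D₂, h₂, hn₂⟩ := ihN hn₁
    obtain ⟨r, hr⟩ := exists_notMem_multiset (s + (Gates.ins D₁ + {p}) + (Gates.ins D₂ + {q}))
    have hn := Multiset.nodup_cons.2 ⟨hr, hn₂⟩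
    refine ⟨r, _, _, .app M N p q r _ _ _ _ h₁ h₂, ?_⟩
    simp only [Gates.ins_add, Gates.ins_singleton, Gate.ins, ← Multiset.singleton_add,
      Multiset.insert_eq_cons] at hn ⊢
    convert hn using 1
    abel
  | lam x M ih =>
    obtain ⟨p, o, D, h, hn₁⟩ := ih hs
    obtain ⟨v, T, hT, hn₂⟩ := exists_binder (Γ := Γ) hn₁ (occurrences x o)
    obtain ⟨r, hr⟩ := exists_notMem_multiset (s + (Gates.ins D + {p}) + Gates.ins T)
    have hn := Multiset.nodup_cons.2 ⟨hr, hn₂⟩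
    refine ⟨r, _, _, BoundTree.lam_iff.2 ⟨p, v, o, D, T, h, hT, rfl, rfl⟩, ?_⟩
    simp only [Gates.ins_add, Gates.ins_singleton, Gate.ins, ← Multiset.singleton_add] at hn ⊢
    convert hn using 1
    abel

theorem exists_freeTrees {s : Multiset ℕ} (hs : s.Nodup) (o : List (X × ℕ)) (S : Finset X)
    (hS : ∀ x ∈ S, occurrences x o ≠ []) :
    ∃ (v : X → ℕ) (T : X → Gates Γ), (∀ x ∈ S, FanTree (v x) (occurrences x o) (T x)) ∧
      (s + Gates.ins (∑ x ∈ S, T x)).Nodup := by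
  induction S using Finset.induction_on with
  | empty => exact ⟨fun _ => 0, fun _ => 0, by simp, by simpa using hs⟩
  | insert x S hx ih =>
    obtain ⟨v, T, hT, hn⟩ := ih fun y hy => hS y (Finset.mem_insert_of_mem hy)
    obtain ⟨v₀, T₀, hT₀, hn₀⟩ := exists_fanTree (Γ := Γ) hn (hS x (Finset.mem_insert_self x S))
    refine ⟨Function.update v x v₀, Function.update T x T₀, fun y hy => ?_, ?_⟩
    · rcases Finset.mem_insert.1 hy with rfl | hyS
      · simpa using hT₀
      · have : y ≠ x := by rintro rfl; exact hx hyS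
        simpa [this] using hT y hyS
    · have : ∑ y ∈ S, Function.update T x T₀ y = ∑ y ∈ S, T y :=
        Finset.sum_congr rfl fun y hy => Function.update_of_ne (by rintro rfl; exact hx hy) _ _
      rw [Finset.sum_insert hx, this, Function.update_self, Gates.ins_add,
        add_comm (Gates.ins T₀), ← add_assoc]
      exact hn₀

theorem sum_occurrences {S : Finset X} {o : List (X × ℕ)} (h : ∀ x ∈ o.map Prod.fst, x ∈ S) :
    ∑ x ∈ S, (occurrences x o : Multiset ℕ) = (o.map Prod.snd : List ℕ) := by
  induction o with
  | nil => simp [occurrences]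
  | cons l o ih =>
    have hl : l.1 ∈ S := h _ (by simp)
    have : ∀ x, (occurrences x (l :: o) : Multiset ℕ) =
        (if l.1 = x then {l.2} else 0) + (occurrences x o : Multiset ℕ) := by
      intro x
      by_cases hx : l.1 = x <;> simp [occurrences, hx]
    simp only [this, Finset.sum_add_distrib, ih fun x hx => h x (by simp at hx ⊢; grind),
      Finset.sum_ite_eq, hl, if_true, List.map_cons, ← Multiset.cons_coe, Multiset.singleton_add]

theorem freeTrees_balance {S : Finset X} {o : List (X × ℕ)} (h : ∀ x ∈ o.map Prod.fst, x ∈ S)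
    {v : X → ℕ} {T : X → Gates Γ} (hT : ∀ x ∈ S, FanTree (v x) (occurrences x o) (T x)) :
    Gates.ins (∑ x ∈ S, T x) + (o.map Prod.snd : List ℕ) =
      Gates.outs (∑ x ∈ S, T x) + ∑ x ∈ S, {v x} := by
  rw [Gates.ins_sum, Gates.outs_sum, ← sum_occurrences h, ← Finset.sum_add_distrib,
    ← Finset.sum_add_distrib]
  exact Finset.sum_congr rfl fun x hx => (hT x hx).balance

theorem conversion_balance {A : Term X} {r : ℕ} {o : List (X × ℕ)} {D : Gates Γ} {v : X → ℕ}
    {T : X → Gates Γ} (hA : BoundTree A r o D)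
    (hT : ∀ x ∈ A.fv, FanTree (v x) (occurrences x o) (T x)) :
    Gates.ins (D + ∑ x ∈ A.fv, T x) + {r} =
      Gates.outs (D + ∑ x ∈ A.fv, T x) + ∑ x ∈ A.fv, {v x} := by
  ext n
  have h1 := congrArg (Multiset.count n) hA.balance
  have h2 := congrArg (Multiset.count n) (freeTrees_balance (fun x hx => hA.mem_labels.1 hx) hT)
  simp only [Gates.ins_add, Gates.outs_add, Multiset.count_add] at h1 h2 ⊢
  omega

/-- Transformations of `A` are presented by a bound tree and fan trees for the free variables that
give no edge two targets. -/
theorem isConversion_iff {A : Term X} {G : GRAPH Γ} :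
    IsConversion A G ↔ ∃ (r : ℕ) (o : List (X × ℕ)) (D : Gates Γ) (v : X → ℕ) (T : X → Gates Γ)
      (P : Presentation Γ), BoundTree A r o D ∧
      (∀ x ∈ A.fv, FanTree (v x) (occurrences x o) (T x)) ∧ P.1 = D + ∑ x ∈ A.fv, T x ∧
      (Gates.ins P.1 + {r}).Nodup ∧ P.graph = G := by
  simp only [IsConversion]
  have key : ∀ (P : Presentation Γ) (r : ℕ), (Gates.ins P.1 + {r}).Nodup ↔ r ∉ P.1.ins := by
    intro P r
    rw [add_comm, Multiset.singleton_add, Multiset.nodup_cons]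
    exact and_iff_left P.2.1
  simp only [key]

theorem exists_isConversion (A : Term X) : ∃ G : GRAPH Γ, IsConversion A G := by
  obtain ⟨r, o, D, hA, hn⟩ := exists_boundTree (Γ := Γ) (s := 0) (by simp) A
  obtain ⟨v, T, hT, hn⟩ := exists_freeTrees (Γ := Γ) hn o A.fv fun x hx h =>
    hA.occurrences_eq_nil.1 h hx
  have hn' : (Gates.ins (D + ∑ x ∈ A.fv, T x) + {r}).Nodup := by
    convert hn using 1
    rw [Gates.ins_add]
    abel
  exact ⟨_, isConversion_iff.2 ⟨r, o, D, v, T,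
    ⟨_, isLinear_of_balance (conversion_balance hA hT) hn'⟩, hA, hT, rfl, hn', rfl⟩⟩

variable [Infinite X]

theorem Term.Alpha.fv_eq {A B : Term X} (h : Alpha A B) : A.fv = B.fv := by
  obtain ⟨r, o, D, hA, -⟩ := exists_boundTree (Γ := Unit) (s := 0) (by simp) A
  ext x
  rw [← hA.mem_labels, ← (h.boundTree_iff.1 hA).mem_labels]

theorem Term.Alpha.isConversion_iff {A B : Term X} (h : Alpha A B) {G : GRAPH Γ} :
    IsConversion A G ↔ IsConversion B G := by
  simp only [IsConversion, h.boundTree_iff, h.fv_eq]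

end Conversion

/-! ### Sequences of (CO-ASSOC) moves -/

section Steps

variable {Γ : Type*}

/-- `CoAssocSteps k G H`: one passes from `G` to `H` by `k` moves (CO-ASSOC). -/
inductive CoAssocSteps : ℕ → GRAPH Γ → GRAPH Γ → Prop
  | refl (G : GRAPH Γ) : CoAssocSteps 0 G G
  | head {k : ℕ} {G H K : GRAPH Γ} :
      CoAssocMove G H → CoAssocSteps k H K → CoAssocSteps (k + 1) G K

theorem CoAssocMove.symm {G H : GRAPH Γ} (h : CoAssocMove G H) : CoAssocMove H G := by
  cases h with
  | right D D' C a m e₁ e₂ e₃ h h' => exact .left D' D C a m e₁ e₂ e₃ h' h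
  | left D D' C a m e₁ e₂ e₃ h h' => exact .right D' D C a m e₁ e₂ e₃ h' h

namespace CoAssocSteps

theorem trans {k l : ℕ} {G H K : GRAPH Γ} (h : CoAssocSteps k G H) (h' : CoAssocSteps l H K) :
    CoAssocSteps (k + l) G K := by
  induction h with
  | refl G => rwa [zero_add]
  | head hm _ ih =>
    rw [add_right_comm]
    exact .head hm (ih h')

theorem symm {k : ℕ} {G H : GRAPH Γ} (h : CoAssocSteps k G H) : CoAssocSteps k H G := by
  induction h with
  | refl G => exact .refl G
  | head hm _ ih => exact ih.trans (.head hm.symm (.refl _))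

theorem reflTransGen {k : ℕ} {G H : GRAPH Γ} (h : CoAssocSteps k G H) :
    ReflTransGen CoAssocMove G H := by
  induction h with
  | refl G => exact .refl
  | head hm _ ih => exact .head hm ih

theorem exists_path {k : ℕ} {G H : GRAPH Γ} (h : CoAssocSteps k G H) :
    ∃ F : ℕ → GRAPH Γ, F 0 = G ∧ F k = H ∧ ∀ i < k, CoAssocMove (F i) (F (i + 1)) := by
  induction h with
  | refl G => exact ⟨fun _ => G, rfl, rfl, by simp⟩
  | @head k G H K hm _ ih =>
    obtain ⟨F, h0, hk, hF⟩ := ih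
    refine ⟨fun i => Nat.casesOn i G F, rfl, hk, ?_⟩
    rintro (_ | i) hi
    · simpa [h0] using hm
    · exact hF i (by omega)

end CoAssocSteps

/-- `T` is carried to `T'` by `k` moves (CO-ASSOC) inside any graph, with the same names of edges. -/
def CoAssocIn (k : ℕ) (T T' : Gates Γ) : Prop :=
  Gates.ins T = Gates.ins T' ∧ Gates.outs T = Gates.outs T' ∧
    ∀ P P' : Presentation Γ, ∀ C : Gates Γ, P.1 = C + T → P'.1 = C + T' →
      CoAssocSteps k P.graph P'.graph

namespace CoAssocIn

theorem refl (T : Gates Γ) : CoAssocIn 0 T T :=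
  ⟨rfl, rfl, fun _ _ _ h h' => graph_congr (h.trans h'.symm) ▸ .refl _⟩

theorem trans {k l : ℕ} {T T' T'' : Gates Γ} (h : CoAssocIn k T T') (h' : CoAssocIn l T' T'') :
    CoAssocIn (k + l) T T'' := by
  refine ⟨h.1.trans h'.1, h.2.1.trans h'.2.1, fun P P' C hP hP' => ?_⟩
  have hl : Gates.IsLinear (C + T') := by
    have := P.2
    rw [hP] at this
    simpa [Gates.IsLinear, h.1, h.2.1] using this
  exact (h.2.2 P ⟨_, hl⟩ C hP rfl).trans (h'.2.2 ⟨_, hl⟩ P' C rfl hP')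

theorem add_left {k : ℕ} {T T' : Gates Γ} (E : Gates Γ) (h : CoAssocIn k T T') :
    CoAssocIn k (E + T) (E + T') :=
  ⟨by simp [h.1], by simp [h.2.1], fun P P' C hP hP' =>
    h.2.2 P P' (C + E) (by rw [hP, add_assoc]) (by rw [hP', add_assoc])⟩

theorem add {k l : ℕ} {T T' E E' : Gates Γ} (h : CoAssocIn k T T') (h' : CoAssocIn l E E') :
    CoAssocIn (k + l) (T + E) (T' + E') := by
  have := h.add_left E
  rw [add_comm E, add_comm E] at this
  exact this.trans (h'.add_left T')

theorem rotate (a m e₁ e₂ e₃ : ℕ) :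
    CoAssocIn 1 ({Gate.fan a m e₃} + {Gate.fan m e₁ e₂} : Gates Γ)
      ({Gate.fan a e₁ m} + {Gate.fan m e₂ e₃}) := by
  refine ⟨by simp [Gate.ins], ?_, fun P P' C hP hP' => ?_⟩
  · simp only [Gates.outs_add, Gates.outs_singleton, Gate.outs, Multiset.insert_eq_cons,
      ← Multiset.singleton_add]
    abel
  · exact .head (.right P P' C a m e₁ e₂ e₃ hP hP') (.refl _)

end CoAssocIn

/-- `Comb v es T`: `T` is a fan tree in which every left exit ends in a leaf. -/
inductive Comb : ℕ → List ℕ → Gates Γ → Prop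
  | leaf (v e : ℕ) : Comb v [e] {Gate.arrow v e}
  | node (v a b e : ℕ) (es : List ℕ) (T : Gates Γ) :
      Comb b es T → Comb v (e :: es) ({Gate.fan v a b} + {Gate.arrow a e} + T)

theorem Comb.fanTree {v : ℕ} {es : List ℕ} {T : Gates Γ} (h : Comb v es T) : FanTree v es T := by
  induction h with
  | leaf v e => exact .leaf v e
  | node v a b e es T _ ih => exact .node v a b [e] es _ _ (.leaf a e) ih

theorem Comb.root_mem {v : ℕ} {es : List ℕ} {T : Gates Γ} (h : Comb v es T) :
    v ∈ Gates.ins T := by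
  cases h <;> simp [Gate.ins]

/-- Rotations at the root move a left subtree, leaf by leaf, in front of a comb. -/
theorem FanTree.exists_comb_node {a : ℕ} {es₁ : List ℕ} {T₁ : Gates Γ} (h₁ : FanTree a es₁ T₁)
    {b : ℕ} {es₂ : List ℕ} {T₂ : Gates Γ} (h₂ : Comb b es₂ T₂) (v : ℕ) :
    ∃ k T', k + 1 ≤ es₁.length ∧ Comb v (es₁ ++ es₂) T' ∧
      CoAssocIn k ({Gate.fan v a b} + T₁ + T₂) T' := by
  induction h₁ generalizing b es₂ T₂ v with
  | leaf a e => exact ⟨0, _, by simp, .node v a b e es₂ T₂ h₂, .refl _⟩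
  | node a a₁ a₂ es es' T T' _ _ ih ih' =>
    obtain ⟨k', S', hk', hS', hco'⟩ := ih' h₂ a
    obtain ⟨k, S, hk, hS, hco⟩ := ih hS' v
    refine ⟨1 + k' + k, S, by simp; omega, by simpa using hS, ?_⟩
    have h1 := (CoAssocIn.rotate (Γ := Γ) v a a₁ a₂ b).add_left (T + T' + T₂)
    have h2 := hco'.add_left ({Gate.fan v a₁ a} + T)
    rw [show {Gate.fan v a b} + ({Gate.fan a a₁ a₂} + T + T') + T₂ =
      T + T' + T₂ + ({Gate.fan v a b} + {Gate.fan a a₁ a₂}) by abel]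
    rw [show T + T' + T₂ + ({Gate.fan v a₁ a} + {Gate.fan a a₂ b}) =
      {Gate.fan v a₁ a} + T + ({Gate.fan a a₂ b} + T' + T₂) by abel] at h1
    exact (h1.trans h2).trans hco

theorem FanTree.exists_comb {v : ℕ} {es : List ℕ} {T : Gates Γ} (h : FanTree v es T) :
    ∃ k T', k + 1 ≤ es.length ∧ Comb v es T' ∧ CoAssocIn k T T' := by
  induction h with
  | leaf v e => exact ⟨0, _, by simp, .leaf v e, .refl _⟩
  | node v a b es₁ es₂ T₁ T₂ h₁ _ _ ih₂ =>
    obtain ⟨k₂, S₂, hk₂, hS₂, hco₂⟩ := ih₂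
    obtain ⟨k, S, hk, hS, hco⟩ := h₁.exists_comb_node hS₂ v
    exact ⟨k₂ + k, S, by simp; omega, hS, (hco₂.add_left _).trans hco⟩

/-- Two combs with corresponding leaves differ by the names of the other edges. -/
theorem Comb.exists_rename {v : ℕ} {es : List ℕ} {T : Gates Γ} (h : Comb v es T)
    {v' : ℕ} {f : ℕ → ℕ} {T' : Gates Γ} (h' : Comb v' (es.map f) T') (hn : (Gates.ins T).Nodup)
    (hes : ∀ e ∈ es, e ∉ Gates.ins T) :
    ∃ f' : ℕ → ℕ, (∀ n, n ∉ Gates.ins T → f' n = f n) ∧ f' v = v' ∧ T' = Gates.rename f' T := by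
  induction h generalizing v' T' with
  | leaf v e =>
    cases h' with
    | leaf =>
      refine ⟨Function.update f v v', fun n hn => ?_, by simp, ?_⟩
      · rw [Function.update_of_ne]
        simpa [Gate.ins] using hn
      · have : e ≠ v := by simpa [Gate.ins] using hes e (by simp)
        simp [Gate.rename, this]
    | node v' a' b' e' es' T' h => cases h
  | node v a b e es T hT ih =>
    generalize hm : (e :: es).map f = es' at h'
    cases h' with
    | leaf =>
      rw [List.map_cons, List.cons.injEq, List.map_eq_nil_iff] at hm
      exact absurd hm.2 hT.fanTree.ne_nil
    | node v' a' b' e' es' T' h =>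
      obtain ⟨rfl, rfl⟩ := List.cons.inj hm
      have hins : Gates.ins ({Gate.fan v a b} + {Gate.arrow a e} + T) =
          v ::ₘ a ::ₘ Gates.ins T := by
        simp only [Gates.ins_add, Gates.ins_singleton, Gate.ins, ← Multiset.singleton_add]
        abel
      simp only [hins, Multiset.nodup_cons, Multiset.mem_cons, List.mem_cons,
        not_or] at hn hes ⊢
      obtain ⟨⟨hva, hv⟩, ha, hn⟩ := hn
      obtain ⟨f₁, h1, h2, rfl⟩ := ih h hn fun e he => (hes e (.inr he)).2.2
      have hb := hT.root_mem
      have hbv : b ≠ v := by rintro rfl; exact hv hb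
      have hba : b ≠ a := by rintro rfl; exact ha hb
      have he := hes e (.inl rfl)
      refine ⟨Function.update (Function.update f₁ v v') a a', fun n hn => ?_, by simp [hva], ?_⟩
      · rw [Function.update_of_ne hn.2.1, Function.update_of_ne hn.1, h1 n hn.2.2]
      · have : Gates.rename f₁ T =
            Gates.rename (Function.update (Function.update f₁ v v') a a') T := by
          refine Gates.rename_congr fun n hn => ?_
          have : n ≠ v ∧ n ≠ a := by
            rcases hn with hn | hn
            · exact ⟨by rintro rfl; exact hv hn, by rintro rfl; exact ha hn⟩
            · have h3 : n ∈ Gates.ins T + (es : Multiset ℕ) := by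
                rw [hT.fanTree.balance]; exact Multiset.mem_add.2 (.inl hn)
              rcases Multiset.mem_add.1 h3 with hn | hn
              · exact ⟨by rintro rfl; exact hv hn, by rintro rfl; exact ha hn⟩
              · have := hes n (.inr hn)
                exact ⟨this.1, this.2.1⟩
          rw [Function.update_of_ne this.2, Function.update_of_ne this.1]
        rw [this]
        simp [Gate.rename, hva, hbv, hba, h2, he, h1]

end Steps

/-! ### Uniqueness of transformations up to (CO-ASSOC) -/

section Uniqueness

variable {X Γ : Type*}

theorem Term.leaves_pos (A : Term X) : 0 < A.leaves := by
  induction A <;> simp_all [Term.leaves]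

variable [DecidableEq X]

/-- `CombTree A r o D`: like `BoundTree A r o D`, with combs as the trees of `Υ` gates. -/
def CombTree : Term X → ℕ → List (X × ℕ) → Gates Γ → Prop
  | .var x, r, o, D => o = [(x, r)] ∧ D = 0
  | .app M N, r, o, D => ∃ p q o₁ o₂ D₁ D₂, CombTree M p o₁ D₁ ∧ CombTree N q o₂ D₂ ∧
      o = o₁ ++ o₂ ∧ D = D₁ + D₂ + {Gate.app p q r}
  | .lam x M, r, o, D => ∃ p v o₁ D₁ T, CombTree M p o₁ D₁ ∧
      (occurrences x o₁ = [] ∧ T = {Gate.top v} ∨ Comb v (occurrences x o₁) T) ∧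
      o = (o₁.filter fun l => l.1 ≠ x) ∧ D = D₁ + T + {Gate.lam p v r}

theorem CombTree.boundTree {A : Term X} {r : ℕ} {o : List (X × ℕ)} {D : Gates Γ}
    (h : CombTree A r o D) : BoundTree A r o D := by
  induction A generalizing r o D with
  | var x => exact BoundTree.var_iff.2 h
  | app M N ihM ihN =>
    obtain ⟨p, q, o₁, o₂, D₁, D₂, h₁, h₂, h⟩ := h
    exact BoundTree.app_iff.2 ⟨p, q, o₁, o₂, D₁, D₂, ihM h₁, ihN h₂, h⟩
  | lam x M ih =>
    obtain ⟨p, v, o₁, D₁, T, h₁, hT, h⟩ := h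
    exact BoundTree.lam_iff.2 ⟨p, v, o₁, D₁, T, ih h₁, hT.imp_right Comb.fanTree, h⟩

/-- Every bound or free occurrence contributes at most one rotation, and the free ones are left for
the trees of the free variables. -/
theorem BoundTree.exists_combTree {A : Term X} {r : ℕ} {o : List (X × ℕ)} {D : Gates Γ}
    (h : BoundTree A r o D) :
    ∃ k D', k + o.length ≤ A.leaves ∧ CombTree A r o D' ∧ CoAssocIn k D D' := by
  induction A generalizing r o D with
  | var x =>
    obtain ⟨rfl, rfl⟩ := var_iff.1 h
    exact ⟨0, 0, by simp [Term.leaves], ⟨rfl, rfl⟩, .refl _⟩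
  | app M N ihM ihN =>
    obtain ⟨p, q, o₁, o₂, D₁, D₂, h₁, h₂, rfl, rfl⟩ := app_iff.1 h
    obtain ⟨k₁, D₁', hk₁, hc₁, hco₁⟩ := ihM h₁
    obtain ⟨k₂, D₂', hk₂, hc₂, hco₂⟩ := ihN h₂
    exact ⟨k₁ + k₂ + 0, _, by simp [Term.leaves]; omega,
      ⟨p, q, o₁, o₂, _, _, hc₁, hc₂, rfl, rfl⟩, (hco₁.add hco₂).add (.refl _)⟩
  | lam x M ih =>
    obtain ⟨p, v, o₁, D₁, T, h₁, hT, rfl, rfl⟩ := lam_iff.1 h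
    obtain ⟨k₁, D₁', hk₁, hc₁, hco₁⟩ := ih h₁
    have hcard := congrArg Multiset.card (occurrences_add_filter x o₁)
    simp only [Multiset.card_add, Multiset.coe_card, List.length_map] at hcard
    obtain ⟨k₂, T', hk₂, hT', hco₂⟩ : ∃ k T', k ≤ (occurrences x o₁).length ∧
        (occurrences x o₁ = [] ∧ T' = {Gate.top v} ∨ Comb v (occurrences x o₁) T') ∧
        CoAssocIn k T T' := by
      rcases hT with hT | hT
      · exact ⟨0, T, by simp, .inl hT, .refl _⟩
      · obtain ⟨k, T', hk, hT', hco⟩ := hT.exists_comb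
        exact ⟨k, T', by omega, .inr hT', hco⟩
    exact ⟨k₁ + k₂ + 0, _, by simp only [Term.leaves]; omega,
      ⟨p, v, o₁, _, _, hc₁, hT', rfl, rfl⟩, (hco₁.add hco₂).add (.refl _)⟩

theorem BoundTree.mem_of_hasEdge {A : Term X} {r : ℕ} {o : List (X × ℕ)} {D : Gates Γ}
    (h : BoundTree A r o D) {n : ℕ} (hn : D.HasEdge n) : n ∈ Gates.ins D + {r} := by
  rcases hn with hn | hn
  · exact Multiset.mem_add.2 (.inl hn)
  · rw [h.balance]
    exact Multiset.mem_add.2 (.inl hn)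

theorem BoundTree.mem_of_mem_leaves {A : Term X} {r : ℕ} {o : List (X × ℕ)} {D : Gates Γ}
    (h : BoundTree A r o D) {l : X × ℕ} (hl : l ∈ o) : l.2 ∈ Gates.ins D + {r} := by
  rw [h.balance]
  exact Multiset.mem_add.2 (.inr (Multiset.mem_coe.2 (List.mem_map_of_mem hl)))

/-- Two graphs of the same term with combs differ by the names of the edges. -/
theorem CombTree.exists_rename {A : Term X} {r r' : ℕ} {o o' : List (X × ℕ)} {D D' : Gates Γ}
    (h : CombTree A r o D) (h' : CombTree A r' o' D') (hn : (Gates.ins D + {r}).Nodup) :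
    ∃ f : ℕ → ℕ, f r = r' ∧ o' = (o.map fun l => (l.1, f l.2)) ∧ D' = Gates.rename f D := by
  induction A generalizing r r' o o' D D' with
  | var x =>
    obtain ⟨rfl, rfl⟩ := h
    obtain ⟨rfl, rfl⟩ := h'
    exact ⟨fun _ => r', rfl, rfl, rfl⟩
  | app M N ihM ihN =>
    obtain ⟨p, q, o₁, o₂, D₁, D₂, h₁, h₂, rfl, rfl⟩ := h
    obtain ⟨p', q', o₁', o₂', D₁', D₂', h₁', h₂', rfl, rfl⟩ := h'
    have hn' : ((Gates.ins D₁ + {p}) + (Gates.ins D₂ + {q}) + {r}).Nodup := by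
      convert hn using 1
      simp only [Gates.ins_add, Gates.ins_singleton, Gate.ins, ← Multiset.singleton_add,
        Multiset.insert_eq_cons]
      abel
    rw [Multiset.nodup_add, Multiset.nodup_add, Multiset.disjoint_left, Multiset.disjoint_left]
      at hn'
    obtain ⟨⟨hn₁, hn₂, hd⟩, -, hr⟩ := hn'
    replace hr : ∀ n ∈ Gates.ins D₁ + {p} + (Gates.ins D₂ + {q}), n ≠ r := fun n h => by
      simpa using hr h
    obtain ⟨f₁, hf₁, rfl, rfl⟩ := ihM h₁ h₁' hn₁
    obtain ⟨f₂, hf₂, rfl, rfl⟩ := ihN h₂ h₂' hn₂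
    classical
    set f : ℕ → ℕ := fun n => if n = r then r' else if n ∈ Gates.ins D₁ + {p} then f₁ n else f₂ n
      with hf
    have e₁ : ∀ n ∈ Gates.ins D₁ + {p}, f n = f₁ n := fun n h => by
      simp only [hf, hr n (Multiset.mem_add.2 (.inl h)), if_false, if_pos h]
    have e₂ : ∀ n ∈ Gates.ins D₂ + {q}, f n = f₂ n := fun n h => by
      have : n ∉ Gates.ins D₁ + {p} := fun h' => hd h' h
      simp only [hf, hr n (Multiset.mem_add.2 (.inr h)), if_false, if_neg this]
    have er : f r = r' := by simp [hf]
    refine ⟨f, er, ?_, ?_⟩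
    · rw [List.map_append]
      congr 1
      · exact List.map_congr_left fun l hl => by rw [e₁ _ (h₁.boundTree.mem_of_mem_leaves hl)]
      · exact List.map_congr_left fun l hl => by rw [e₂ _ (h₂.boundTree.mem_of_mem_leaves hl)]
    · simp only [Gates.rename_add, Gates.rename_singleton, Gate.rename, er]
      rw [e₁ p (by simp), e₂ q (by simp), hf₁, hf₂,
        Gates.rename_congr fun n hn => e₁ n (h₁.boundTree.mem_of_hasEdge hn),
        Gates.rename_congr fun n hn => e₂ n (h₂.boundTree.mem_of_hasEdge hn)]
  | lam x M ih =>
    obtain ⟨p, v, o₁, D₁, T, h₁, hT, rfl, rfl⟩ := h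
    obtain ⟨p', v', o₁', D₁', T', h₁', hT', rfl, rfl⟩ := h'
    have hn' : ((Gates.ins D₁ + {p}) + Gates.ins T + {r}).Nodup := by
      convert hn using 1
      simp only [Gates.ins_add, Gates.ins_singleton, Gate.ins]
      abel
    rw [Multiset.nodup_add, Multiset.nodup_add, Multiset.disjoint_left, Multiset.disjoint_left]
      at hn'
    obtain ⟨⟨hn₁, hn₂, hd⟩, -, hr⟩ := hn'
    replace hr : ∀ n ∈ Gates.ins D₁ + {p} + Gates.ins T, n ≠ r := fun n h => by
      simpa using hr h
    obtain ⟨f₁, hf₁, rfl, rfl⟩ := ih h₁ h₁' hn₁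
    rw [occurrences_map_snd] at hT'
    have hleaf : ∀ e ∈ occurrences x o₁, e ∈ Gates.ins D₁ + {p} := fun e he =>
      h₁.boundTree.mem_of_mem_leaves (mem_occurrences.1 he)
    have hB : Binder v (occurrences x o₁) T := hT.imp_right Comb.fanTree
    have hv : v ∈ Gates.ins T := by
      rcases hT with ⟨-, rfl⟩ | hT
      · simp [Gate.ins]
      · exact hT.root_mem
    obtain ⟨f₂, hf₂, hv₂, rfl⟩ : ∃ f' : ℕ → ℕ, (∀ n, n ∉ Gates.ins T → f' n = f₁ n) ∧
        f' v = v' ∧ T' = Gates.rename f' T := by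
      rcases hT with ⟨h0, rfl⟩ | hT
      · rcases hT' with ⟨-, rfl⟩ | hT'
        · refine ⟨Function.update f₁ v v', fun n hn => ?_, by simp, by simp [Gate.rename]⟩
          exact Function.update_of_ne (by simpa [Gate.ins] using hn) _ _
        · exact absurd (by simp [h0]) hT'.fanTree.ne_nil
      · rcases hT' with ⟨h0, -⟩ | hT'
        · exact absurd (List.map_eq_nil_iff.1 h0) hT.fanTree.ne_nil
        · exact hT.exists_rename hT' hn₂ fun e he => hd (hleaf e he)
    have e₁ : ∀ n ∈ Gates.ins D₁ + {p}, Function.update f₂ r r' n = f₁ n := fun n h => by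
      rw [Function.update_of_ne (hr n (Multiset.mem_add.2 (.inl h))), hf₂ n (hd h)]
    have e₂ : ∀ n, T.HasEdge n → Function.update f₂ r r' n = f₂ n := fun n h => by
      refine Function.update_of_ne (hr n ?_) _ _
      rcases h with h | h
      · exact Multiset.mem_add.2 (.inr h)
      · have : n ∈ Gates.ins T + (occurrences x o₁ : Multiset ℕ) := by
          rw [hB.balance]
          exact Multiset.mem_add.2 (.inl h)
        exact Multiset.mem_add.2 ((Multiset.mem_add.1 this).symm.imp_left (hleaf n))
    refine ⟨Function.update f₂ r r', by simp, ?_, ?_⟩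
    · rw [filter_map_snd]
      exact List.map_congr_left fun l hl => by
        rw [e₁ _ (h₁.boundTree.mem_of_mem_leaves (List.mem_of_mem_filter hl))]
    · simp only [Gates.rename_add, Gates.rename_singleton, Gate.rename, Function.update_self]
      rw [e₁ p (by simp), e₂ v (.inl hv), hf₁, hv₂,
        Gates.rename_congr fun n hn => e₁ n (h₁.boundTree.mem_of_hasEdge hn),
        Gates.rename_congr e₂]

theorem exists_comb_freeTrees {S : Finset X} {o : List (X × ℕ)} {v : X → ℕ} {T : X → Gates Γ}
    (hT : ∀ x ∈ S, FanTree (v x) (occurrences x o) (T x)) :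
    ∃ k, ∃ T' : X → Gates Γ, k ≤ ∑ x ∈ S, (occurrences x o).length ∧
      (∀ x ∈ S, Comb (v x) (occurrences x o) (T' x)) ∧
      CoAssocIn k (∑ x ∈ S, T x) (∑ x ∈ S, T' x) := by
  induction S using Finset.induction_on with
  | empty => exact ⟨0, T, by simp, by simp, .refl _⟩
  | insert x S hx ih =>
    obtain ⟨k, T', hk, hT', hco⟩ := ih fun y hy => hT y (Finset.mem_insert_of_mem hy)
    obtain ⟨k₀, T₀, hk₀, hT₀, hco₀⟩ := (hT x (Finset.mem_insert_self x S)).exists_comb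
    refine ⟨k₀ + k, Function.update T' x T₀, ?_, fun y hy => ?_, ?_⟩
    · rw [Finset.sum_insert hx]
      omega
    · rcases Finset.mem_insert.1 hy with rfl | hyS
      · simpa using hT₀
      · have : y ≠ x := by rintro rfl; exact hx hyS
        simpa [this] using hT' y hyS
    · have : ∑ y ∈ S, Function.update T' x T₀ y = ∑ y ∈ S, T' y :=
        Finset.sum_congr rfl fun y hy => Function.update_of_ne (by rintro rfl; exact hx hy) _ _
      rw [Finset.sum_insert hx, Finset.sum_insert hx, this, Function.update_self]
      exact hco₀.add hco

/-- The renaming `f` of the edges `s`, which contain the leaves, extends to the combs of the free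
variables. -/
theorem exists_rename_freeTrees {s : Multiset ℕ} {f : ℕ → ℕ} {S : Finset X} {o : List (X × ℕ)}
    (ho : ∀ l ∈ o, l.2 ∈ s) {v v' : X → ℕ} {T T' : X → Gates Γ}
    (hT : ∀ x ∈ S, Comb (v x) (occurrences x o) (T x))
    (hT' : ∀ x ∈ S, Comb (v' x) ((occurrences x o).map f) (T' x))
    (hn : (s + Gates.ins (∑ x ∈ S, T x)).Nodup) :
    ∃ f' : ℕ → ℕ, (∀ n ∈ s, f' n = f n) ∧
      ∑ x ∈ S, T' x = Gates.rename f' (∑ x ∈ S, T x) := by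
  induction S using Finset.induction_on with
  | empty => exact ⟨f, fun _ _ => rfl, rfl⟩
  | insert x S hx ih =>
    have hTx := hT x (Finset.mem_insert_self x S)
    have hTS : ∀ y ∈ S, Comb (v y) (occurrences y o) (T y) := fun y hy =>
      hT y (Finset.mem_insert_of_mem hy)
    rw [Finset.sum_insert hx, Gates.ins_add, add_comm (Gates.ins (T x)), ← add_assoc,
      Multiset.nodup_add, Multiset.disjoint_left] at hn
    obtain ⟨hn, hnx, hd⟩ := hn
    obtain ⟨f₁, hf₁, hr₁⟩ := ih hTS (fun y hy => hT' y (Finset.mem_insert_of_mem hy)) hn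
    have hleaf : ∀ y, ∀ e ∈ occurrences y o, e ∈ s := fun y e he => ho _ (mem_occurrences.1 he)
    have hTx' := hT' x (Finset.mem_insert_self x S)
    rw [← List.map_congr_left fun e he => hf₁ e (hleaf x e he)] at hTx'
    obtain ⟨f₂, hf₂, -, hr₂⟩ := hTx.exists_rename hTx' hnx fun e he =>
      hd (Multiset.mem_add.2 (.inl (hleaf x e he)))
    refine ⟨f₂, fun n hn => ?_, ?_⟩
    · rw [hf₂ n (hd (Multiset.mem_add.2 (.inl hn))), hf₁ n hn]
    · rw [Finset.sum_insert hx, Finset.sum_insert hx, Gates.rename_add, hr₂, hr₁]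
      congr 1
      refine Gates.rename_congr fun n hn => (hf₂ n (hd ?_)).symm
      rcases hn with hn | hn
      · exact Multiset.mem_add.2 (.inr hn)
      · rw [Gates.outs_sum, Multiset.mem_sum] at hn
        obtain ⟨y, hy, hn⟩ := hn
        have h : n ∈ Gates.ins (T y) + (occurrences y o : Multiset ℕ) := by
          rw [(hTS y hy).fanTree.balance]
          exact Multiset.mem_add.2 (.inl hn)
        rw [Gates.ins_sum]
        exact Multiset.mem_add.2 ((Multiset.mem_add.1 h).symm.imp (hleaf y n)
          fun h => Multiset.mem_sum.2 ⟨y, hy, h⟩)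

/-- A renaming is injective if it leads to a graph in which no edge has two targets. -/
theorem graph_rename_of_nodup {P P' : Presentation Γ} {D : Gates Γ} {F : Multiset ℕ} {r : ℕ}
    {f : ℕ → ℕ} (hD : Gates.ins D + {r} = Gates.outs D + F) (hP : P.1 = D)
    (hP' : P'.1 = P.1.rename f) (hn : (Gates.ins P'.1 + {f r}).Nodup) : P.graph = P'.graph := by
  subst hP
  rw [hP', Gates.ins_rename, ← Multiset.map_singleton f r, ← Multiset.map_add] at hn
  have key : ∀ n, P.1.HasEdge n → n ∈ Gates.ins P.1 + {r} := by
    rintro n (h | h)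
    · exact Multiset.mem_add.2 (.inl h)
    · rw [hD]
      exact Multiset.mem_add.2 (.inl h)
  exact graph_rename f
    (fun m hm n hn' h => Multiset.inj_on_of_nodup_map hn m (key m hm) n (key n hn') h) hP'

/-- Presentations that are made of the same combs have the same graph. -/
theorem graph_eq_of_combs {A : Term X} {r r' : ℕ} {o o' : List (X × ℕ)} {D D' : Gates Γ}
    {v v' : X → ℕ} {T T' : X → Gates Γ} {P P' : Presentation Γ} (hA : CombTree A r o D)
    (hA' : CombTree A r' o' D') (hT : ∀ x ∈ A.fv, Comb (v x) (occurrences x o) (T x))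
    (hT' : ∀ x ∈ A.fv, Comb (v' x) (occurrences x o') (T' x)) (hP : P.1 = D + ∑ x ∈ A.fv, T x)
    (hP' : P'.1 = D' + ∑ x ∈ A.fv, T' x) (hn : (Gates.ins P.1 + {r}).Nodup)
    (hn' : (Gates.ins P'.1 + {r'}).Nodup) : P.graph = P'.graph := by
  have hn₂ : ((Gates.ins D + {r}) + Gates.ins (∑ x ∈ A.fv, T x)).Nodup := by
    convert hn using 1
    rw [hP, Gates.ins_add]
    abel
  obtain ⟨f, hr, rfl, hD⟩ := hA.exists_rename hA' (Multiset.nodup_add.1 hn₂).1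
  simp only [occurrences_map_snd] at hT'
  obtain ⟨f', hf', hT''⟩ := exists_rename_freeTrees
    (fun l hl => hA.boundTree.mem_of_mem_leaves hl) hT hT' hn₂
  have hPP : P'.1 = Gates.rename f' P.1 := by
    rw [hP', hP, Gates.rename_add, hT'', hD]
    congr 1
    exact Gates.rename_congr fun n hn => (hf' n (hA.boundTree.mem_of_hasEdge hn)).symm
  rw [hP', Gates.ins_add] at hn'
  refine graph_rename_of_nodup (conversion_balance hA.boundTree fun x hx => (hT x hx).fanTree)
    hP hPP ?_
  rwa [hf' r (by simp), hr, hP', Gates.ins_add]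

/-- Both transformations are carried to combs, by at most `A.leaves` moves each. -/
theorem coAssocSteps_of_isConversion {A : Term X} {G' G'' : GRAPH Γ} (h' : IsConversion A G')
    (h'' : IsConversion A G'') : ∃ k ≤ 2 ^ A.leaves, CoAssocSteps k G' G'' := by
  have key : ∀ G : GRAPH Γ, IsConversion A G →
      ∃ (r : ℕ) (o : List (X × ℕ)) (D : Gates Γ) (v : X → ℕ) (T : X → Gates Γ)
      (P : Presentation Γ) (k : ℕ), CombTree A r o D ∧
      (∀ x ∈ A.fv, Comb (v x) (occurrences x o) (T x)) ∧ P.1 = D + ∑ x ∈ A.fv, T x ∧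
      (Gates.ins P.1 + {r}).Nodup ∧ k ≤ A.leaves ∧ CoAssocSteps k G P.graph := by
    intro G hG
    obtain ⟨r, o, D, v, T, P, hA, hT, hP, hn, rfl⟩ := isConversion_iff.1 hG
    obtain ⟨k₁, D', hk₁, hA', hco₁⟩ := hA.exists_combTree
    obtain ⟨k₂, T', hk₂, hT', hco₂⟩ := exists_comb_freeTrees hT
    have hcard := congrArg Multiset.card (sum_occurrences fun x hx => hA.mem_labels.1 hx)
    simp only [Multiset.card_sum, Multiset.coe_card, List.length_map] at hcard
    have hco := hco₁.add hco₂
    have hl : Gates.IsLinear (D' + ∑ x ∈ A.fv, T' x) := by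
      have := P.2
      rw [hP] at this
      simpa only [Gates.IsLinear, hco.1, hco.2.1] using this
    refine ⟨r, o, D', v, T', ⟨_, hl⟩, k₁ + k₂, hA', hT', rfl, ?_, by omega,
      hco.2.2 P _ 0 (by rw [hP, zero_add]) (by rw [zero_add])⟩
    rw [hP, hco.1] at hn
    exact hn
  obtain ⟨r', o', D', v', T', P', k', hA', hT', hP', hn', hk', hs'⟩ := key G' h'
  obtain ⟨r'', o'', D'', v'', T'', P'', k'', hA'', hT'', hP'', hn'', hk'', hs''⟩ := key G'' h''
  rw [graph_eq_of_combs hA' hA'' hT' hT'' hP' hP'' hn' hn''] at hs'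
  refine ⟨k' + k'', ?_, hs'.trans hs''.symm⟩
  -- `2 * n ≤ 2 ^ n` for `0 < n`
  obtain ⟨m, hm⟩ := Nat.exists_eq_succ_of_ne_zero A.leaves_pos.ne'
  have : m < 2 ^ m := Nat.lt_two_pow_self
  rw [hm, Nat.succ_eq_add_one, pow_succ]
  omega

end Uniqueness

/-! ### Oriented paths and lambda graphs -/

section Paths

variable {Γ : Type*}

namespace Gates

theorem Reach.mono {C D : Gates Γ} (h : C ≤ D) {a b : ℕ} (hab : C.Reach a b) : D.Reach a b :=
  ReflTransGen.mono (fun _ _ ⟨g, hg, h'⟩ => ⟨g, Multiset.mem_of_le h hg, h'⟩) _ _ hab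

theorem Reach.rename {D : Gates Γ} (f : ℕ → ℕ) {a b : ℕ} (h : D.Reach a b) :
    (D.rename f).Reach (f a) (f b) :=
  ReflTransGen.lift f (fun _ _ ⟨g, hg, ha, hb⟩ => ⟨g.rename f, Multiset.mem_map_of_mem _ hg,
    by simpa using ⟨_, ha, rfl⟩, by simpa using ⟨_, hb, rfl⟩⟩) _ _ h

theorem hasEdge_of_mem_ins {D : Gates Γ} {g : Gate Γ} (hg : g ∈ D) {n : ℕ} (hn : n ∈ g.ins) :
    D.HasEdge n := .inl (mem_ins.2 ⟨g, hg, hn⟩)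

theorem hasEdge_of_mem_outs {D : Gates Γ} {g : Gate Γ} (hg : g ∈ D) {n : ℕ} (hn : n ∈ g.outs) :
    D.HasEdge n := .inr (mem_outs.2 ⟨g, hg, hn⟩)

theorem exists_lam_of_mem_rename {D : Gates Γ} {f : ℕ → ℕ} {p' v' r' : ℕ}
    (h : Gate.lam p' v' r' ∈ D.rename f) :
    ∃ p v r, Gate.lam p v r ∈ D ∧ f p = p' ∧ f v = v' ∧ f r = r' := by
  obtain ⟨g, hg, he⟩ := Multiset.mem_map.1 h
  cases g <;> simp [Gate.rename] at he
  exact ⟨_, _, _, hg, he⟩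

theorem exists_top_of_mem_rename {D : Gates Γ} {f : ℕ → ℕ} {t' : ℕ}
    (h : Gate.top t' ∈ D.rename f) : ∃ t, Gate.top t ∈ D ∧ f t = t' := by
  obtain ⟨g, hg, he⟩ := Multiset.mem_map.1 h
  cases g <;> simp [Gate.rename] at he
  exact ⟨_, hg, he⟩

theorem exists_eps_of_mem_rename {D : Gates Γ} {f : ℕ → ℕ} {ε : Γ} {a' b' c' : ℕ}
    (h : Gate.eps ε a' b' c' ∈ D.rename f) : ∃ a b c, Gate.eps ε a b c ∈ D := by
  obtain ⟨g, hg, he⟩ := Multiset.mem_map.1 h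
  cases g <;> simp [Gate.rename] at he
  rw [he.1] at hg
  exact ⟨_, _, _, hg⟩

/-- Paths of an injectively renamed collection lift. -/
theorem exists_reach_of_rename {D : Gates Γ} {f : ℕ → ℕ} {s : Set ℕ} (hf : Set.InjOn f s)
    (hs : ∀ n, D.HasEdge n → n ∈ s) {a n : ℕ} (ha : a ∈ s) (h : (D.rename f).Reach (f a) n) :
    ∃ b ∈ s, f b = n ∧ D.Reach a b := by
  induction h with
  | refl => exact ⟨a, ha, rfl, .refl⟩
  | tail _ hst ih =>
    obtain ⟨b, hb, rfl, hab⟩ := ih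
    obtain ⟨g', hg', hi, ho⟩ := hst
    obtain ⟨g, hg, rfl⟩ := Multiset.mem_map.1 hg'
    rw [Gate.ins_rename, Multiset.mem_map] at hi
    rw [Gate.outs_rename, Multiset.mem_map] at ho
    obtain ⟨i, hi, hib⟩ := hi
    obtain ⟨c, hc, rfl⟩ := ho
    obtain rfl := hf (hs i (hasEdge_of_mem_ins hg hi)) hb hib
    exact ⟨c, hs c (hasEdge_of_mem_outs hg hc), rfl, hab.tail ⟨g, hg, hi, hc⟩⟩

theorem IsLambda.rename {D : Gates Γ} {f : ℕ → ℕ} (hf : Set.InjOn f {n | D.HasEdge n})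
    (hD : D.IsLambda) : (D.rename f).IsLambda := by
  refine ⟨fun ε a b c h => ?_, fun C' p' v' r' hC' e' he' => ?_⟩
  · obtain ⟨a, b, c, h⟩ := exists_eps_of_mem_rename h
    exact hD.1 _ _ _ _ h
  · obtain ⟨p, v, r, hg, rfl, rfl, rfl⟩ := exists_lam_of_mem_rename
      (hC' ▸ Multiset.mem_cons_self _ C')
    obtain ⟨C, rfl⟩ := Multiset.exists_cons_of_mem hg
    rw [rename_cons, Gate.rename, Multiset.cons_inj_right] at hC'
    subst hC'
    obtain ⟨e, he, rfl, hve⟩ := exists_reach_of_rename hf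
      (fun n hn => hn.imp (by simp; tauto) (by simp; tauto))
      (hasEdge_of_mem_outs hg (by simp [Gate.outs])) he'
    refine (hD.2 C p v r rfl e hve).imp (fun ⟨t, ht, het⟩ => ?_) fun h => h.rename f
    exact ⟨f t, Multiset.mem_map_of_mem (Gate.rename f) ht, het.rename f⟩

theorem isLambda_rename_iff {D : Gates Γ} {f : ℕ → ℕ} (hf : Set.InjOn f {n | D.HasEdge n}) :
    (D.rename f).IsLambda ↔ D.IsLambda := by
  refine ⟨fun h => ?_, IsLambda.rename hf⟩
  have hinv := hf.leftInvOn_invFunOn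
  have h1 : (D.rename f).rename (Function.invFunOn f {n | D.HasEdge n}) = D := by
    rw [rename_rename]
    exact rename_eq_self fun n hn => hinv hn
  rw [← h1]
  refine h.rename fun m hm n hn hmn => ?_
  obtain ⟨m, hm', rfl⟩ := hasEdge_rename.1 hm
  obtain ⟨n, hn', rfl⟩ := hasEdge_rename.1 hn
  rw [hinv hm', hinv hn'] at hmn
  rw [hmn]

theorem reach_absorb {C : Gates Γ} {a b x y : ℕ} (hab : a ≠ b)
    (h : Reach (Gate.arrow a b ::ₘ C) x y) :
    (C.rename (Function.update id b a)).Reach (Function.update id b a x)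
      (Function.update id b a y) := by
  induction h with
  | refl => exact .refl
  | tail _ hst ih =>
    obtain ⟨g, hg, hi, ho⟩ := hst
    rcases Multiset.mem_cons.1 hg with rfl | hg
    · simp only [Gate.ins, Gate.outs, Multiset.mem_singleton] at hi ho
      subst hi ho
      simpa [hab] using ih
    · exact ih.tail ⟨g.rename _, Multiset.mem_map_of_mem _ hg, by simpa using ⟨_, hi, rfl⟩,
        by simpa using ⟨_, ho, rfl⟩⟩

/-- A path is lifted through the absorption of an arrow from `a` to `b`. In general the edge `a` is
not reached from `b`, which has the same image; hence the assumption `z ≠ a`. -/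
theorem reach_of_absorb {C : Gates Γ} {a b x z : ℕ} (hab : a ≠ b) (ha : a ∉ ins C) (hz : z ≠ a)
    (h : (C.rename (Function.update id b a)).Reach (Function.update id b a x)
      (Function.update id b a z)) :
    Reach (Gate.arrow a b ::ₘ C) x z := by
  have hstep : ∀ y z, z ≠ a → Function.update id b a y = Function.update id b a z →
      Reach (Gate.arrow a b ::ₘ C) x y →
      Reach (Gate.arrow a b ::ₘ C) x z := by
    intro y z hz hyz hy
    by_cases hzb : z = b
    · subst hzb
      by_cases hyz' : y = z
      · exact hyz' ▸ hy
      · rw [Function.update_of_ne hyz', Function.update_self, id] at hyz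
        subst hyz
        exact hy.tail ⟨_, Multiset.mem_cons_self _ _, by simp [Gate.ins], by simp [Gate.outs]⟩
    · rw [Function.update_of_ne hzb, id] at hyz
      by_cases hyb : y = b
      · subst hyb
        exact absurd (by simpa using hyz.symm) hz
      · rw [Function.update_of_ne hyb, id] at hyz
        rwa [← hyz]
  suffices ∀ n, (C.rename (Function.update id b a)).Reach (Function.update id b a x) n →
      ∃ y, Function.update id b a y = n ∧ Reach (Gate.arrow a b ::ₘ C) x y by
    obtain ⟨y, hy, hxy⟩ := this _ h
    exact hstep y z hz hy hxy
  intro n h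
  induction h with
  | refl => exact ⟨x, rfl, .refl⟩
  | tail _ hst ih =>
    obtain ⟨y, rfl, hxy⟩ := ih
    obtain ⟨g', hg', hi, ho⟩ := hst
    obtain ⟨g, hg, rfl⟩ := Multiset.mem_map.1 hg'
    rw [Gate.ins_rename, Multiset.mem_map] at hi
    rw [Gate.outs_rename, Multiset.mem_map] at ho
    obtain ⟨i, hi, hiy⟩ := hi
    obtain ⟨c, hc, rfl⟩ := ho
    have hia : i ≠ a := by
      rintro rfl
      exact ha (mem_ins.2 ⟨g, hg, hi⟩)
    exact ⟨c, rfl, (hstep y i hia hiy.symm hxy).tail ⟨g, Multiset.mem_cons_of_mem hg, hi, hc⟩⟩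

theorem isLambda_absorb_iff {C : Gates Γ} {a b : ℕ} (hab : a ≠ b) (ha : a ∉ ins C) :
    (C.rename (Function.update id b a)).IsLambda ↔ IsLambda (Gate.arrow a b ::ₘ C) := by
  constructor
  · refine fun h => ⟨fun ε x y z hm => ?_, fun E p v r hE e he => ?_⟩
    · have hm : Gate.eps ε x y z ∈ C := by simpa using hm
      exact h.1 _ _ _ _ (Multiset.mem_map_of_mem (Gate.rename _) hm)
    · have hm : Gate.lam p v r ∈ C := by
        have : Gate.lam p v r ∈ Gate.arrow a b ::ₘ C := hE ▸ Multiset.mem_cons_self _ E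
        simpa using this
      obtain ⟨C, rfl⟩ := Multiset.exists_cons_of_mem hm
      rw [Multiset.cons_swap, Multiset.cons_inj_right] at hE
      subst hE
      rw [ins_cons, Multiset.mem_add, not_or] at ha
      have hp : p ≠ a := by
        rintro rfl
        exact ha.1 (by simp [Gate.ins])
      refine (h.2 _ _ _ _ (by rw [rename_cons, Gate.rename]) _ (reach_absorb hab he)).imp
        (fun ⟨t', ht', het⟩ => ?_) fun hr => reach_of_absorb hab ha.2 hp hr
      obtain ⟨t, ht, rfl⟩ := exists_top_of_mem_rename ht'
      refine ⟨t, Multiset.mem_cons_of_mem ht, reach_of_absorb hab ha.2 ?_ het⟩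
      rintro rfl
      exact ha.2 (mem_ins.2 ⟨_, ht, by simp [Gate.ins]⟩)
  · refine fun h => ⟨fun ε x y z hm => ?_, fun C' p' v' r' hC' e' he' => ?_⟩
    · obtain ⟨x, y, z, hm⟩ := exists_eps_of_mem_rename hm
      exact h.1 _ _ _ _ (Multiset.mem_cons_of_mem hm)
    · obtain ⟨p, v, r, hg, rfl, rfl, rfl⟩ := exists_lam_of_mem_rename
        (hC' ▸ Multiset.mem_cons_self _ C')
      obtain ⟨C, rfl⟩ := Multiset.exists_cons_of_mem hg
      rw [rename_cons, Gate.rename, Multiset.cons_inj_right] at hC'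
      subst hC'
      rw [ins_cons, Multiset.mem_add, not_or] at ha
      obtain ⟨e, he, hee⟩ : ∃ e, Reach (Gate.arrow a b ::ₘ C) v e ∧
          Function.update id b a e = e' := by
        -- the edge `b` itself is not an edge of the renamed collection
        by_cases hea : e' = a
        · subst hea
          refine ⟨b, reach_of_absorb hab ha.2 hab.symm ?_, by simp⟩
          simpa using he'
        · by_cases heb : e' = b
          · subst heb
            have hne : ∀ n, Function.update id e' a n ≠ e' := by
              intro n
              by_cases hn : n = e'
              · rw [hn, Function.update_self]; exact hab
              · rw [Function.update_of_ne hn]; exact hn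
            rcases ReflTransGen.cases_tail he' with h | ⟨_, _, g', hg', _, ho⟩
            · exact absurd h.symm (hne v)
            · obtain ⟨g, hg, rfl⟩ := Multiset.mem_map.1 hg'
              rw [Gate.outs_rename, Multiset.mem_map] at ho
              obtain ⟨c, _, hc⟩ := ho
              exact absurd hc (hne c)
          · refine ⟨e', reach_of_absorb hab ha.2 hea ?_, ?_⟩ <;>
              rw [Function.update_of_ne heb, id]
            exact he'
      subst hee
      refine (h.2 (Gate.arrow a b ::ₘ C) p v r (Multiset.cons_swap _ _ _) e he).imp
        (fun ⟨t, ht, het⟩ => ?_) fun hr => reach_absorb hab hr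
      have ht : Gate.top t ∈ C := by simpa using ht
      exact ⟨_, Multiset.mem_map_of_mem (Gate.rename _) ht, reach_absorb hab het⟩

end Gates

theorem SameGraph.isLambda_iff {D D' : Presentation Γ} (h : SameGraph D D') :
    D.1.IsLambda ↔ D'.1.IsLambda := by
  cases h with
  | rename f hf h => rw [h, Gates.isLambda_rename_iff hf]
  | absorb C a b hab hC h h' =>
    have ha : a ∉ Gates.ins C := by
      have := D.2.1
      rw [h, Gates.ins_cons, Gate.ins, Multiset.singleton_add, Multiset.nodup_cons] at this
      exact this.1
    rw [h, h', Gates.isLambda_absorb_iff hab ha]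

/-- Being a lambda graph can be checked on any presentation. -/
theorem Presentation.graph_mem_lambdaGRAPH {D : Presentation Γ} (h : D.1.IsLambda) :
    D.graph ∈ lambdaGRAPH Γ := by
  intro E hE
  have hDE := Quot.eqvGen_exact hE
  suffices E.1.IsLambda ↔ D.1.IsLambda from this.2 h
  clear hE h
  induction hDE with
  | rel _ _ h => exact h.isLambda_iff
  | refl _ => rfl
  | symm _ _ _ ih => exact ih.symm
  | trans _ _ _ _ _ ih₁ ih₂ => exact ih₁.trans ih₂

theorem FanTree.mem {v : ℕ} {es : List ℕ} {T : Gates Γ} (h : FanTree v es T) {g : Gate Γ}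
    (hg : g ∈ T) : (∃ a b c, g = Gate.fan a b c) ∨ ∃ a b, g = Gate.arrow a b := by
  induction h with
  | leaf v e => exact .inr ⟨v, e, by simpa using hg⟩
  | node v a b es₁ es₂ T₁ T₂ _ _ ih₁ ih₂ =>
    rcases Multiset.mem_add.1 hg with hg | hg
    · rcases Multiset.mem_add.1 hg with hg | hg
      · exact .inl ⟨v, a, b, by simpa using hg⟩
      · exact ih₁ hg
    · exact ih₂ hg

theorem FanTree.root_mem {v : ℕ} {es : List ℕ} {T : Gates Γ} (h : FanTree v es T) :
    v ∈ Gates.ins T := by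
  cases h <;> simp [Gate.ins]

theorem FanTree.exists_reach {v : ℕ} {es : List ℕ} {T : Gates Γ} (h : FanTree v es T) {n : ℕ}
    (hn : n ∈ Gates.ins T) : ∃ e ∈ es, Gates.Reach T n e := by
  induction h generalizing n with
  | leaf v e =>
    obtain rfl : n = v := by simpa [Gate.ins] using hn
    exact ⟨e, by simp, .single ⟨_, Multiset.mem_singleton_self _, by simp [Gate.ins],
      by simp [Gate.outs]⟩⟩
  | node v a b es₁ es₂ T₁ T₂ h₁ h₂ ih₁ ih₂ =>
    have l₁ : T₁ ≤ {Gate.fan v a b} + T₁ + T₂ :=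
      (Multiset.le_add_left _ _).trans (Multiset.le_add_right _ _)
    have l₂ : T₂ ≤ {Gate.fan v a b} + T₁ + T₂ := Multiset.le_add_left _ _
    rw [Gates.ins_add, Gates.ins_add, Multiset.mem_add, Multiset.mem_add] at hn
    rcases hn with (hn | hn) | hn
    · obtain rfl : n = v := by simpa [Gate.ins] using hn
      obtain ⟨e, he, hr⟩ := ih₁ h₁.root_mem
      exact ⟨e, by simp [he], .head ⟨Gate.fan n a b, by simp, by simp [Gate.ins],
        by simp [Gate.outs]⟩ (hr.mono l₁)⟩
    · obtain ⟨e, he, hr⟩ := ih₁ hn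
      exact ⟨e, by simp [he], hr.mono l₁⟩
    · obtain ⟨e, he, hr⟩ := ih₂ hn
      exact ⟨e, by simp [he], hr.mono l₂⟩

theorem Binder.exists_reach {v : ℕ} {es : List ℕ} {T : Gates Γ} (h : Binder v es T) {n : ℕ}
    (hn : n ∈ Gates.ins T) :
    (∃ t, Gate.top t ∈ T ∧ Gates.Reach T n t) ∨ ∃ e ∈ es, Gates.Reach T n e := by
  rcases h with ⟨rfl, rfl⟩ | h
  · obtain rfl : n = v := by simpa [Gate.ins] using hn
    exact .inl ⟨n, by simp, .refl⟩
  · exact .inr (h.exists_reach hn)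

theorem Binder.root_mem {v : ℕ} {es : List ℕ} {T : Gates Γ} (h : Binder v es T) :
    v ∈ Gates.ins T := by
  rcases h with ⟨rfl, rfl⟩ | h
  · simp [Gate.ins]
  · exact h.root_mem

end Paths

section BoundTree

variable {X Γ : Type*} [DecidableEq X]

/-- Every edge in the graph of a term leads to the root or to a `⊤` gate. The second assertion is
about the scope of an abstraction, i.e. its body with the fan tree of its left leg. -/
theorem BoundTree.exists_reach (A : Term X) :
    (∀ {r : ℕ} {o : List (X × ℕ)} {D : Gates Γ}, BoundTree A r o D → ∀ n ∈ Gates.ins D,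
      (∃ t, Gate.top t ∈ D ∧ Gates.Reach D n t) ∨ Gates.Reach D n r) ∧
    ∀ {x : X} {p v : ℕ} {o : List (X × ℕ)} {D T : Gates Γ}, BoundTree A p o D →
      Binder v (occurrences x o) T → ∀ n ∈ Gates.ins (D + T),
      (∃ t, Gate.top t ∈ D + T ∧ Gates.Reach (D + T) n t) ∨ Gates.Reach (D + T) n p := by
  have aux : ∀ {r n : ℕ} {D E : Gates Γ}, D ≤ E →
      (∃ t, Gate.top t ∈ D ∧ Gates.Reach D n t) ∨ Gates.Reach D n r →
      (∃ t, Gate.top t ∈ E ∧ Gates.Reach E n t) ∨ Gates.Reach E n r := fun hDE =>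
    Or.imp (fun ⟨t, ht, hr⟩ => ⟨t, Multiset.mem_of_le hDE ht, hr.mono hDE⟩) fun hr => hr.mono hDE
  have aux' : ∀ {a b n : ℕ} {D : Gates Γ}, Gates.Reach D a b →
      ((∃ t, Gate.top t ∈ D ∧ Gates.Reach D n t) ∨ Gates.Reach D n a) →
      (∃ t, Gate.top t ∈ D ∧ Gates.Reach D n t) ∨ Gates.Reach D n b := fun hab =>
    Or.imp_right fun hr => hr.trans hab
  have scope : ∀ {A : Term X}, (∀ {r : ℕ} {o : List (X × ℕ)} {D : Gates Γ}, BoundTree A r o D →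
      ∀ n ∈ Gates.ins D, (∃ t, Gate.top t ∈ D ∧ Gates.Reach D n t) ∨ Gates.Reach D n r) →
      ∀ {x : X} {p v : ℕ} {o : List (X × ℕ)} {D T : Gates Γ}, BoundTree A p o D →
      Binder v (occurrences x o) T → ∀ n ∈ Gates.ins (D + T),
      (∃ t, Gate.top t ∈ D + T ∧ Gates.Reach (D + T) n t) ∨ Gates.Reach (D + T) n p := by
    intro A hA x p v o D T h hT n hn
    have l₁ : D ≤ D + T := Multiset.le_add_right _ _
    have l₂ : T ≤ D + T := Multiset.le_add_left _ _
    rw [Gates.ins_add, Multiset.mem_add] at hn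
    rcases hn with hn | hn
    · exact aux l₁ (hA h n hn)
    · rcases hT.exists_reach hn with ⟨t, ht, hr⟩ | ⟨e, he, hr⟩
      · exact .inl ⟨t, Multiset.mem_of_le l₂ ht, hr.mono l₂⟩
      · have he' := h.mem_of_mem_leaves (mem_occurrences.1 he)
        rw [Multiset.mem_add, Multiset.mem_singleton] at he'
        rcases he' with he' | rfl
        · exact (aux l₁ (hA h e he')).imp
            (fun ⟨t, ht, h⟩ => ⟨t, ht, (hr.mono l₂).trans h⟩) fun h => (hr.mono l₂).trans h
        · exact .inr (hr.mono l₂)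
  suffices h : ∀ {r : ℕ} {o : List (X × ℕ)} {D : Gates Γ}, BoundTree A r o D →
      ∀ n ∈ Gates.ins D, (∃ t, Gate.top t ∈ D ∧ Gates.Reach D n t) ∨ Gates.Reach D n r from
    ⟨h, scope h⟩
  intro r o D h
  induction A generalizing r o D with
  | var x =>
    obtain ⟨rfl, rfl⟩ := var_iff.1 h
    simp
  | app M N ihM ihN =>
    obtain ⟨p, q, o₁, o₂, D₁, D₂, h₁, h₂, rfl, rfl⟩ := app_iff.1 h
    have l₁ : D₁ ≤ D₁ + D₂ + {Gate.app p q r} :=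
      (Multiset.le_add_right _ _).trans (Multiset.le_add_right _ _)
    have l₂ : D₂ ≤ D₁ + D₂ + {Gate.app p q r} :=
      (Multiset.le_add_left _ _).trans (Multiset.le_add_right _ _)
    have hs : ∀ n ∈ ({p, q} : Multiset ℕ), Gates.Reach (D₁ + D₂ + {Gate.app p q r}) n r :=
      fun n hn => .single ⟨Gate.app p q r, by simp, hn, by simp [Gate.outs]⟩
    intro n hn
    rw [Gates.ins_add, Gates.ins_add, Multiset.mem_add, Multiset.mem_add] at hn
    rcases hn with (hn | hn) | hn
    · exact aux' (hs p (by simp)) (aux l₁ (ihM h₁ n hn))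
    · exact aux' (hs q (by simp)) (aux l₂ (ihN h₂ n hn))
    · exact .inr (hs n (by simpa [Gate.ins] using hn))
  | lam x M ih =>
    obtain ⟨p, v, o₁, D₁, T, h₁, hT, rfl, rfl⟩ := lam_iff.1 h
    have hs : Gates.Reach (D₁ + T + {Gate.lam p v r}) p r :=
      .single ⟨Gate.lam p v r, by simp, by simp [Gate.ins], by simp [Gate.outs]⟩
    intro n hn
    rw [Gates.ins_add, Multiset.mem_add] at hn
    rcases hn with hn | hn
    · exact aux' hs (aux (Multiset.le_add_right _ _) (scope ih h₁ hT n hn))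
    · obtain rfl : n = p := by simpa [Gate.ins] using hn
      exact .inr hs

/-- The scope `S` of a `λ` gate in the graph of a term. -/
theorem BoundTree.exists_scope {A : Term X} {r : ℕ} {o : List (X × ℕ)} {D : Gates Γ}
    (h : BoundTree A r o D) {p v s : ℕ} (hg : Gate.lam p v s ∈ D) :
    ∃ S, Gate.lam p v s ::ₘ S ≤ D ∧ v ∈ Gates.ins S ∧
      (∀ n ∈ Gates.outs S, n ∈ Gates.ins S ∨ n = p) ∧
      ∀ n ∈ Gates.ins S, (∃ t, Gate.top t ∈ S ∧ Gates.Reach S n t) ∨ Gates.Reach S n p := by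
  induction A generalizing r o D with
  | var x =>
    obtain ⟨rfl, rfl⟩ := var_iff.1 h
    simp at hg
  | app M N ihM ihN =>
    obtain ⟨p', q, o₁, o₂, D₁, D₂, h₁, h₂, rfl, rfl⟩ := app_iff.1 h
    rw [Multiset.mem_add, Multiset.mem_add] at hg
    rcases hg with (hg | hg) | hg
    · obtain ⟨S, hS, h⟩ := ihM h₁ hg
      exact ⟨S, hS.trans ((Multiset.le_add_right _ _).trans (Multiset.le_add_right _ _)), h⟩
    · obtain ⟨S, hS, h⟩ := ihN h₂ hg
      exact ⟨S, hS.trans ((Multiset.le_add_left _ _).trans (Multiset.le_add_right _ _)), h⟩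
    · simp at hg
  | lam x M ih =>
    obtain ⟨p', v', o₁, D₁, T, h₁, hT, rfl, rfl⟩ := lam_iff.1 h
    rw [Multiset.mem_add, Multiset.mem_add] at hg
    rcases hg with (hg | hg) | hg
    · obtain ⟨S, hS, h⟩ := ih h₁ hg
      exact ⟨S, hS.trans ((Multiset.le_add_right _ _).trans (Multiset.le_add_right _ _)), h⟩
    · rcases hT with ⟨-, rfl⟩ | hT
      · simp at hg
      · rcases hT.mem hg with ⟨a, b, c, h⟩ | ⟨a, b, h⟩ <;> simp at h
    · obtain ⟨rfl, rfl, rfl⟩ : p = p' ∧ v = v' ∧ s = r := by simpa using hg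
      refine ⟨D₁ + T, ?_, ?_, fun n hn => ?_, fun n hn => (exists_reach M).2 h₁ hT n hn⟩
      · rw [← Multiset.singleton_add, add_comm]
      · rw [Gates.ins_add, Multiset.mem_add]
        exact .inr hT.root_mem
      · have hleaf : ∀ e ∈ occurrences x o₁, e ∈ Gates.ins D₁ + {p} := fun e he =>
          h₁.mem_of_mem_leaves (mem_occurrences.1 he)
        have : n ∈ Gates.ins D₁ + {p} ∨ n ∈ Gates.ins T := by
          rw [Gates.outs_add, Multiset.mem_add] at hn
          rcases hn with hn | hn
          · exact .inl (h₁.mem_of_hasEdge (.inr hn))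
          · have : n ∈ Gates.ins T + (occurrences x o₁ : Multiset ℕ) := by
              rw [hT.balance]
              exact Multiset.mem_add.2 (.inl hn)
            exact (Multiset.mem_add.1 this).symm.imp_left (hleaf n)
        rw [Gates.ins_add]
        simp only [Multiset.mem_add, Multiset.mem_singleton] at this ⊢
        tauto

theorem BoundTree.eps_notMem {A : Term X} {r : ℕ} {o : List (X × ℕ)} {D : Gates Γ}
    (h : BoundTree A r o D) (ε : Γ) (a b c : ℕ) : Gate.eps ε a b c ∉ D := by
  induction h with
  | var x e => simp
  | app M N p q r o₁ o₂ D₁ D₂ _ _ ih₁ ih₂ => simp [ih₁, ih₂]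
  | lamUnused x M p v r o D _ _ ih => simp [ih]
  | lamUsed x M p v r o D T _ hT ih =>
    intro hm
    simp only [Multiset.mem_add, ih, Multiset.mem_singleton, reduceCtorEq, or_false,
      false_or] at hm
    rcases hT.mem hm with ⟨a, b, c, h⟩ | ⟨a, b, h⟩ <;> simp at h

theorem mem_lambdaGRAPH_of_isConversion {A : Term X} {G : GRAPH Γ} (h : IsConversion A G) :
    G ∈ lambdaGRAPH Γ := by
  obtain ⟨r, o, D, v, T, P, hA, hT, hP, hr, rfl⟩ := h
  have hfan : ∀ g ∈ ∑ x ∈ A.fv, T x, (∃ a b c, g = Gate.fan a b c) ∨ ∃ a b, g = Gate.arrow a b := by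
    intro g hg
    obtain ⟨x, hx, hg⟩ := Multiset.mem_sum.1 hg
    exact (hT x hx).mem hg
  apply Presentation.graph_mem_lambdaGRAPH
  refine ⟨fun ε a b c hm => ?_, fun C p v s hC e he => ?_⟩
  · rw [hP, Multiset.mem_add] at hm
    rcases hm with hm | hm
    · exact hA.eps_notMem ε a b c hm
    · rcases hfan _ hm with ⟨a, b, c, h⟩ | ⟨a, b, h⟩ <;> simp at h
  · have hm : Gate.lam p v s ∈ D := by
      have hm : Gate.lam p v s ∈ P.1 := hC ▸ Multiset.mem_cons_self _ C
      rw [hP, Multiset.mem_add] at hm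
      rcases hm with hm | hm
      · exact hm
      · rcases hfan _ hm with ⟨a, b, c, h⟩ | ⟨a, b, h⟩ <;> simp at h
    obtain ⟨S, hS, hv, hout, hreach⟩ := hA.exists_scope hm
    have hSC : S ≤ C := by
      rw [← Multiset.cons_le_cons_iff (Gate.lam p v s), ← hC, hP]
      exact hS.trans (Multiset.le_add_right _ _)
    obtain ⟨U, rfl⟩ := Multiset.le_iff_exists_add.1 hSC
    have hn := P.2.1
    rw [hC, Gates.ins_cons, Gates.ins_add, Gate.ins, Multiset.singleton_add, Multiset.nodup_cons,
      Multiset.nodup_add, Multiset.disjoint_left, Multiset.mem_add, not_or] at hn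
    obtain ⟨⟨hpS, hpU⟩, -, -, hd⟩ := hn
    -- a path that starts at `v` cannot leave the scope before it arrives at `p`
    have key : e ∈ Gates.ins S ∨ e = p := by
      induction he with
      | refl => exact .inl hv
      | tail _ hst ih =>
        obtain ⟨g, hg, hi, ho⟩ := hst
        rcases Multiset.mem_add.1 hg with hg | hg
        · exact hout _ (Gates.mem_outs.2 ⟨g, hg, ho⟩)
        · have hU := Gates.mem_ins.2 ⟨g, hg, hi⟩
          rcases ih with ih | rfl
          · exact absurd hU (hd ih)
          · exact absurd hU hpU
    rcases key with hk | rfl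
    · exact (hreach e hk).imp (fun ⟨t, ht, h⟩ => ⟨t, Multiset.mem_of_le hSC ht, h.mono hSC⟩)
        fun h => h.mono hSC
    · exact .inr .refl

end BoundTree

/-! ### Separating the occurrences of the free variables -/

section Wires

variable {Γ : Type*}

/-- `Wires es W`: `W` consists of one arrow to each of the edges `es`. -/
def Wires (es : Multiset ℕ) (W : Gates Γ) : Prop :=
  Multiset.Rel (fun e g => ∃ a, g = Gate.arrow a e) es W

namespace Wires

theorem outs {es : Multiset ℕ} {W : Gates Γ} (h : Wires es W) : Gates.outs W = es := by
  unfold Wires at h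
  induction h with
  | zero => rfl
  | cons h _ ih =>
    obtain ⟨a, rfl⟩ := h
    rw [Gates.outs_cons, Gate.outs, ih, Multiset.singleton_add]

theorem rename {es : Multiset ℕ} {W : Gates Γ} (f : ℕ → ℕ) (h : Wires es W) :
    Wires (es.map f) (Gates.rename f W) := by
  unfold Wires Gates.rename at *
  rw [Multiset.rel_map]
  exact h.mono fun e _ g _ ⟨a, ha⟩ => ⟨f a, by rw [ha, Gate.rename]⟩

theorem add {es es' : Multiset ℕ} {W W' : Gates Γ} (h : Wires es W) (h' : Wires es' W') :
    Wires (es + es') (W + W') := Multiset.Rel.add h h'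

theorem exists_add {es es' : Multiset ℕ} {W : Gates Γ} (h : Wires (es + es') W) :
    ∃ W₁ W₂, Wires es W₁ ∧ Wires es' W₂ ∧ W = W₁ + W₂ := Multiset.rel_add_left.1 h

/-- Wires with the same targets differ by the names of their sources. -/
theorem exists_rename {es : Multiset ℕ} {W W' : Gates Γ} (h : Wires es W) (h' : Wires es W')
    {s : Multiset ℕ} (hes : ∀ e ∈ es, e ∈ s) (hn : (s + Gates.ins W).Nodup) :
    ∃ f : ℕ → ℕ, (∀ n ∈ s, f n = n) ∧ W' = Gates.rename f W := by
  induction es using Multiset.induction_on generalizing W W' with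
  | empty =>
    obtain rfl := Multiset.rel_zero_left.1 h
    obtain rfl := Multiset.rel_zero_left.1 h'
    exact ⟨id, fun _ _ => rfl, rfl⟩
  | cons e es ih =>
    obtain ⟨_, W, ⟨a, rfl⟩, hW, rfl⟩ := Multiset.rel_cons_left.1 h
    obtain ⟨_, W', ⟨a', rfl⟩, hW', rfl⟩ := Multiset.rel_cons_left.1 h'
    rw [Gates.ins_cons, Gate.ins, Multiset.singleton_add, Multiset.add_cons,
      Multiset.nodup_cons, Multiset.mem_add, not_or] at hn
    obtain ⟨⟨has, haW⟩, hn⟩ := hn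
    obtain ⟨f, hf, rfl⟩ := ih hW hW' (fun e he => hes e (Multiset.mem_cons_of_mem he)) hn
    have hfs : ∀ n ∈ s, Function.update f a a' n = n := fun n hn => by
      rw [Function.update_of_ne (by rintro rfl; exact has hn), hf n hn]
    refine ⟨Function.update f a a', hfs, ?_⟩
    rw [Gates.rename_cons, Gate.rename, Function.update_self, hfs e (hes e (by simp))]
    congr 1
    refine Gates.rename_congr fun n hn => ?_
    rcases hn with hn | hn
    · rw [Function.update_of_ne (by rintro rfl; exact haW hn)]
    · rw [outs hW] at hn
      have hns := hes n (Multiset.mem_cons_of_mem hn)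
      rw [hf n hns, hfs n hns]

end Wires

theorem FanTree.leaves_le {v : ℕ} {es : List ℕ} {T : Gates Γ} (h : FanTree v es T) :
    (es : Multiset ℕ) ≤ Gates.outs T := by
  induction h with
  | leaf v e => simp [Gate.outs]
  | node v a b es₁ es₂ T₁ T₂ _ _ ih₁ ih₂ =>
    rw [← Multiset.coe_add, Gates.outs_add, Gates.outs_add, add_assoc]
    exact (add_le_add ih₁ ih₂).trans (Multiset.le_add_left _ _)

theorem Gates.IsLinear.of_le {D E : Gates Γ} (hE : E.IsLinear) (hi : ins D ≤ ins E)
    (ho : outs D ≤ outs E) : D.IsLinear :=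
  ⟨Multiset.nodup_of_le hi hE.1, Multiset.nodup_of_le ho hE.2⟩

/-- The move (global FAN-OUT) for a wire: a `Υ` gate with a free root may be removed. -/
theorem fanOut_root {P P' : Presentation Γ} {E : Gates Γ} {v a b : ℕ}
    (hP : P.1 = {Gate.fan v a b} + E) (hP' : P'.1 = E) (hv : v ∉ Gates.outs P.1)
    (ha : a ∈ Gates.ins E) (hb : b ∈ Gates.ins E) : FanOut P.graph P'.graph := by
  obtain ⟨N, hN⟩ := Gates.exists_lt_of_hasEdge P.1
  have hPi := P.2.1
  have hPo := P.2.2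
  rw [hP] at hPi hPo hv hN
  have hins : Gates.ins ({Gate.fan v a b} + E) = v ::ₘ Gates.ins E := by
    rw [Gates.ins_add, Gates.ins_singleton, Gate.ins, Multiset.singleton_add]
  have houts : Gates.outs ({Gate.fan v a b} + E) = a ::ₘ b ::ₘ Gates.outs E := by
    rw [Gates.outs_add, Gates.outs_singleton, Gate.outs, Multiset.insert_eq_cons,
      Multiset.cons_add, Multiset.singleton_add]
  simp only [Gates.HasEdge, hins, houts, Multiset.nodup_cons, Multiset.mem_cons, not_or]
    at hPi hPo hv hN
  obtain ⟨hva, hvb, hvE⟩ := hv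
  obtain ⟨⟨hab, haE⟩, hbE, hEo⟩ := hPo
  have hvN : v < N := hN v (by simp)
  have haN : a < N := hN a (by simp)
  have hbN : b < N := hN b (by simp)
  have hiN : ∀ k, N + k ∉ Gates.ins E := fun k h => absurd (hN _ (.inl (.inr h))) (by omega)
  have hoN : ∀ k, N + k ∉ Gates.outs E := fun k h =>
    absurd (hN _ (.inr (.inr (.inr h)))) (by omega)
  -- `Q` has an additional arrow at the root, and `Q'` has additional arrows at both exits
  have hQ : Gates.IsLinear (({Gate.arrow N v} : Gates Γ) + {Gate.fan v a b} + E) := by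
    have h0 := hiN 0
    simp only [Nat.add_zero] at h0
    constructor
    · rw [add_assoc, Gates.ins_add, hins, Gates.ins_singleton, Gate.ins, Multiset.singleton_add]
      simp only [Multiset.nodup_cons, Multiset.mem_cons, not_or]
      exact ⟨⟨by omega, h0⟩, hPi⟩
    · rw [add_assoc, Gates.outs_add, houts, Gates.outs_singleton, Gate.outs,
        Multiset.singleton_add]
      simp only [Multiset.nodup_cons, Multiset.mem_cons, not_or]
      exact ⟨⟨hva, hvb, hvE⟩, ⟨hab, haE⟩, hbE, hEo⟩
  have hQ' : Gates.IsLinear (({Gate.arrow (N + 1) a} : Gates Γ) + {Gate.arrow (N + 2) b} + E) := by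
    constructor
    · rw [add_assoc, Gates.ins_add, Gates.ins_add, Gates.ins_singleton, Gates.ins_singleton,
        Gate.ins, Gate.ins, Multiset.singleton_add, Multiset.singleton_add]
      simp only [Multiset.nodup_cons, Multiset.mem_cons, not_or]
      exact ⟨⟨by omega, hiN 1⟩, hiN 2, hPi.2⟩
    · rw [add_assoc, Gates.outs_add, Gates.outs_add, Gates.outs_singleton, Gates.outs_singleton,
        Gate.outs, Gate.outs, Multiset.singleton_add, Multiset.singleton_add]
      simp only [Multiset.nodup_cons, Multiset.mem_cons, not_or]
      exact ⟨⟨hab, haE⟩, hbE, hEo⟩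
  have e1 : P.graph = Presentation.graph ⟨_, hQ⟩ := by
    refine (graph_absorb_src (D := ⟨_, hQ⟩) (a := N) (b := v) (C := {Gate.fan v a b} + E)
      ?_ ?_ ?_ hP).symm
    · simp only [Gates.HasEdge, hins, houts, Multiset.mem_cons]
      intro h
      exact absurd (hN N h) (by omega)
    · exact .inl (by rw [hins]; simp)
    · dsimp only
      rw [add_assoc, Multiset.singleton_add]
  have hE2 : Gates.IsLinear (Gate.arrow (N + 2) b ::ₘ E) := by
    refine hQ'.of_le ?_ ?_ <;> rw [add_assoc, ← Multiset.singleton_add] <;> simp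
  have e2 : Presentation.graph ⟨_, hQ'⟩ = P'.graph := by
    refine (graph_absorb_src (D := ⟨_, hQ'⟩) (D' := ⟨_, hE2⟩) (a := N + 1) (b := a)
      ?_ ?_ (by dsimp only; rw [add_assoc, Multiset.singleton_add, Multiset.singleton_add]) rfl).trans
      (graph_absorb_src (a := N + 2) (b := b) ?_ (.inl hb) rfl hP')
    · simp only [Gates.HasEdge, Gates.ins_cons, Gates.outs_cons, Gate.ins, Gate.outs,
        Multiset.mem_add, Multiset.mem_singleton]
      have := hiN 1
      have := hoN 1
      rintro ((h | h) | (h | h)) <;> first | omega | contradiction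
    · exact .inl (by simp [ha])
    · exact fun h => h.elim (hiN 2) (hoN 2)
  rw [e1, ← e2]
  have hedge : ∀ {c d n : ℕ}, Gates.HasEdge ({Gate.arrow c d} : Gates Γ) n ↔ n = c ∨ n = d := by
    simp [Gates.HasEdge, Gate.ins, Gate.outs]
  have hNv : N ≠ v := by omega
  refine .mk ⟨_, hQ⟩ ⟨_, hQ'⟩ {Gate.arrow N v} E v a b (fun n => if n = v then a else N + 1)
    (fun n => if n = v then b else N + 2) ?_ ?_ ?_ (by simp) ?_ (by simp) ?_ ?_ ?_ rfl ?_
  · intro n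
    simp only [Gates.outs_singleton, Gates.ins_singleton, Gate.ins, Gate.outs,
      Multiset.mem_singleton]
    omega
  · intro n hn
    rcases hedge.1 hn with rfl | rfl
    · exact ⟨fun h => h.elim (hiN 0) (hoN 0), by omega, by omega⟩
    · exact ⟨fun h => h.elim hPi.1 hvE, hva, hvb⟩
  · intro m hm n hn h
    rcases hedge.1 hm with rfl | rfl <;> rcases hedge.1 hn with rfl | rfl <;>
      simp [hNv] at h ⊢ <;> omega
  · intro m hm n hn h
    rcases hedge.1 hm with rfl | rfl <;> rcases hedge.1 hn with rfl | rfl <;>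
      simp [hNv] at h ⊢ <;> omega
  · intro n
    simp only [Gates.rename_singleton, Gate.rename, hedge, hNv, if_true, if_false]
    omega
  · intro n
    simp only [Gates.rename_singleton, Gate.rename, hedge, hNv, if_true, if_false]
    rintro (rfl | rfl) h
    · exact absurd h fun h => h.elim (hiN 1) (hoN 1)
    · rfl
  · intro n
    simp only [Gates.rename_singleton, Gate.rename, hedge, hNv, if_true, if_false]
    rintro (rfl | rfl) h
    · exact absurd h fun h => h.elim (hiN 2) (hoN 2)
    · rfl
  · simp [Gates.rename_singleton, Gate.rename, hNv]

/-- A fan tree with a free root is removed by FAN-OUT moves: its leaves become free. -/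
theorem FanTree.exists_wires {v : ℕ} {es : List ℕ} {T : Gates Γ} (h : FanTree v es T)
    {P : Presentation Γ} {C : Gates Γ} (hP : P.1 = T + C) (hv : v ∉ Gates.outs P.1) :
    ∃ W, ∃ P' : Presentation Γ, Wires es W ∧ Gates.ins W ≤ Gates.ins T ∧ P'.1 = W + C ∧
      ReflTransGen FanOut P.graph P'.graph := by
  induction h generalizing P C with
  | leaf v e =>
    refine ⟨_, P, ?_, le_rfl, hP, .refl⟩
    exact .cons ⟨v, rfl⟩ .zero
  | node v a b es₁ es₂ T₁ T₂ h₁ h₂ ih₁ ih₂ =>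
    have hPo := P.2.2
    rw [hP] at hPo
    simp only [Gates.outs_add, Gates.outs_singleton, Gate.outs] at hPo
    simp only [Multiset.insert_eq_cons, Multiset.cons_add, Multiset.singleton_add,
      Multiset.nodup_cons, Multiset.mem_cons, Multiset.mem_add, not_or] at hPo
    obtain ⟨⟨hab, ha⟩, hb, -⟩ := hPo
    have hl₁ : Gates.IsLinear (T₁ + (T₂ + C)) := by
      have := P.2
      rw [hP] at this
      refine this.of_le ?_ ?_ <;>
      · simp only [Gates.ins_add, Gates.outs_add, ← add_assoc]
        simp only [add_assoc, Multiset.le_add_left]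
    have hmove : FanOut P.graph (Presentation.graph ⟨_, hl₁⟩) :=
      fanOut_root (a := a) (b := b) (hP.trans (by rw [add_assoc, add_assoc])) rfl hv
        (by simp [h₁.root_mem]) (by simp [h₂.root_mem])
    obtain ⟨W₁, P₁, hW₁, hi₁, hP₁, hm₁⟩ := ih₁ (P := ⟨_, hl₁⟩) rfl (by
      simp only [Gates.outs_add, Multiset.mem_add, not_or]
      tauto)
    obtain ⟨W₂, P₂, hW₂, hi₂, hP₂, hm₂⟩ := ih₂ (P := P₁) (C := W₁ + C)
      (hP₁.trans (by abel)) (by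
        rw [hP₁]
        simp only [Gates.outs_add, Multiset.mem_add, not_or, hW₁.outs]
        have hle := h₁.leaves_le
        exact ⟨fun h => hb.1.1 (Multiset.mem_of_le hle h), hb.1.2, hb.2⟩)
    refine ⟨W₁ + W₂, P₂, ?_, ?_, hP₂.trans (by abel), .head hmove (hm₁.trans hm₂)⟩
    · rw [← Multiset.coe_add]
      exact hW₁.add hW₂
    · simp only [Gates.ins_add]
      rw [add_assoc]
      exact (add_le_add hi₁ hi₂).trans (Multiset.le_add_left _ _)

end Wires

section FreeVariables

variable {X Γ : Type*} [DecidableEq X]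

/-- All trees of free variables are removed by FAN-OUT moves. -/
theorem exists_wires_freeTrees {S : Finset X} {o : List (X × ℕ)} {v : X → ℕ} {T : X → Gates Γ}
    (hT : ∀ x ∈ S, FanTree (v x) (occurrences x o) (T x)) {P : Presentation Γ} {C : Gates Γ}
    (hP : P.1 = ∑ x ∈ S, T x + C) (hv : ∀ x ∈ S, v x ∉ Gates.outs P.1) :
    ∃ W, ∃ P' : Presentation Γ, Wires (∑ x ∈ S, (occurrences x o : Multiset ℕ)) W ∧
      Gates.ins W ≤ Gates.ins (∑ x ∈ S, T x) ∧ P'.1 = W + C ∧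
      ReflTransGen FanOut P.graph P'.graph := by
  induction S using Finset.induction_on generalizing P C with
  | empty => exact ⟨0, P, .zero, by simp, by simpa using hP, .refl⟩
  | insert x S hx ih =>
    have hTx := hT x (Finset.mem_insert_self x S)
    rw [Finset.sum_insert hx] at hP ⊢
    rw [Finset.sum_insert hx]
    obtain ⟨W₁, P₁, hW₁, hi₁, hP₁, hm₁⟩ := hTx.exists_wires (hP.trans (add_assoc _ _ _))
      (hv x (Finset.mem_insert_self x S))
    obtain ⟨W₂, P₂, hW₂, hi₂, hP₂, hm₂⟩ := ih (P := P₁) (C := W₁ + C)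
      (fun y hy => hT y (Finset.mem_insert_of_mem hy)) (hP₁.trans (by abel)) (by
        intro y hy h
        refine hv y (Finset.mem_insert_of_mem hy) ?_
        rw [hP₁] at h
        rw [hP]
        simp only [Gates.outs_add, Multiset.mem_add, hW₁.outs] at h ⊢
        have := fun h => Multiset.mem_of_le hTx.leaves_le (a := v y) h
        tauto)
    refine ⟨W₁ + W₂, P₂, hW₁.add hW₂, ?_, hP₂.trans (by abel), hm₁.trans hm₂⟩
    rw [Gates.ins_add, Gates.ins_add]
    exact add_le_add hi₁ hi₂

theorem wires_balance {A : Term X} {r : ℕ} {o : List (X × ℕ)} {D W : Gates Γ}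
    (hA : BoundTree A r o D) (hW : Wires (o.map Prod.snd : List ℕ) W) :
    Gates.ins (D + W) + {r} = Gates.outs (D + W) + Gates.ins W := by
  rw [Gates.ins_add, Gates.outs_add, hW.outs, ← hA.balance]
  abel

/-- A graph of `A` in which every occurrence of a free variable has its own free root is obtained
from a transformation of `A` by FAN-OUT moves. -/
theorem exists_isConversion_of_wires {A : Term X} {r : ℕ} {o : List (X × ℕ)} {D W : Gates Γ}
    {P : Presentation Γ} (hA : BoundTree A r o D) (hW : Wires (o.map Prod.snd : List ℕ) W)
    (hP : P.1 = D + W) (hn : (Gates.ins P.1 + {r}).Nodup) :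
    ∃ H : GRAPH Γ, IsConversion A H ∧ ReflTransGen FanOut H P.graph := by
  have hn₂ : ((Gates.ins D + {r}) + Gates.ins W).Nodup := by
    convert hn using 1
    rw [hP, Gates.ins_add]
    abel
  obtain ⟨v, T, hT, hnT⟩ := exists_freeTrees (Γ := Γ) (Multiset.nodup_add.1 hn₂).1 o A.fv
    fun x hx h => hA.occurrences_eq_nil.1 h hx
  have hb := conversion_balance hA hT
  have hnT' : (Gates.ins (D + ∑ x ∈ A.fv, T x) + {r}).Nodup := by
    convert hnT using 1
    rw [Gates.ins_add]
    abel
  have hl := isLinear_of_balance hb hnT'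
  refine ⟨Presentation.graph ⟨_, hl⟩,
    isConversion_iff.2 ⟨r, o, D, v, T, ⟨_, hl⟩, hA, hT, rfl, hnT', rfl⟩, ?_⟩
  obtain ⟨W', P', hW', hi, hP', hm⟩ := exists_wires_freeTrees hT (P := ⟨_, hl⟩) (C := D)
    (add_comm _ _) fun x hx => (nodup_outs_of_balance hb hnT').2 _
      (Multiset.mem_sum.2 ⟨x, hx, Multiset.mem_singleton_self _⟩)
  rw [sum_occurrences fun x hx => hA.mem_labels.1 hx] at hW'
  suffices P.graph = P'.graph by rwa [this]
  obtain ⟨f, hf, rfl⟩ := hW.exists_rename hW' (s := Gates.ins D + {r}) (fun e he => by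
    rw [hA.balance]; exact Multiset.mem_add.2 (.inr he)) hn₂
  have hfr := hf r (by simp)
  refine graph_rename_of_nodup (wires_balance hA hW) hP ?_ ?_ (f := f)
  · rw [hP', hP, Gates.rename_add, Gates.rename_eq_self fun n hn => hf n (hA.mem_of_hasEdge hn),
      add_comm]
  · rw [hfr, hP', Gates.ins_add]
    refine Multiset.nodup_of_le ?_ hnT
    calc _ ≤ Gates.ins (∑ x ∈ A.fv, T x) + Gates.ins D + {r} :=
          add_le_add_left (add_le_add_left hi _) _
      _ = _ := by abel

end FreeVariables

/-! ### Duplication of the argument of a redex -/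

section Duplication

variable {X Γ : Type*}

theorem Gates.mem_of_hasEdge {D : Gates Γ} {r n : ℕ} (h : outs D ≤ ins D + {r})
    (hn : D.HasEdge n) : n ∈ ins D + {r} :=
  hn.elim (fun hn => Multiset.mem_add.2 (.inl hn)) fun hn => Multiset.mem_of_le h hn

theorem isLinear_of_le {D : Gates Γ} {r : ℕ} (h : Gates.outs D ≤ Gates.ins D + {r})
    (hn : (Gates.ins D + {r}).Nodup) : D.IsLinear :=
  ⟨(Multiset.nodup_add.1 hn).1, Multiset.nodup_of_le h hn⟩

theorem Gates.oneOutput_of_le {D : Gates Γ} {u : ℕ} (h : outs D ≤ ins D + {u}) (ho : u ∈ outs D)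
    (hi : u ∉ ins D) : D.OneOutput u := by
  intro n
  constructor
  · rintro ⟨h1, h2⟩
    simpa [h2] using Multiset.mem_of_le h h1
  · rintro rfl
    exact ⟨ho, hi⟩

/-- The move (global FAN-OUT) with fresh names in both copies. -/
theorem exists_fanOut {P : Presentation Γ} {K E : Gates Γ} {v a b r : ℕ}
    (hP : P.1 = K + {Gate.fan v a b} + E) (hK : Gates.outs K ≤ Gates.ins K + {v})
    (hv : v ∈ Gates.outs K) (hE : Gates.outs E + {a} + {b} ≤ Gates.ins E + {r})
    (hn : (Gates.ins P.1 + {r}).Nodup) :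
    ∃ (f g : ℕ → ℕ) (P' : Presentation Γ), f v = a ∧ g v = b ∧
      P'.1 = K.rename f + K.rename g + E ∧ (Gates.ins P'.1 + {r}).Nodup ∧
      FanOut P.graph P'.graph := by
  have hn₂ : ((Gates.ins K + {v}) + (Gates.ins E + {r})).Nodup := by
    convert hn using 1
    rw [hP]
    simp only [Gates.ins_add, Gates.ins_singleton, Gate.ins]
    abel
  obtain ⟨N, hN⟩ : ∃ N, ∀ n ∈ (Gates.ins K + {v}) + (Gates.ins E + {r}), n < N :=
    ⟨((Gates.ins K + {v}) + (Gates.ins E + {r})).toFinset.sup id + 1, fun n hn =>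
      Nat.lt_succ_of_le (Finset.le_sup (f := id) (Multiset.mem_toFinset.2 hn))⟩
  rw [Multiset.nodup_add, Multiset.disjoint_left] at hn₂
  obtain ⟨hnK, hnE, hd⟩ := hn₂
  have hEab : ({a} + {b} : Multiset ℕ) ≤ Gates.ins E + {r} := by
    refine le_trans ?_ hE
    rw [add_assoc]
    exact Multiset.le_add_left _ _
  have haE : a ∈ Gates.ins E + {r} := Multiset.mem_of_le hEab (by simp)
  have hbE : b ∈ Gates.ins E + {r} := Multiset.mem_of_le hEab (by simp)
  have hab : a ≠ b := by
    have := Multiset.nodup_of_le hEab hnE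
    simpa [Multiset.singleton_add] using this
  have hEle : Gates.outs E ≤ Gates.ins E + {r} := by
    refine le_trans ?_ hE
    rw [add_assoc]
    exact Multiset.le_add_right _ _
  have hvK : v ∉ Gates.ins K := by
    rw [add_comm, Multiset.singleton_add, Multiset.nodup_cons] at hnK
    exact hnK.1
  have hKN : ∀ n ∈ Gates.ins K + {v}, n < N := fun n h => hN n (Multiset.mem_add.2 (.inl h))
  have hEN : ∀ n ∈ Gates.ins E + {r}, n < N := fun n h => hN n (Multiset.mem_add.2 (.inr h))
  have haN := hEN a haE
  have hbN := hEN b hbE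
  -- names above `N` are not used, and the two copies get names of different parity relative to `N`
  set f : ℕ → ℕ := fun n => if n = v then a else N + 2 * n with hf
  set g : ℕ → ℕ := fun n => if n = v then b else N + 2 * n + 1 with hg
  have hfv : f v = a := by simp [hf]
  have hgv : g v = b := by simp [hg]
  have hfK : ∀ n ∈ Gates.ins K, f n = N + 2 * n := fun n hn => by
    have : n ≠ v := by rintro rfl; exact hvK hn
    simp [hf, this]
  have hgK : ∀ n ∈ Gates.ins K, g n = N + 2 * n + 1 := fun n hn => by
    have : n ≠ v := by rintro rfl; exact hvK hn
    simp [hg, this]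
  have hfn : ∀ n, f n = a ∨ f n = N + 2 * n := fun n => by
    by_cases h : n = v <;> simp [hf, h]
  have hgn : ∀ n, g n = b ∨ g n = N + 2 * n + 1 := fun n => by
    by_cases h : n = v <;> simp [hg, h]
  have hn' : (Gates.ins (K.rename f + K.rename g + E) + {r}).Nodup := by
    have hnK' := (Multiset.nodup_add.1 hnK).1
    rw [Gates.ins_add, Gates.ins_add, Gates.ins_rename, Gates.ins_rename, add_assoc,
      Multiset.nodup_add, Multiset.nodup_add, Multiset.disjoint_left, Multiset.disjoint_left]
    refine ⟨⟨?_, ?_, ?_⟩, hnE, ?_⟩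
    · refine hnK'.map_on fun m hm n hn h => ?_
      rw [hfK m hm, hfK n hn] at h
      omega
    · refine hnK'.map_on fun m hm n hn h => ?_
      rw [hgK m hm, hgK n hn] at h
      omega
    · intro k hk hk'
      obtain ⟨m, hm, rfl⟩ := Multiset.mem_map.1 hk
      obtain ⟨n, hn, h⟩ := Multiset.mem_map.1 hk'
      rw [hfK m hm, hgK n hn] at h
      omega
    · intro k hk hk'
      have hkN := hEN k hk'
      rcases Multiset.mem_add.1 hk with hk | hk <;> obtain ⟨m, hm, rfl⟩ := Multiset.mem_map.1 hk
      · rw [hfK m hm] at hkN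
        omega
      · rw [hgK m hm] at hkN
        omega
  have hle : Gates.outs (K.rename f + K.rename g + E) ≤
      Gates.ins (K.rename f + K.rename g + E) + {r} := by
    have h1 := Multiset.map_le_map (f := f) hK
    have h2 := Multiset.map_le_map (f := g) hK
    rw [Multiset.map_add, Multiset.map_singleton] at h1 h2
    rw [hfv] at h1
    rw [hgv] at h2
    simp only [Gates.outs_add, Gates.ins_add, Gates.outs_rename, Gates.ins_rename]
    refine Multiset.le_iff_count.2 fun n => ?_
    have h1 := Multiset.le_iff_count.1 h1 n
    have h2 := Multiset.le_iff_count.1 h2 n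
    have h3 := Multiset.le_iff_count.1 hE n
    simp only [Multiset.count_add] at h1 h2 h3 ⊢
    omega
  have hKedge := fun n (h : K.HasEdge n) => Gates.mem_of_hasEdge hK h
  have hEedge := fun n (h : E.HasEdge n) => Gates.mem_of_hasEdge hEle h
  have inj : ∀ (h : ℕ → ℕ) (c k : ℕ), (h = fun n => if n = v then c else N + 2 * n + k) → c < N →
      Set.InjOn h {n | K.HasEdge n} := by
    rintro h c k rfl hc m - n - hmn
    dsimp only at hmn
    split_ifs at hmn <;> omega
  refine ⟨f, g, ⟨_, isLinear_of_le hle hn'⟩, hfv, hgv, rfl, hn', .mk P ⟨_, isLinear_of_le hle hn'⟩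
    K E v a b f g (Gates.oneOutput_of_le hK hv hvK) (fun n h => ?_) (inj f a 0 hf haN) hfv
    (inj g b 1 hg hbN) hgv (fun n h h' => ?_) (fun n h h' => ?_) (fun n h h' => ?_) hP rfl⟩
  · have := hd (hKedge n h)
    exact ⟨fun h' => this (hEedge n h'), by rintro rfl; exact this haE,
      by rintro rfl; exact this hbE⟩
  · obtain ⟨m, hm, rfl⟩ := Gates.hasEdge_rename.1 h
    obtain ⟨k, hk, hkm⟩ := Gates.hasEdge_rename.1 h'
    have := hfn m
    have := hgn k
    omega
  · obtain ⟨m, hm, rfl⟩ := Gates.hasEdge_rename.1 h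
    have := hEN _ (hEedge _ h')
    have := hfn m
    omega
  · obtain ⟨m, hm, rfl⟩ := Gates.hasEdge_rename.1 h
    have := hEN _ (hEedge _ h')
    have := hgn m
    omega

variable [DecidableEq X]

theorem Plug.append {σ : X → Term X} {o₁ o₂ o₁' o₂' : List (X × ℕ)} {D₁ D₂ : Gates Γ}
    (h₁ : Plug σ o₁ o₁' D₁) (h₂ : Plug σ o₂ o₂' D₂) :
    Plug σ (o₁ ++ o₂) (o₁' ++ o₂') (D₁ + D₂) := by
  induction h₁ with
  | nil => simpa using h₂
  | cons hB _ ih =>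
    rw [List.cons_append, List.append_assoc, add_assoc]
    exact .cons hB ih

theorem Plug.balance {σ : X → Term X} {o o' : List (X × ℕ)} {D : Gates Γ} (h : Plug σ o o' D) :
    Gates.ins D + (o.map Prod.snd : List ℕ) = Gates.outs D + (o'.map Prod.snd : List ℕ) := by
  induction h with
  | nil => rfl
  | cons hB _ ih =>
    ext n
    have h1 := congrArg (Multiset.count n) hB.balance
    have h2 := congrArg (Multiset.count n) ih
    simp only [Gates.ins_add, Gates.outs_add, List.map_append, List.map_cons, ← Multiset.coe_add,
      ← Multiset.cons_coe, ← Multiset.singleton_add, Multiset.count_add] at h1 h2 ⊢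
    omega

/-- Grafting at the leaves decorated by `x` only. -/
theorem Plug.interleave {x : X} {B : Term X} {o o' : List (X × ℕ)} {D : Gates Γ}
    (h : Plug (Function.update Term.var x B) ((occurrences x o).map fun e => (x, e)) o' D) :
    ∃ o'', Plug (Function.update Term.var x B) o o'' D ∧
      (o''.map Prod.snd : List ℕ) = (o'.map Prod.snd : Multiset ℕ) +
        ((o.filter fun l => l.1 ≠ x).map Prod.snd : List ℕ) := by
  induction o generalizing o' D with
  | nil =>
    cases h
    exact ⟨[], .nil, rfl⟩
  | cons l o ih =>
    obtain ⟨y, e⟩ := l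
    by_cases hy : y = x
    · subst hy
      have hocc : occurrences y ((y, e) :: o) = e :: occurrences y o := by simp [occurrences]
      rw [hocc] at h
      rw [List.filter_cons_of_neg (by simp)]
      cases h with
      | cons hB h =>
        obtain ⟨o'', h1, h2⟩ := ih h
        refine ⟨_, .cons hB h1, ?_⟩
        rw [List.map_append, List.map_append, ← Multiset.coe_add, ← Multiset.coe_add, h2, add_assoc]
    · have hocc : occurrences x ((y, e) :: o) = occurrences x o := by simp [occurrences, hy]
      rw [hocc] at h
      rw [List.filter_cons_of_pos (by simpa using hy)]
      obtain ⟨o'', h1, h2⟩ := ih h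
      refine ⟨[(y, e)] ++ o'', ?_, ?_⟩
      · rw [← zero_add D]
        exact .cons (by rw [Function.update_of_ne hy]; exact .var y e) h1
      · rw [List.map_append, ← Multiset.coe_add, h2]
        simp only [List.map_cons, List.map_nil, ← Multiset.cons_coe, ← Multiset.singleton_add,
          Multiset.coe_nil]
        abel

/-- The argument of a redex with its free wires: its only output is the edge `v`. -/
theorem argument_balance {B : Term X} {q : ℕ} {o : List (X × ℕ)} {D W : Gates Γ}
    (hB : BoundTree B q o D) (hW : Wires (o.map Prod.snd : List ℕ) W) (v : ℕ) :
    Gates.outs (D + W + {Gate.arrow q v}) = Gates.ins D + {q} + {v} := by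
  rw [hB.balance, Gates.outs_add, Gates.outs_add, hW.outs, Gates.outs_singleton, Gate.outs]

theorem argument_le {B : Term X} {q : ℕ} {o : List (X × ℕ)} {D W : Gates Γ}
    (hB : BoundTree B q o D) (hW : Wires (o.map Prod.snd : List ℕ) W) (v : ℕ) :
    Gates.outs (D + W + {Gate.arrow q v}) ≤ Gates.ins (D + W + {Gate.arrow q v}) + {v} := by
  rw [argument_balance hB hW]
  simp only [Gates.ins_add, Gates.ins_singleton, Gate.ins]
  refine Multiset.le_iff_count.2 fun n => ?_
  simp only [Multiset.count_add]
  omega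

/-- A term above a fan tree is copied by FAN-OUT moves to all leaves of the tree. -/
theorem FanTree.exists_copies {σ : X → Term X} {x : X} {v : ℕ} {es : List ℕ} {T : Gates Γ}
    (h : FanTree v es T) {q r : ℕ} {o : List (X × ℕ)} {D W C : Gates Γ} {P : Presentation Γ}
    (hB : BoundTree (σ x) q o D) (hW : Wires (o.map Prod.snd : List ℕ) W)
    (hP : P.1 = D + W + {Gate.arrow q v} + T + C)
    (hC : Gates.outs C + (es : Multiset ℕ) ≤ Gates.ins C + {r})
    (hn : (Gates.ins P.1 + {r}).Nodup) :
    ∃ (o' : List (X × ℕ)) (D' W' : Gates Γ) (P' : Presentation Γ),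
      Plug σ (es.map fun e => (x, e)) o' D' ∧ Wires (o'.map Prod.snd : List ℕ) W' ∧
      P'.1 = D' + W' + C ∧ (Gates.ins P'.1 + {r}).Nodup ∧
      ReflTransGen FanOut P.graph P'.graph := by
  induction h generalizing q o D W C P with
  | leaf v e =>
    have hbal := hB.balance
    have hn₂ : (q ::ₘ v ::ₘ (Gates.ins D + Gates.ins W + (Gates.ins C + {r}))).Nodup := by
      convert hn using 1
      rw [hP]
      simp only [Gates.ins_add, Gates.ins_singleton, Gate.ins, ← Multiset.singleton_add]
      abel
    simp only [Multiset.nodup_cons, Multiset.mem_cons, not_or] at hn₂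
    obtain ⟨⟨hqv, hq⟩, hv, hn₂⟩ := hn₂
    have hCe : e ∈ Gates.ins C + {r} := Multiset.mem_of_le hC (by simp)
    have hCo : Gates.outs C ≤ Gates.ins C + {r} := (Multiset.le_add_right _ _).trans hC
    have hve : v ≠ e := by
      rintro rfl
      exact hv (Multiset.mem_add.2 (.inr hCe))
    have hqe : q ≠ e := by
      rintro rfl
      exact hq (Multiset.mem_add.2 (.inr hCe))
    have hCedge : ∀ n, C.HasEdge n → n ≠ q ∧ n ≠ v := fun n hn => by
      have := Gates.mem_of_hasEdge hCo hn
      exact ⟨by rintro rfl; exact hq (Multiset.mem_add.2 (.inr this)),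
        by rintro rfl; exact hv (Multiset.mem_add.2 (.inr this))⟩
    have hDWedge : ∀ n, Gates.HasEdge (D + W) n → n ≠ v := by
      rintro n hn rfl
      have h1 : n ∈ Gates.ins D + Gates.ins W ∨ n ∈ Gates.ins D + {q} := by
        rcases hn with hn | hn
        · rw [Gates.ins_add] at hn
          exact .inl hn
        · rw [Gates.outs_add, hW.outs] at hn
          exact .inr (hbal ▸ hn)
      simp only [Multiset.mem_add, Multiset.mem_singleton] at h1 hv
      have := Ne.symm hqv
      tauto
    have hqout : q ∈ Gates.outs (D + W) := by
      rw [Gates.outs_add, hW.outs, ← hbal]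
      simp
    have hP₁ : Gates.IsLinear (D + W + {Gate.arrow q e} + C) := by
      have hle : Gates.outs (D + W + {Gate.arrow q e} + C) ≤
          Gates.ins (D + W + {Gate.arrow q e} + C) + {r} := by
        rw [Gates.outs_add, argument_balance hB hW]
        simp only [Gates.ins_add, Gates.ins_singleton, Gate.ins]
        refine Multiset.le_iff_count.2 fun n => ?_
        have h1 := Multiset.le_iff_count.1 hC n
        simp only [Multiset.count_add, Multiset.coe_singleton] at h1 ⊢
        omega
      refine isLinear_of_le hle (Multiset.nodup_of_le ?_ hn)
      rw [hP]
      simp only [Gates.ins_add, Gates.ins_singleton, Gate.ins]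
      refine Multiset.le_iff_count.2 fun n => ?_
      simp only [Multiset.count_add]
      omega
    set f : ℕ → ℕ := Function.update id q e with hf
    have hfq : f q = e := by simp [hf]
    have hfn : ∀ n, n ≠ q → f n = n := fun n hn => by simp [hf, hn]
    have hfD : (Gates.ins D).map f = Gates.ins D := by
      conv_rhs => rw [← Multiset.map_id (Gates.ins D)]
      exact Multiset.map_congr rfl fun n hn => hfn n (by rintro rfl; exact hq (by simp [hn]))
    have hfW : (Gates.ins W).map f = Gates.ins W := by
      conv_rhs => rw [← Multiset.map_id (Gates.ins W)]
      exact Multiset.map_congr rfl fun n hn => hfn n (by rintro rfl; exact hq (by simp [hn]))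
    have hn' : (Gates.ins (D.rename f + W.rename f + C) + {r}).Nodup := by
      rw [Gates.ins_add, Gates.ins_add, Gates.ins_rename, Gates.ins_rename, hfD, hfW, add_assoc]
      exact hn₂
    have hle' : Gates.outs (D.rename f + W.rename f + C) ≤
        Gates.ins (D.rename f + W.rename f + C) + {r} := by
      simp only [Gates.ins_add, Gates.outs_add, Gates.ins_rename, Gates.outs_rename, hW.outs, hfD,
        hfW, ← Multiset.map_add, ← hbal]
      rw [Multiset.map_add, hfD, Multiset.map_singleton, hfq]
      refine Multiset.le_iff_count.2 fun n => ?_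
      have h1 := Multiset.le_iff_count.1 hC n
      simp only [Multiset.count_add, Multiset.coe_singleton] at h1 ⊢
      omega
    have hW' := hW.rename f
    rw [Multiset.map_coe, List.map_map] at hW'
    refine ⟨o.map fun l => (l.1, f l.2), D.rename f, W.rename f, ⟨_, isLinear_of_le hle' hn'⟩,
      ?_, ?_, rfl, hn', ?_⟩
    · have := Plug.cons (hB.rename f) (.nil (σ := σ) (Γ := Γ))
      simpa [hfq] using this
    · rw [List.map_map]
      exact hW'
    · -- the two arrows from `q` to `v` and from `v` to `e` are absorbed
      have e1 : P.graph = Presentation.graph ⟨_, hP₁⟩ := by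
        refine graph_absorb' (C := D + W + {Gate.arrow q v} + C) hve (.inl (.inr ?_)) ?_ ?_
        · simp [Gate.outs]
        · rw [hP, ← Multiset.singleton_add]
          abel
        · dsimp only
          rw [Gates.rename_add, Gates.rename_add, Gates.rename_singleton, Gate.rename,
            Gates.rename_eq_self (D := D + W), Gates.rename_eq_self (D := C)]
          · simp [hqv]
          · exact fun n hn => by simp [(hCedge n hn).2]
          · exact fun n hn => by simp [hDWedge n hn]
      have e2 : Presentation.graph ⟨_, hP₁⟩ = Presentation.graph ⟨_, isLinear_of_le hle' hn'⟩ := by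
        refine graph_absorb' (C := D + W + C) hqe (.inl (.inr ?_)) ?_ ?_
        · rw [Gates.outs_add]
          exact Multiset.mem_add.2 (.inl hqout)
        · rw [← Multiset.singleton_add]
          dsimp only
          abel
        · dsimp only
          rw [Gates.rename_add, Gates.rename_add, Gates.rename_eq_self (D := C)]
          exact fun n hn => hfn n (hCedge n hn).1
      rw [e1, e2]
  | node v a b es₁ es₂ T₁ T₂ h₁ h₂ ih₁ ih₂ =>
    rw [← Multiset.coe_add] at hC
    have hb₁ := h₁.balance
    have hb₂ := h₂.balance
    obtain ⟨f, g, P₁, hfv, hgv, hP₁, hn₁, hm₁⟩ := exists_fanOut (E := T₁ + T₂ + C) (r := r)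
      (hP.trans (by abel)) (argument_le hB hW v)
      (by rw [argument_balance hB hW]; simp) (by
        refine Multiset.le_iff_count.2 fun n => ?_
        have h1 := congrArg (Multiset.count n) hb₁
        have h2 := congrArg (Multiset.count n) hb₂
        have h3 := Multiset.le_iff_count.1 hC n
        simp only [Gates.outs_add, Gates.ins_add, Multiset.count_add] at h1 h2 h3 ⊢
        omega) hn
    have key : ∀ f : ℕ → ℕ, Wires ((o.map fun l => (l.1, f l.2)).map Prod.snd : List ℕ)
        (Gates.rename f W) := fun f => by
      have := hW.rename f
      rw [Multiset.map_coe, List.map_map] at this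
      rw [List.map_map]
      exact this
    simp only [Gates.rename_add, Gates.rename_singleton, Gate.rename, hfv, hgv] at hP₁
    have hBg := argument_balance (hB.rename g) (key g) b
    obtain ⟨o₁, D₁, W₁, P₂, hp₁, hW₁, hP₂, hn₂, hm₂⟩ := ih₁ (hB.rename f) (key f)
      (C := D.rename g + W.rename g + {Gate.arrow (g q) b} + T₂ + C)
      (hP₁.trans (by abel)) (by
        rw [Gates.outs_add, Gates.outs_add, hBg]
        refine Multiset.le_iff_count.2 fun n => ?_
        have h2 := congrArg (Multiset.count n) hb₂
        have h3 := Multiset.le_iff_count.1 hC n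
        simp only [Gates.ins_add, Gates.ins_singleton, Gate.ins, Multiset.count_add] at h2 h3 ⊢
        omega) hn₁
    obtain ⟨o₂, D₂, W₂, P₃, hp₂, hW₂, hP₃, hn₃, hm₃⟩ := ih₂ (hB.rename g) (key g)
      (C := D₁ + W₁ + C) (hP₂.trans (by abel)) (by
        have hpb := hp₁.balance
        rw [List.map_map, show Prod.snd ∘ (fun e : ℕ => (x, e)) = id from rfl, List.map_id] at hpb
        rw [Gates.outs_add, Gates.outs_add, hW₁.outs, ← hpb]
        refine Multiset.le_iff_count.2 fun n => ?_
        have h3 := Multiset.le_iff_count.1 hC n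
        simp only [Gates.ins_add, Multiset.count_add] at h3 ⊢
        omega) hn₂
    refine ⟨o₁ ++ o₂, D₁ + D₂, W₁ + W₂, P₃, ?_, ?_, hP₃.trans (by abel), hn₃,
      .head hm₁ (hm₂.trans hm₃)⟩
    · rw [List.map_append]
      exact hp₁.append hp₂
    · rw [List.map_append, ← Multiset.coe_add]
      exact hW₁.add hW₂

end Duplication

/-! ### The graphic beta move and the extensionality move -/

section Moves

variable {X Γ : Type*} [DecidableEq X]

/-- The moves that follow the graphic `β` move: once every free occurrence has its own root, the
argument is either erased or copied to the occurrences of the bound variable. -/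
theorem exists_moves_of_redex [Infinite X] {A B : Term X} {x : X} {p q v : ℕ} {o₁ o₂ : List (X × ℕ)}
    {D₁ D₂ T W : Gates Γ} {P : Presentation Γ} (hA : BoundTree A p o₁ D₁)
    (hB : BoundTree B q o₂ D₂) (hT : Binder v (occurrences x o₁) T)
    (hW : Wires (((o₁.filter fun l => l.1 ≠ x) ++ o₂).map Prod.snd : List ℕ) W)
    (hP : P.1 = D₁ + T + D₂ + {Gate.arrow q v} + W) (hn : (Gates.ins P.1 + {p}).Nodup) :
    ∃ H : GRAPH Γ, IsConversion (A.subst x B) H ∧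
      ReflTransGen (fun G G' => FanOutMove G G' ∨ CoAssocMove G G' ∨ PruningMove G G')
        P.graph H := by
  rw [List.map_append, ← Multiset.coe_add] at hW
  obtain ⟨W₁, W₂, hW₁, hW₂, rfl⟩ := hW.exists_add
  have hocc := occurrences_add_filter x o₁
  have hbA := hA.balance
  have hC : Gates.outs (D₁ + W₁) + (occurrences x o₁ : Multiset ℕ) ≤
      Gates.ins (D₁ + W₁) + {p} := by
    rw [Gates.outs_add, hW₁.outs, Gates.ins_add]
    refine Multiset.le_iff_count.2 fun n => ?_
    have h1 := congrArg (Multiset.count n) hocc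
    have h2 := congrArg (Multiset.count n) hbA
    simp only [Multiset.count_add] at h1 h2 ⊢
    omega
  have hfan : ∀ {G H : GRAPH Γ}, ReflTransGen FanOut G H →
      ReflTransGen (fun G G' => FanOutMove G G' ∨ CoAssocMove G G' ∨ PruningMove G G') G H :=
    fun h => ReflTransGen.mono (fun _ _ h => .inl (.inl h)) _ _ h
  have hfan' : ∀ {G H : GRAPH Γ}, ReflTransGen FanOut H G →
      ReflTransGen (fun G G' => FanOutMove G G' ∨ CoAssocMove G G' ∨ PruningMove G G') G H :=
    fun h => ReflTransGen.mono (fun _ _ h => .inl (.inr h)) _ _ (ReflTransGen.swap _ _ h)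
  obtain ⟨o', D', W', P', hplug, hW', hP', hn', hm⟩ : ∃ (o' : List (X × ℕ)) (D' W' : Gates Γ)
      (P' : Presentation Γ), Plug (Function.update Term.var x B)
        ((occurrences x o₁).map fun e => (x, e)) o' D' ∧
      Wires (o'.map Prod.snd : List ℕ) W' ∧ P'.1 = D' + W' + (D₁ + W₁) ∧
      (Gates.ins P'.1 + {p}).Nodup ∧
      ReflTransGen (fun G G' => FanOutMove G G' ∨ CoAssocMove G G' ∨ PruningMove G G')
        P.graph P'.graph := by
    rcases hT with ⟨h0, rfl⟩ | hT
    · -- the bound variable is not used: the argument ends in a `⊤` gate and is pruned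
      have hle : Gates.outs (D₁ + W₁) ≤ Gates.ins (D₁ + W₁) + {p} :=
        (Multiset.le_add_right _ _).trans hC
      have hn₂ : ((Gates.ins (D₂ + W₂ + {Gate.arrow q v}) + {v}) +
          (Gates.ins (D₁ + W₁) + {p})).Nodup := by
        convert hn using 1
        rw [hP]
        simp only [Gates.ins_add, Gates.ins_singleton, Gate.ins]
        abel
      rw [Multiset.nodup_add, Multiset.disjoint_left] at hn₂
      obtain ⟨hnK, hnE, hd⟩ := hn₂
      have hK := argument_le hB hW₂ v
      refine ⟨[], 0, 0, ⟨_, isLinear_of_le hle hnE⟩, ?_, .zero, by simp, hnE,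
        .single (.inr (.inr (.inr (.mk P ⟨_, isLinear_of_le hle hnE⟩
          (D₂ + W₂ + {Gate.arrow q v}) (D₁ + W₁) v ?_ (fun n h h' => ?_) ?_ rfl))))⟩
      · rw [h0]
        exact .nil
      · refine Gates.oneOutput_of_le hK ?_ ?_
        · rw [argument_balance hB hW₂]
          simp
        · rw [add_comm, Multiset.singleton_add, Multiset.nodup_cons] at hnK
          exact hnK.1
      · exact hd (Gates.mem_of_hasEdge hK h) (Gates.mem_of_hasEdge hle h')
      · rw [hP]
        abel
    · obtain ⟨o', D', W', P', h1, h2, h3, h4, h5⟩ := hT.exists_copies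
        (σ := Function.update Term.var x B) (x := x) (by rwa [Function.update_self]) hW₂
        (hP.trans (by abel)) hC hn
      exact ⟨o', D', W', P', h1, h2, h3, h4, hfan h5⟩
  obtain ⟨o'', hp, ho''⟩ := hplug.interleave
  obtain ⟨H, hH, hmH⟩ := exists_isConversion_of_wires (hA.substAll hp) (W := W' + W₁) (P := P')
    (by rw [ho'']; exact hW'.add hW₁) (hP'.trans (by abel)) hn'
  exact ⟨H, hH, hm.trans (hfan' hmH)⟩

theorem exists_betaMove [Infinite X] {A B : Term X} {x : X} {G : GRAPH Γ}
    (hG : IsConversion (.app (.lam x A) B) G) :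
    ∃ G₁ H : GRAPH Γ, BetaMove G G₁ ∧ IsConversion (A.subst x B) H ∧
      ReflTransGen (fun G G' => FanOutMove G G' ∨ CoAssocMove G G' ∨ PruningMove G G') G₁ H := by
  obtain ⟨r, o, D, u, F, P, hA, hF, hP, hn, rfl⟩ := isConversion_iff.1 hG
  have hu := (nodup_outs_of_balance (conversion_balance hA hF) (hP ▸ hn)).2
  have hlab := fun y => (hA.mem_labels (x := y)).1
  obtain ⟨c, q, o', o₂, D', D₂, hL, hB, rfl, rfl⟩ := BoundTree.app_iff.1 hA
  obtain ⟨p, v, o₁, D₁, T, hA₁, hT, rfl, rfl⟩ := BoundTree.lam_iff.1 hL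
  set S := (Term.app (.lam x A) B).fv
  -- the graph after the `β` move
  have hP₁ : Gates.IsLinear (D₁ + T + D₂ + ∑ y ∈ S, F y +
      {Gate.arrow p r, Gate.arrow q v}) := by
    have := P.2
    rw [hP] at this
    refine this.of_le ?_ ?_ <;>
    · refine Multiset.le_iff_count.2 fun n => ?_
      simp only [Gates.ins_add, Gates.outs_add, Multiset.insert_eq_cons,
        ← Multiset.singleton_add, Gates.ins_singleton, Gates.outs_singleton, Gate.ins, Gate.outs,
        Multiset.count_add]
      omega
  have hbeta : BetaMove P.graph (Presentation.graph ⟨_, hP₁⟩) := by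
    refine .mk P ⟨_, hP₁⟩ _ p v r q c ?_ rfl
    rw [hP]
    simp only [Multiset.insert_eq_cons, ← Multiset.singleton_add]
    abel
  obtain ⟨W, P₂, hW, hi, hP₂, hm⟩ := exists_wires_freeTrees (S := S) hF (P := ⟨_, hP₁⟩)
    (C := D₁ + T + D₂ + {Gate.arrow p r, Gate.arrow q v}) (by dsimp only; abel) (by
      intro y hy h
      refine hu (u y) (Multiset.mem_sum.2 ⟨y, hy, Multiset.mem_singleton_self _⟩) ?_
      simp only [Gates.outs_add, Multiset.insert_eq_cons, ← Multiset.singleton_add,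
        Gates.outs_singleton, Gate.outs, Multiset.mem_add, Multiset.mem_singleton] at h ⊢
      tauto)
  rw [sum_occurrences hlab] at hW
  -- the arrow from the root of `A` to the free root `r` is absorbed
  have hP₃ : Gates.IsLinear (D₁ + T + D₂ + {Gate.arrow q v} + W) := by
    have := P₂.2
    rw [hP₂] at this
    refine this.of_le ?_ ?_ <;>
    · refine Multiset.le_iff_count.2 fun n => ?_
      simp only [Gates.ins_add, Gates.outs_add, Multiset.insert_eq_cons,
        ← Multiset.singleton_add, Gates.ins_singleton, Gates.outs_singleton, Gate.ins, Gate.outs,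
        Multiset.count_add]
      omega
  have hn₃ : (Gates.ins (D₁ + T + D₂ + {Gate.arrow q v} + W) + {p}).Nodup := by
    have := P₂.2.1
    rw [hP₂] at this
    convert this using 1
    simp only [Gates.ins_add, Multiset.insert_eq_cons, ← Multiset.singleton_add,
      Gates.ins_singleton, Gate.ins]
    abel
  have hr : ¬ Gates.HasEdge (D₁ + T + D₂ + {Gate.arrow q v} + W) r := by
    rintro (h | h)
    · refine Multiset.disjoint_right.1 (Multiset.nodup_add.1 hn).2.2
        (Multiset.mem_singleton_self r) ?_
      rw [hP]
      have := fun h => Multiset.mem_of_le hi (a := r) h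
      simp only [Gates.ins_add, Gates.ins_singleton, Gate.ins, Multiset.mem_add,
        Multiset.mem_singleton, Multiset.insert_eq_cons, Multiset.mem_cons] at h this ⊢
      tauto
    · have := P₂.2.2
      rw [hP₂] at this
      have := Multiset.nodup_iff_count_le_one.1 this r
      have h := Multiset.count_pos.2 h
      simp only [Gates.outs_add, Multiset.insert_eq_cons,
        ← Multiset.singleton_add, Gates.outs_singleton, Gate.outs,
        Multiset.count_add, Multiset.count_singleton_self] at this h
      omega
  have hp : Gates.HasEdge (D₁ + T + D₂ + {Gate.arrow q v} + W) p := by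
    have h1 : p ∈ Gates.outs D₁ + (o₁.map Prod.snd : List ℕ) := by
      rw [← hA₁.balance]
      simp
    have h2 : p ∈ (occurrences x o₁ : Multiset ℕ) → p ∈ Gates.outs T + {v} := fun h => by
      rw [← hT.balance]
      exact Multiset.mem_add.2 (.inr h)
    rw [← occurrences_add_filter x o₁] at h1
    right
    simp only [Gates.outs_add, hW.outs, Gates.outs_singleton, Gate.outs, List.map_append,
      ← Multiset.coe_add, Multiset.mem_add] at h1 h2 ⊢
    tauto
  have e : P₂.graph = Presentation.graph ⟨_, hP₃⟩ := by
    refine graph_absorb_tgt (D' := ⟨_, hP₃⟩) hp hr ?_ rfl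
    rw [hP₂]
    simp only [Multiset.insert_eq_cons, ← Multiset.singleton_add]
    abel
  obtain ⟨H, hH, hmH⟩ := exists_moves_of_redex hA₁ hB hT hW (P := ⟨_, hP₃⟩) rfl hn₃
  refine ⟨_, H, hbeta, hH, .trans ?_ hmH⟩
  rw [← e]
  exact ReflTransGen.mono (fun _ _ h => .inl (.inl h)) _ _ hm

theorem fanTree_singleton_iff {v e : ℕ} {T : Gates Γ} :
    FanTree v [e] T ↔ T = {Gate.arrow v e} := by
  constructor
  · intro h
    generalize hes : [e] = es at h
    cases h with
    | leaf => rw [(List.cons.inj hes).1]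
    | node v a b es₁ es₂ T₁ T₂ h₁ h₂ =>
      have := congrArg List.length hes
      have := List.length_pos_of_ne_nil h₁.ne_nil
      have := List.length_pos_of_ne_nil h₂.ne_nil
      simp at *
      omega
  · rintro rfl
    exact .leaf v e

theorem Term.fv_eta {A : Term X} {x : X} (hx : x ∉ A.fv) :
    (Term.lam x (.app A (.var x))).fv = A.fv := by
  ext y
  simp only [Term.fv, Finset.mem_erase, Finset.mem_union, Finset.mem_singleton]
  constructor
  · tauto
  · exact fun h => ⟨by rintro rfl; exact hx h, .inl h⟩

/-- The graphs of `λ x. A x`: the pattern of (ext1), with an arrow from the left leg `v` of the `λ`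
gate to the right entry `q` of the `⋏` gate, on top of a graph of `A`. -/
theorem boundTree_eta_iff {A : Term X} {x : X} (hx : x ∉ A.fv) {r : ℕ} {o : List (X × ℕ)}
    {D : Gates Γ} : BoundTree (.lam x (.app A (.var x))) r o D ↔ ∃ a q s v D₁,
      BoundTree A a o D₁ ∧
      D = D₁ + {Gate.app a q s} + {Gate.arrow v q} + {Gate.lam s v r} := by
  have h2 : ∀ q : ℕ, occurrences x [(x, q)] = [q] := fun q => by simp [occurrences]
  have h3 : ∀ q : ℕ, ([(x, q)].filter fun l => l.1 ≠ x) = [] := fun q => by simp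
  rw [BoundTree.lam_iff]
  constructor
  · rintro ⟨s, v, o₁, D₁, T, h, hT, rfl, rfl⟩
    obtain ⟨a, q, o, o₂, D, D₂, hA, hx', rfl, rfl⟩ := BoundTree.app_iff.1 h
    obtain ⟨rfl, rfl⟩ := BoundTree.var_iff.1 hx'
    have h1 : occurrences x o = [] := hA.occurrences_eq_nil.2 hx
    rw [occurrences_append, h1, h2, List.nil_append] at hT
    rcases hT with ⟨h, -⟩ | hT
    · simp at h
    rw [fanTree_singleton_iff.1 hT]
    refine ⟨a, q, s, v, D, ?_, by simp⟩
    rwa [List.filter_append, filter_ne_of_occurrences_eq_nil h1, h3, List.append_nil]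
  · rintro ⟨a, q, s, v, D₁, hA, rfl⟩
    have h1 : occurrences x o = [] := hA.occurrences_eq_nil.2 hx
    have h4 : Binder v (occurrences x (o ++ [(x, q)])) ({Gate.arrow v q} : Gates Γ) := by
      rw [occurrences_append, h1, h2, List.nil_append]
      exact .inr (.leaf v q)
    refine ⟨s, v, _, _, _, .app A (.var x) a q s _ _ _ _ hA (.var x q), h4, ?_, by simp⟩
    · rw [List.filter_append, filter_ne_of_occurrences_eq_nil h1, h3, List.append_nil]

/-- The root of a transformation has a source or is a free variable. -/
theorem hasEdge_root {A : Term X} {r : ℕ} {o : List (X × ℕ)} {D : Gates Γ} {v : X → ℕ}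
    {T : X → Gates Γ} (hA : BoundTree A r o D)
    (hT : ∀ x ∈ A.fv, FanTree (v x) (occurrences x o) (T x)) :
    Gates.HasEdge (D + ∑ x ∈ A.fv, T x) r := by
  have h : r ∈ Gates.outs (D + ∑ x ∈ A.fv, T x) + ∑ x ∈ A.fv, {v x} := by
    rw [← conversion_balance hA hT]
    simp
  rcases Multiset.mem_add.1 h with h | h
  · exact .inr h
  · obtain ⟨x, hx, h⟩ := Multiset.mem_sum.1 h
    obtain rfl := Multiset.mem_singleton.1 h
    left
    rw [Gates.ins_add, Gates.ins_sum]
    exact Multiset.mem_add.2 (.inr (Multiset.mem_sum.2 ⟨x, hx, (hT x hx).root_mem⟩))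

/-- The arrow from `v` to `q` is absorbed before the move, and the arrow from `a` to `r` after it. -/
theorem exists_ext1Move {P : Presentation Γ} {E : Gates Γ} {a q s v r : ℕ}
    (hP : P.1 = E + {Gate.app a q s} + {Gate.arrow v q} + {Gate.lam s v r})
    (hn : (Gates.ins P.1 + {r}).Nodup) (ha : E.HasEdge a) :
    ∃ P' : Presentation Γ, P'.1 = E ∧ Ext1Move P.graph P'.graph := by
  have hPl := P.2
  have hcount := fun n => Multiset.nodup_iff_count_le_one.1 hn n
  have hcount' := fun n => Multiset.nodup_iff_count_le_one.1 P.2.2 n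
  rw [hP] at hPl hcount hcount'
  simp only [Gates.ins_add, Gates.outs_add, Gates.ins_singleton, Gates.outs_singleton, Gate.ins,
    Gate.outs, Multiset.insert_eq_cons, ← Multiset.singleton_add, Multiset.count_add]
    at hcount hcount'
  have hone : ∀ n : ℕ, Multiset.count n ({n} : Multiset ℕ) = 1 := Multiset.count_singleton_self
  have hE : E.IsLinear := by
    refine hPl.of_le ?_ ?_ <;>
    · refine Multiset.le_iff_count.2 fun n => ?_
      simp only [Gates.ins_add, Gates.outs_add, Multiset.count_add]
      omega
  have hP₁ : Gates.IsLinear (E + {Gate.app a q s, Gate.lam s q r}) := by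
    refine hPl.of_le ?_ ?_ <;>
    · refine Multiset.le_iff_count.2 fun n => ?_
      simp only [Gates.ins_add, Gates.outs_add, Gates.ins_singleton, Gates.outs_singleton,
        Gate.ins, Gate.outs, Multiset.insert_eq_cons, ← Multiset.singleton_add,
        Multiset.count_add]
      omega
  have hP₂ : Gates.IsLinear (E + {Gate.arrow a r}) := by
    refine hPl.of_le ?_ ?_ <;>
    · refine Multiset.le_iff_count.2 fun n => ?_
      simp only [Gates.ins_add, Gates.outs_add, Gates.ins_singleton, Gates.outs_singleton,
        Gate.ins, Gate.outs, Multiset.insert_eq_cons, ← Multiset.singleton_add,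
        Multiset.count_add]
      omega
  have hva : v ≠ a := by
    rintro rfl
    have := hcount v
    rw [hone] at this
    omega
  have hvq : v ≠ q := by
    rintro rfl
    have := hcount v
    rw [hone] at this
    omega
  have hvs : v ≠ s := by
    rintro rfl
    have := hcount v
    rw [hone] at this
    omega
  have hvr : v ≠ r := by
    rintro rfl
    have := hcount v
    rw [hone] at this
    omega
  have hra : r ≠ a := by
    rintro rfl
    have := hcount r
    rw [hone] at this
    omega
  have hvE : ∀ n, E.HasEdge n → n ≠ v := by
    rintro n (h | h) rfl <;> have h := Multiset.count_pos.2 h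
    · have := hcount n
      rw [hone] at this
      omega
    · have := hcount' n
      rw [hone] at this
      omega
  have hrE : ¬ E.HasEdge r := by
    rintro (h | h) <;> have h := Multiset.count_pos.2 h
    · have := hcount r
      rw [hone] at this
      omega
    · have := hcount' r
      rw [hone] at this
      omega
  have e1 : P.graph = Presentation.graph ⟨_, hP₁⟩ := by
    refine graph_absorb' (C := E + {Gate.app a q s} + {Gate.lam s v r}) hvq
      (.inl (.inr (by simp [Gate.outs]))) ?_ ?_
    · rw [hP, ← Multiset.singleton_add]
      abel
    · simp only [Gates.rename_add, Gates.rename_singleton, Gate.rename]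
      rw [Gates.rename_eq_self fun n hn => by simp [hvE n hn]]
      simp [hva.symm, hvq.symm, hvs.symm, hvr.symm, ← Multiset.singleton_add, add_assoc]
  have e2 : Presentation.graph ⟨_, hP₂⟩ = Presentation.graph ⟨_, hE⟩ :=
    graph_absorb_tgt (C := E) ha hrE (by dsimp only; rw [add_comm, Multiset.singleton_add]) rfl
  refine ⟨⟨E, hE⟩, rfl, ?_⟩
  rw [e1, ← e2]
  refine .mk ⟨_, hP₁⟩ ⟨_, hP₂⟩ E a r s q rfl rfl fun h => ?_
  rcases ReflTransGen.cases_head h with h | ⟨_, ⟨g, hg, hi, -⟩, -⟩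
  · exact hra h
  · have h : r ∈ Gates.ins (E + {Gate.app a q s, Gate.lam s q r}) := Gates.mem_ins.2 ⟨g, hg, hi⟩
    have h := Multiset.count_pos.2 h
    simp only [Gates.ins_add, Gates.ins_singleton, Gate.ins, Multiset.insert_eq_cons,
      ← Multiset.singleton_add, Multiset.count_add] at h
    have := hcount r
    rw [hone] at this
    omega

theorem exists_ext1Move_of_eta {A : Term X} {x : X} (hx : x ∉ A.fv) {G : GRAPH Γ}
    (hG : IsConversion (.lam x (.app A (.var x))) G) :
    ∃ H : GRAPH Γ, IsConversion A H ∧ Ext1Move G H := by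
  obtain ⟨r, o, D, u, F, P, hL, hF, hP, hn, rfl⟩ := isConversion_iff.1 hG
  rw [Term.fv_eta hx] at hF hP
  obtain ⟨a, q, s, v, D₁, hA, rfl⟩ := (boundTree_eta_iff hx).1 hL
  obtain ⟨P', hP', hm⟩ := exists_ext1Move (E := D₁ + ∑ y ∈ A.fv, F y) (hP.trans (by abel)) hn
    (hasEdge_root hA hF)
  refine ⟨_, isConversion_iff.2 ⟨a, o, D₁, u, F, P', hA, hF, hP', ?_, rfl⟩, hm⟩
  refine Multiset.nodup_of_le ?_ hn
  rw [hP, hP']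
  refine Multiset.le_iff_count.2 fun n => ?_
  simp only [Gates.ins_add, Gates.ins_singleton, Gate.ins, Multiset.insert_eq_cons,
    ← Multiset.singleton_add, Multiset.count_add]
  omega

theorem exists_eta_of_isConversion {A : Term X} {x : X} (hx : x ∉ A.fv) {H : GRAPH Γ}
    (hH : IsConversion A H) :
    ∃ G : GRAPH Γ, IsConversion (.lam x (.app A (.var x))) G ∧ Ext1Move G H := by
  obtain ⟨a, o, D₁, u, F, P', hA, hF, hP', hn, rfl⟩ := isConversion_iff.1 hH
  obtain ⟨q, hq⟩ := exists_notMem_multiset (Gates.ins P'.1 + {a})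
  have hn₁ := Multiset.nodup_cons.2 ⟨hq, hn⟩
  obtain ⟨s, hs⟩ := exists_notMem_multiset (q ::ₘ (Gates.ins P'.1 + {a}))
  have hn₂ := Multiset.nodup_cons.2 ⟨hs, hn₁⟩
  obtain ⟨v, hv⟩ := exists_notMem_multiset (s ::ₘ q ::ₘ (Gates.ins P'.1 + {a}))
  have hn₃ := Multiset.nodup_cons.2 ⟨hv, hn₂⟩
  obtain ⟨r, hr⟩ := exists_notMem_multiset (v ::ₘ s ::ₘ q ::ₘ (Gates.ins P'.1 + {a}))
  have hn₄ := Multiset.nodup_cons.2 ⟨hr, hn₃⟩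
  have hE := (boundTree_eta_iff hx (r := r)).2 ⟨a, q, s, v, D₁, hA, rfl⟩
  have hn' : (Gates.ins (D₁ + {Gate.app a q s} + {Gate.arrow v q} + {Gate.lam s v r} +
      ∑ y ∈ A.fv, F y) + {r}).Nodup := by
    convert hn₄ using 1
    rw [hP']
    simp only [Gates.ins_add, Gates.ins_singleton, Gate.ins, Multiset.insert_eq_cons,
      ← Multiset.singleton_add]
    abel
  have hF' := hF
  rw [← Term.fv_eta hx] at hF'
  have hb := conversion_balance hE hF'
  rw [Term.fv_eta hx] at hb
  have hl := isLinear_of_balance hb hn'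
  obtain ⟨P'', hP'', hm⟩ := exists_ext1Move (P := ⟨_, hl⟩) (E := D₁ + ∑ y ∈ A.fv, F y)
    (by dsimp only; abel) hn' (hasEdge_root hA hF)
  refine ⟨_, isConversion_iff.2 ⟨r, o, _, u, F, ⟨_, hl⟩, hE, hF', ?_, hn', rfl⟩, ?_⟩
  · rw [Term.fv_eta hx]
  · rwa [graph_congr (hP'.trans hP''.symm)]

end Moves

end GLC

open GLC in
theorem theorem3p1 {X : Type*} [DecidableEq X] [Infinite X] {Γ : Type*} [CommGroup Γ] :
    -- (a)
    (∀ A : Term X, (∃ G : GRAPH Γ, IsConversion A G) ∧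
      ∀ G : GRAPH Γ, IsConversion A G → G ∈ lambdaGRAPH Γ) ∧
    -- (b)
    (∀ (A : Term X) (G' G'' : GRAPH Γ), IsConversion A G' → IsConversion A G'' →
      ∃ k ≤ 2 ^ A.leaves, ∃ F : ℕ → GRAPH Γ, F 0 = G' ∧ F k = G'' ∧
        ∀ i < k, CoAssocMove (F i) (F (i + 1))) ∧
    -- (c)
    (∀ (A B : Term X) (G H : GRAPH Γ), Term.Alpha A B → IsConversion A G → IsConversion B H →
      Relation.ReflTransGen CoAssocMove G H) ∧
    -- (d)
    (∀ (A B : Term X) (x : X) (G : GRAPH Γ), IsConversion (.app (.lam x A) B) G →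
      ∃ G₁ H : GRAPH Γ, BetaMove G G₁ ∧ IsConversion (A.subst x B) H ∧
        Relation.ReflTransGen (fun G G' => FanOutMove G G' ∨ CoAssocMove G G' ∨ PruningMove G G')
          G₁ H) ∧
    -- (e)
    (∀ (A : Term X) (x : X), x ∉ A.fv →
      (∀ G : GRAPH Γ, IsConversion (.lam x (.app A (.var x))) G →
        ∃ H : GRAPH Γ, IsConversion A H ∧ Ext1Move G H) ∧
      (∀ H : GRAPH Γ, IsConversion A H →
        ∃ G : GRAPH Γ, IsConversion (.lam x (.app A (.var x))) G ∧ Ext1Move G H)) := by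
  refine ⟨fun A => ⟨exists_isConversion A, fun G hG => mem_lambdaGRAPH_of_isConversion hG⟩,
    fun A G' G'' h' h'' => ?_, fun A B G H hAB hG hH => ?_, fun A B x G hG => exists_betaMove hG,
    fun A x hx => ⟨fun G hG => exists_ext1Move_of_eta hx hG,
      fun H hH => exists_eta_of_isConversion hx hH⟩⟩
  · obtain ⟨k, hk, hs⟩ := coAssocSteps_of_isConversion h' h''
    exact ⟨k, hk, hs.exists_path⟩
  · obtain ⟨k, -, hs⟩ := coAssocSteps_of_isConversion (hAB.isConversion_iff.1 hG) hH
    exact hs.reflTransGen
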